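/- **Theorem 1.** Let $1\le p\le n$ and let $A$ be a $p\times n$ matrix of non-negative integers with rows $\alpha_1,\dots,\alpha_p$ and columns $\alpha^1,\dots,\alpha^n$; write $|\alpha^j|$ for the sum of the entries of $\alpha^j$. Let $f=\zeta^A=(\zeta^{\alpha_1},\dots,\zeta^{\alpha_p}):\mathbb C^n\to\mathbb C^p$. Write a smooth compactly supported test form of bidegree $(n,n-p)$ as $\varphi=\sum_{\#I=p}\varphi_I\,d\zeta\wedge d\bar\zeta[I]$, where $I=\{i_1<\dots<i_p\}\subset\{1,\dots,n\}$, $d\zeta=d\zeta_1\wedge\dots\wedge d\zeta_n$, and $d\bar\zeta[I]$ is the exterior product, in increasing order, of the $d\bar\zeta_j$ with $j\notin I$. The Bochner–Martinelli residue current of $f$ is $$T_f(\varphi)=\lim_{\eta\to0+}\frac{(-1)^{p(p-1)/2}(p-1)!}{(2\pi i)^p}\int_{\|f\|^2=\eta}\frac{1}{\|f\|^{2p}}\sum_{k=1}^p(-1)^{k-1}\bar f_k\bigwedge_{l\ne k}\overline{df_l}\wedge\varphi ,$$ the hypersurface $\{\|f\|^2=\eta\}$ being oriented as the boundary of $\{\|f\|^2<\eta\}$.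 For $\#I=p$ let $A_I$ be the square matrix with columns $\alpha^j$, $j\in I$ (in increasing order), $\Delta_I=\det A_I$, $c_I=(-1)^{i_1+\dots+i_p-p(p+1)/2+(n-p+1)(n-p)/2}$, $$K_0^I=\{x\in\mathbb R^p:\langle\alpha^k,x\rangle\ge0\ (k\in I),\ x_1+\dots+x_p\le0\},$$ and let $q=q(I)$ be the codimension of the cone $K_0^I$ in $\mathbb R^p$. If $\Delta_I\neq0$ and $q\ge1$, there is exactly one set $J=J(I)\subset I$ with $q$ elements such that $$K_0^I=\{x:\langle\alpha^j,x\rangle=0\ (j\in J),\ \langle\alpha^k,x\rangle\ge0\ (k\in I\setminus J)\}.$$ For every test form $\varphi$ the limit defining $T_{\zeta^A}(\varphi)$ exists, and $T_{\zeta^A}=\sum_{\#I=p}T^I$, where $T^I(\varphi)=T_{\zeta^A}(\varphi_I\,d\zeta\wedge d\bar\zeta[I])$ is given as follows. If $\Delta_I=0$ or $q(I)=0$, then $T^I=0$. If $\Delta_I\ne0$ and $q(I)\ge1$, then, with $J=J(I)$, $$T^I=\frac{\operatorname{sgn}(\Delta_I)\,c_I}{(2\pi i)^p}\bigwedge_{j\in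 J}\bar\partial\Big[\frac1{\zeta_j^{|\alpha^j|}}\Big]\bigwedge_{k\in I\setminus J}\Big(\frac1{\zeta_k^{|\alpha^k|}\bar\zeta_k}\Big)\bigwedge_{l\notin I}\Big[\frac1{\zeta_l^{|\alpha^l|}}\Big]\,F(|\zeta_1|^2,\dots,|\zeta_n|^2).$$ Here the value of the product on $\varphi$ means the limit, as $\varepsilon_1,\dots,\varepsilon_n\to0+$ independently, of the integral over $\{|\zeta_j|=\varepsilon_j\ (j\in J),\ |\zeta_k|>\varepsilon_k\ (k\notin J)\}$ of $$\varphi_I(\zeta)\,F(|\zeta_1|^2,\dots,|\zeta_n|^2)\prod_{j\in J}\frac{d\zeta_j}{\zeta_j^{|\alpha^j|}}\prod_{k\in I\setminus J}\frac{d\bar\zeta_k\wedge d\zeta_k}{\zeta_k^{|\alpha^k|}\bar\zeta_k}\prod_{l\notin I}\frac{d\bar\zeta_l\wedge d\zeta_l}{\zeta_l^{|\alpha^l|}}$$ (circles oriented counterclockwise), and this limit exists. The hypergeometric function $F$, which does not depend on the variables $x_j$ with $j\in J$, is the Mellin–Barnes integral, absolutely convergent for positive $x_1,\dots,x_n$,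 $$F(x)=\frac1{(2\pi i)^{p-q}}\int_{i\mathbb R^{p-q}}\prod_{l=1}^p\Gamma\Big(1-\sum_{j\in I\setminus J}\beta_j^l\lambda_j\Big)\prod_{j\in I\setminus J}\Big(x_j\prod_{k\notin I}x_k^{\langle\alpha^k,\beta_j\rangle}\Big)^{\lambda_j}\prod_{j\in I\setminus J}d\lambda_j ,$$ where $\beta_j=(\beta_j^1,\dots,\beta_j^p)$ is the row of $A_I^{-1}$ with index $j\in I$. In particular, if $J=I$, then $$T^I=\frac{\operatorname{sgn}(\Delta_I)\,c_I}{(2\pi i)^p}\bigwedge_{j\in I}\bar\partial\Big[\frac1{\zeta_j^{|\alpha^j|}}\Big]\bigwedge_{l\notin I}\Big[\frac1{\zeta_l^{|\alpha^l|}}\Big].$$ -/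

import Mathlib

open Filter Topology MeasureTheory
open scoped ContDiff ComplexConjugate

noncomputable section

namespace BMResidue

/-- The space `ℂⁿ` with its Hermitian (hence Euclidean) norm. -/
abbrev Cn (n : ℕ) : Type := EuclideanSpace ℂ (Fin n)

/-- The `p`-element subsets `I = {i₁ < ⋯ < i_p}` of the set of indices. -/
abbrev PSubset (n p : ℕ) : Type := {I : Finset (Fin n) // I.card = p}

/-- The increasing enumeration `i₁ < ⋯ < i_p` of `I`. -/
def PSubset.idx {n p : ℕ} (I : PSubset n p) (ν : Fin p) : Fin n :=
  I.1.orderEmbOfFin I.2 ν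

/-! ### Differential forms and integration over level sets -/

/-- Complex-valued real covectors on `ℂⁿ`. -/
abbrev Covector (n : ℕ) : Type := Cn n →L[ℝ] ℂ

/-- `dζ_j`. -/
def dz {n : ℕ} (j : Fin n) : Covector n :=
  (EuclideanSpace.proj j : Cn n →L[ℂ] ℂ).restrictScalars ℝ

/-- `dζ̄_j`. -/
def dzBar {n : ℕ} (j : Fin n) : Covector n :=
  (Complex.conjCLE : ℂ →L[ℝ] ℂ).comp (dz j)

/-- The exterior product `θ₁ ∧ ⋯ ∧ θ_m` of a list of `m` covectors, evaluated on `m` vectors: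
`(θ₁ ∧ ⋯ ∧ θ_m)(v₁, …, v_m) = det (θ_i (v_j))`. (Only used for lists of length `m`.) -/
def wedge {n m : ℕ} (θ : List (Covector n)) (v : Fin m → Cn n) : ℂ :=
  (Matrix.of fun i j : Fin m => (θ.getD i 0) (v j)).det

/-- The positively oriented real orthonormal basis `e₁, i e₁, e₂, i e₂, …, e_n, i e_n` of `ℂⁿ`,
numbered from `0` to `2n - 1`. -/
def stdFrame (n k : ℕ) : Cn n :=
  if h : k / 2 < n then
    EuclideanSpace.single ⟨k / 2, h⟩ (if k % 2 = 0 then (1 : ℂ) else Complex.I)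
  else 0

/-- The exterior product `dg ∧ ψ` of the differential of a real function and a form `ψ` of degree
`2n - 1`, evaluated on the positively oriented orthonormal basis of `ℂⁿ`. -/
def dWedge {n : ℕ} (g : Cn n → ℝ) (ψ : Cn n → (Fin (2 * n - 1) → Cn n) → ℂ) (z : Cn n) : ℂ :=
  ∑ i : Fin (2 * n - 1 + 1),
    (-1 : ℂ) ^ (i : ℕ) * (fderiv ℝ g z (stdFrame n i) : ℂ) *
      ψ z (i.removeNth fun k : Fin (2 * n - 1 + 1) => stdFrame n k)

/-- The density, with respect to the `(2n-1)`-dimensional surface measure, of the restriction of a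
form `ψ` of degree `2n - 1` to the hypersurface `{g = η}` oriented as the boundary of `{g < η}`.
If `ν = ∇g / |∇g|` is the outer normal and `(ν, t₁, …, t_{2n-1})` is a positively oriented
orthonormal basis, then `ψ(t₁, …, t_{2n-1}) = (dg ∧ ψ)(ν, t₁, …, t_{2n-1}) / |dg|`. -/
def levelDensity {n : ℕ} (g : Cn n → ℝ) (ψ : Cn n → (Fin (2 * n - 1) → Cn n) → ℂ)
    (z : Cn n) : ℂ :=
  dWedge g ψ z / (‖fderiv ℝ g z‖ : ℂ)

/-- The integral of the form `ψ` of degree `2n - 1` over the level hypersurface `{g = η}`, oriented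
as the boundary of `{g < η}`. -/
def levelIntegral {n : ℕ} (g : Cn n → ℝ) (η : ℝ)
    (ψ : Cn n → (Fin (2 * n - 1) → Cn n) → ℂ) : ℂ :=
  ∫ z in {z : Cn n | g z = η}, levelDensity g ψ z ∂(μHE[2 * n - 1])

/-! ### The Bochner–Martinelli residue current -/

/-- A test form `φ = ∑_I φ_I dζ ∧ dζ̄[I]` of bidegree `(n, n - p)`, given by its coefficients
`φ_I`, which are smooth with compact support. Here `dζ = dζ₁ ∧ ⋯ ∧ dζ_n` and `dζ̄[I]` is the
exterior product, in increasing order, of the `dζ̄_j` with `j ∉ I`. -/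
def IsTestForm {n p : ℕ} (φ : PSubset n p → Cn n → ℂ) : Prop :=
  ∀ I, ContDiff ℝ ∞ (φ I) ∧ HasCompactSupport (φ I)

/-- `‖f‖² = ∑ |f_k|²`. -/
def normSqMap {n p : ℕ} (f : Fin p → Cn n → ℂ) (z : Cn n) : ℝ :=
  ∑ k, ‖f k z‖ ^ 2

/-- The conjugate differential of `f`. -/
def dBarConj {n : ℕ} (f : Cn n → ℂ) (z : Cn n) : Covector n :=
  (Complex.conjCLE : ℂ →L[ℝ] ℂ).comp (fderiv ℝ f z)

/-- The form `Ω(f) ∧ φ` of degree `2n - 1`, where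
`Ω(f) = ‖f‖^{-2p} ∑_k (-1)^{k-1} f̄_k ⋀_{l ≠ k} df̄_l`. -/
def omegaWedge {n p : ℕ} (f : Fin p → Cn n → ℂ) (φ : PSubset n p → Cn n → ℂ)
    (z : Cn n) (v : Fin (2 * n - 1) → Cn n) : ℂ :=
  ∑ k : Fin p, ∑ I : PSubset n p,
    ((-1 : ℂ) ^ (k : ℕ) * conj (f k z) / (normSqMap f z : ℂ) ^ p * φ I z) *
      wedge
        (((List.finRange p).filter (fun l => l ≠ k)).map (fun l => dBarConj (f l) z) ++
          (List.finRange n).map dz ++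
          ((List.finRange n).filter (fun j => j ∉ I.1)).map dzBar) v

/-- `c_p = (-1)^{p(p-1)/2} (p-1)! / (2πi)^p`. -/
def bmConst (p : ℕ) : ℂ :=
  (-1) ^ (p * (p - 1) / 2) * ((p - 1).factorial : ℂ) / (2 * Real.pi * Complex.I) ^ p

/-- `T` is the value at `φ` of the Bochner–Martinelli residue current of `f`: for small `η > 0`
the form `Ω(f) ∧ φ` is integrable over `{‖f‖² = η}`, and
`T = lim_{η → 0+} c_p ∫_{‖f‖² = η} Ω(f) ∧ φ`. -/
def HasBMResidue {n p : ℕ} (f : Fin p → Cn n → ℂ) (φ : PSubset n p → Cn n → ℂ) (T : ℂ) : Prop :=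
  (∀ᶠ η in 𝓝[>] (0 : ℝ), IntegrableOn (levelDensity (normSqMap f) (omegaWedge f φ))
    {z : Cn n | normSqMap f z = η} (μHE[2 * n - 1])) ∧
  Tendsto (fun η : ℝ => bmConst p * levelIntegral (normSqMap f) η (omegaWedge f φ))
    (𝓝[>] 0) (𝓝 T)

/-- The `I`-component `φ_I dζ ∧ dζ̄[I]` of the test form `φ`. -/
def component {n p : ℕ} (φ : PSubset n p → Cn n → ℂ) (I : PSubset n p) :
    PSubset n p → Cn n → ℂ :=
  Pi.single I (φ I)

/-- The monomial mapping `ζ^A = (ζ^{α₁}, …, ζ^{α_p})`, where `α_k` are the rows of `A`. -/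
def monomialMap {n p : ℕ} (A : Matrix (Fin p) (Fin n) ℕ) (k : Fin p) (z : Cn n) : ℂ :=
  ∏ j, z j ^ A k j

/-! ### Cones, minors, constants -/

/-- `|α^j|`, the sum of the entries of the `j`-th column of `A`. -/
def colSum {n p : ℕ} (A : Matrix (Fin p) (Fin n) ℕ) (j : Fin n) : ℕ := ∑ k, A k j

/-- `⟨α^j, x⟩`, where `α^j` is the `j`-th column of `A`. -/
def colPair {n p : ℕ} (A : Matrix (Fin p) (Fin n) ℕ) (j : Fin n) (x : Fin p → ℝ) : ℝ :=
  ∑ k, (A k j : ℝ) * x k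

/-- The square matrix `A_I` with columns `α^j`, `j ∈ I`. -/
def subMatrix {n p : ℕ} (A : Matrix (Fin p) (Fin n) ℕ) (I : PSubset n p) :
    Matrix (Fin p) (Fin p) ℝ :=
  Matrix.of fun l ν => (A l (I.idx ν) : ℝ)

/-- The minor `Δ_I = det A_I`. -/
def minor {n p : ℕ} (A : Matrix (Fin p) (Fin n) ℕ) (I : PSubset n p) : ℝ := (subMatrix A I).det

/-- The cone `K₀^I = {x : ⟨α^k, x⟩ ≥ 0 for k ∈ I} ∩ {x₁ + ⋯ + x_p ≤ 0}`. -/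
def cone {n p : ℕ} (A : Matrix (Fin p) (Fin n) ℕ) (I : PSubset n p) : Set (Fin p → ℝ) :=
  {x | (∀ k ∈ I.1, 0 ≤ colPair A k x) ∧ ∑ l, x l ≤ 0}

/-- The codimension `q(I)` of the cone `K₀^I` (which contains the origin) in `ℝ^p`. -/
def codim {n p : ℕ} (A : Matrix (Fin p) (Fin n) ℕ) (I : PSubset n p) : ℕ :=
  p - Module.finrank ℝ (Submodule.span ℝ (cone A I))

/-- `J(I)`, the set of those `j ∈ I` for which `⟨α^j, ·⟩` vanishes on `K₀^I`. -/
def faceSet {n p : ℕ} (A : Matrix (Fin p) (Fin n) ℕ) (I : PSubset n p) : Finset (Fin n) := by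
  classical exact I.1.filter fun j => ∀ x ∈ cone A I, colPair A j x = 0

/-- The face of `{x : ⟨α^k, x⟩ ≥ 0 for k ∈ I}` given by `⟨α^j, x⟩ = 0` for `j ∈ J`. -/
def face {n p : ℕ} (A : Matrix (Fin p) (Fin n) ℕ) (I : PSubset n p) (J : Finset (Fin n)) :
    Set (Fin p → ℝ) :=
  {x | (∀ j ∈ J, colPair A j x = 0) ∧ ∀ k ∈ I.1 \ J, 0 ≤ colPair A k x}

/-- `c_I = (-1)^{|I| - p(p+1)/2 + (n-p+1)(n-p)/2}`, where `|I| = i₁ + ⋯ + i_p` with indices counted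
from `1`. -/
def signConst {n p : ℕ} (I : PSubset n p) : ℂ :=
  (-1) ^ (∑ i ∈ I.1, ((i : ℕ) + 1) + p * (p + 1) / 2 + (n - p + 1) * (n - p) / 2)

/-! ### The hypergeometric function -/

/-- The positions `ν` in `I = {i₁ < ⋯ < i_p}` with `i_ν ∈ I ∖ J`. -/
abbrev FreeIdx {n p : ℕ} (I : PSubset n p) (J : Finset (Fin n)) : Type :=
  {ν : Fin p // I.idx ν ∉ J}

/-- The integrand of the Mellin–Barnes integral at `λ = i t`,
`∏_l Γ(1 - ∑_j β_j^l λ_j) ∏_j (x_j ∏_{k ∉ I} x_k^{⟨α^k, β_j⟩})^{λ_j}`, with `j` running over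
`I ∖ J` and `β_j = (β_j^1, …, β_j^p)` the rows of `A_I⁻¹`. -/
def mbIntegrand {n p : ℕ} (A : Matrix (Fin p) (Fin n) ℕ) (I : PSubset n p) (J : Finset (Fin n))
    (x : Fin n → ℝ) (t : FreeIdx I J → ℝ) : ℂ :=
  (∏ l : Fin p,
      Complex.Gamma (1 - ∑ ν : FreeIdx I J,
        (((subMatrix A I)⁻¹ ν.1 l : ℝ) : ℂ) * ((t ν : ℂ) * Complex.I))) *
    ∏ ν : FreeIdx I J,
      ((x (I.idx ν.1) * ∏ k ∈ I.1ᶜ, x k ^ colPair A k ((subMatrix A I)⁻¹ ν.1) : ℝ) : ℂ) ^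
        ((t ν : ℂ) * Complex.I)

/-- The hypergeometric function
`F(x) = (2πi)^{-r} ∫_{(iℝ)^r} ∏_l Γ(1 - ∑_j β_j^l λ_j) ∏_j (x_j ∏_{k ∉ I} x_k^{⟨α^k, β_j⟩})^{λ_j} dλ`,
where `r` is the number of elements of `I ∖ J`; the substitution `λ = i t` has `dλ = i^r dt`. -/
def hyperF {n p : ℕ} (A : Matrix (Fin p) (Fin n) ℕ) (I : PSubset n p) (J : Finset (Fin n))
    (x : Fin n → ℝ) : ℂ :=
  ((2 * Real.pi * Complex.I) ^ Fintype.card (FreeIdx I J))⁻¹ *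
    ∫ t : FreeIdx I J → ℝ, Complex.I ^ Fintype.card (FreeIdx I J) * mbIntegrand A I J x t

/-! ### Products of residue and principal value currents -/

/-- The point of `ℂⁿ` with coordinates `ε_j e^{iθ_j}` for `j ∈ J` and `w_k` for `k ∉ J`. -/
def tubePoint {n : ℕ} (J : Finset (Fin n)) (ε : Fin n → ℝ)
    (w : {k : Fin n // k ∉ J} → ℂ) (θ : {j : Fin n // j ∈ J} → ℝ) : Cn n :=
  WithLp.toLp 2 fun i =>
    if h : i ∈ J then (ε i : ℂ) * Complex.exp ((θ ⟨i, h⟩ : ℂ) * Complex.I) else w ⟨i, h⟩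

/-- The parameters of the tube `{|ζ_j| = ε_j for j ∈ J, |ζ_k| > ε_k for k ∉ J}`. -/
def tubeDomain {n : ℕ} (J : Finset (Fin n)) (ε : Fin n → ℝ) :
    Set (({k : Fin n // k ∉ J} → ℂ) × ({j : Fin n // j ∈ J} → ℝ)) :=
  {w | ∀ k, ε k.1 < ‖w k‖} ×ˢ {θ | ∀ j, θ j ∈ Set.Ioc 0 (2 * Real.pi)}

/-- The integrand, in the parameters of the tube, of
`u(ζ) H(|ζ₁|², …, |ζ_n|²) ∏_{j ∈ J} ζ_j^{-|α^j|} dζ_j`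
`∏_{k ∈ I ∖ J} (ζ_k^{|α^k|} ζ̄_k)⁻¹ dζ̄_k ∧ dζ_k ∏_{l ∉ I} ζ_l^{-|α^l|} dζ̄_l ∧ dζ_l`.
On the circles `dζ_j = i ζ_j dθ_j`, and `dζ̄ ∧ dζ = 2i dx ∧ dy` in the other variables. -/
def tubeIntegrand {n p : ℕ} (A : Matrix (Fin p) (Fin n) ℕ) (I : PSubset n p) (J : Finset (Fin n))
    (H : (Fin n → ℝ) → ℂ) (u : Cn n → ℂ) (ε : Fin n → ℝ)
    (y : ({k : Fin n // k ∉ J} → ℂ) × ({j : Fin n // j ∈ J} → ℝ)) : ℂ :=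
  let z : Cn n := tubePoint J ε y.1 y.2
  u z * H (fun i => ‖z i‖ ^ 2) *
    (∏ j ∈ J, Complex.I * z j / z j ^ colSum A j) *
    (∏ k ∈ I.1 \ J, 2 * Complex.I / (z k ^ colSum A k * conj (z k))) *
    ∏ l ∈ I.1ᶜ, 2 * Complex.I / z l ^ colSum A l

/-- `S` is the value of the product
`⋀_{j ∈ J} ∂̄[1/ζ_j^{|α^j|}] ⋀_{k ∈ I ∖ J} 1/(ζ_k^{|α^k|} ζ̄_k) ⋀_{l ∉ I} [1/ζ_l^{|α^l|}] · H`
on a form with coefficient `u`: the residue factors are limits of integrals over circles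
`|ζ_j| = ε_j`, the other ones are principal values, limits of integrals over `|ζ_k| > ε_k`, and
the limit is taken as all `ε_j → 0+` independently of each other. -/
def HasProductValue {n p : ℕ} (A : Matrix (Fin p) (Fin n) ℕ) (I : PSubset n p)
    (J : Finset (Fin n)) (H : (Fin n → ℝ) → ℂ) (u : Cn n → ℂ) (S : ℂ) : Prop :=
  (∀ ε : Fin n → ℝ, (∀ i, 0 < ε i) →
    IntegrableOn (tubeIntegrand A I J H u ε) (tubeDomain J ε)) ∧
  Tendsto (fun ε : Fin n → ℝ => ∫ y in tubeDomain J ε, tubeIntegrand A I J H u ε y)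
    (𝓝[{ε : Fin n → ℝ | ∀ i, 0 < ε i}] 0) (𝓝 S)

/-- The constant `sgn(Δ_I) c_I / (2πi)^p`. -/
def fullConst {n p : ℕ} (A : Matrix (Fin p) (Fin n) ℕ) (I : PSubset n p) : ℂ :=
  (Real.sign (minor A I) : ℂ) * signConst I / (2 * Real.pi * Complex.I) ^ p

end BMResidue

end

open BMResidue

section

namespace BMResidue

/-! ### The area formula for immersions -/

theorem euclideanHausdorffMeasure_image_le_of_dist_le {V E : Type*} [MetricSpace E]
    [MeasurableSpace E] [BorelSpace E] {f h : V → E} {A : Set V} {c : NNReal} (m : ℕ)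
    (hfh : ∀ a ∈ A, ∀ b ∈ A, dist (f a) (f b) ≤ c * dist (h a) (h b)) :
    μHE[m] (f '' A) ≤ (c : ENNReal) ^ m * μHE[m] (h '' A) := by
  rcases A.eq_empty_or_nonempty with rfl | ⟨a₀, ha₀⟩
  · simp
  have : Nonempty V := ⟨a₀⟩
  have himg : f '' A = (fun y => f (Function.invFunOn h A y)) '' (h '' A) := by
    rw [Set.image_image]
    refine Set.image_congr fun a ha => ?_
    have h1 := Function.invFunOn_mem (f := h) (s := A) ⟨a, ha, rfl⟩
    have h2 := Function.invFunOn_eq (f := h) (s := A) ⟨a, ha, rfl⟩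
    have h3 := hfh a ha _ h1
    rw [h2, dist_self, mul_zero] at h3
    exact dist_le_zero.mp h3
  have hL : LipschitzOnWith c (fun y => f (Function.invFunOn h A y)) (h '' A) := by
    refine LipschitzOnWith.of_dist_le_mul ?_
    rintro _ ⟨a, ha, rfl⟩ _ ⟨b, hb, rfl⟩
    have h1 := Function.invFunOn_mem (f := h) (s := A) ⟨a, ha, rfl⟩
    have h2 := Function.invFunOn_eq (f := h) (s := A) ⟨a, ha, rfl⟩
    have h3 := Function.invFunOn_mem (f := h) (s := A) ⟨b, hb, rfl⟩
    have h4 := Function.invFunOn_eq (f := h) (s := A) ⟨b, hb, rfl⟩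
    have := hfh _ h1 _ h3
    rwa [h2, h4] at this
  have := hL.hausdorffMeasure_image_le (d := m) (by positivity)
  rw [← himg, ENNReal.rpow_natCast] at this
  simp only [Measure.euclideanHausdorffMeasure_def, Measure.smul_apply, ENNReal.smul_def, smul_eq_mul]
  calc _ ≤ _ := mul_le_mul_right this _
    _ = _ := by ring

theorem exists_nhds_bilipschitz {V E : Type*} [NormedAddCommGroup V] [NormedSpace ℝ V]
    [NormedAddCommGroup E] [NormedSpace ℝ E] [FiniteDimensional ℝ V] {Φ : V → E} {L : V →L[ℝ] E}
    {x : V} (hΦ : HasStrictFDerivAt Φ L x) (hL : Function.Injective L) {c : ℝ} (hc : 1 < c) :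
    ∀ᶠ U in (𝓝 x).smallSets, ∀ a ∈ U, ∀ b ∈ U,
      dist (Φ a) (Φ b) ≤ c * dist (L a) (L b) ∧ dist (L a) (L b) ≤ c * dist (Φ a) (Φ b) := by
  obtain ⟨K, hK0, hK⟩ := (LinearMap.injective_iff_antilipschitz L.toLinearMap).mp hL
  have hδ : 0 < (K : ℝ)⁻¹ * (1 - 1 / c) := by
    have : 1 / c < 1 := by rw [div_lt_one (by linarith)]; exact hc
    have hK0' : (0 : ℝ) < K := hK0
    have : 0 < 1 - 1 / c := by linarith
    positivity
  have hev := hΦ.isLittleO.def hδ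
  rw [nhds_prod_eq, Filter.eventually_prod_self_iff'] at hev
  refine Filter.eventually_smallSets.mpr ?_
  obtain ⟨s, hs, hs'⟩ := hev
  refine ⟨s, hs, fun U hU a ha b hb => ?_⟩
  have h1 := hs' a (hU ha) b (hU hb)
  have h2 : ‖a - b‖ ≤ K * ‖L a - L b‖ := by
    have := hK.le_mul_dist a b
    simpa [dist_eq_norm] using this
  have h3 : ‖Φ a - Φ b - (L a - L b)‖ ≤ (1 - 1 / c) * ‖L a - L b‖ := by
    have h1' : ‖Φ a - Φ b - (L a - L b)‖ ≤ (K : ℝ)⁻¹ * (1 - 1 / c) * ‖a - b‖ := by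
      simpa using h1
    refine h1'.trans ?_
    have hK0' : (0 : ℝ) < K := hK0
    calc (K : ℝ)⁻¹ * (1 - 1 / c) * ‖a - b‖ ≤ (K : ℝ)⁻¹ * (1 - 1 / c) * (K * ‖L a - L b‖) := by gcongr
      _ = _ := by field_simp
  rw [dist_eq_norm, dist_eq_norm]
  have h4 : ‖Φ a - Φ b‖ ≤ ‖L a - L b‖ + ‖Φ a - Φ b - (L a - L b)‖ := by
    have := norm_add_le (L a - L b) (Φ a - Φ b - (L a - L b))
    simpa using this
  have h5 : ‖L a - L b‖ ≤ ‖Φ a - Φ b‖ + ‖Φ a - Φ b - (L a - L b)‖ := by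
    have := norm_sub_le (Φ a - Φ b) (Φ a - Φ b - (L a - L b))
    simpa using this
  have hc0 : 0 < c := by linarith
  have hcc : 2 - 1 / c ≤ c := by
    have : 0 ≤ (c - 1) ^ 2 / c := by positivity
    have h : (c - 1) ^ 2 / c = c - (2 - 1 / c) := by field_simp; ring
    linarith
  constructor
  · calc ‖Φ a - Φ b‖ ≤ (2 - 1 / c) * ‖L a - L b‖ := by linarith
      _ ≤ c * ‖L a - L b‖ := by gcongr
  · have : 1 / c * ‖L a - L b‖ ≤ ‖Φ a - Φ b‖ := by linarith
    calc ‖L a - L b‖ = c * (1 / c * ‖L a - L b‖) := by field_simp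
      _ ≤ _ := by gcongr

variable {V E : Type*} [NormedAddCommGroup V] [NormedSpace ℝ V] [NormedAddCommGroup E]
  [NormedSpace ℝ E] [FiniteDimensional ℝ V] [MeasurableSpace V] [BorelSpace V]
  [MeasurableSpace E] [BorelSpace E]

omit [BorelSpace V] in
theorem exists_nhds_area_bound {Φ : V → E} {L : V →L[ℝ] E} {x : V} {m : ℕ} {μ : Measure V}
    (hΦ : HasStrictFDerivAt Φ L x) (hL : Function.Injective L) {j : V → ℝ} (hj : ContinuousAt j x)
    (hjpos : 0 < j x) (hjL : ∀ A, MeasurableSet A → μHE[m] (L '' A) = ENNReal.ofReal (j x) * μ A)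
    {c : NNReal} (hc : 1 < c) :
    ∃ U, IsOpen U ∧ x ∈ U ∧ ∀ A ⊆ U, MeasurableSet A →
      μHE[m] (Φ '' A) ≤ (c : ENNReal) ^ (m + 1) * ∫⁻ y in A, ENNReal.ofReal (j y) ∂μ ∧
      ∫⁻ y in A, ENNReal.ofReal (j y) ∂μ ≤ (c : ENNReal) ^ (m + 1) * μHE[m] (Φ '' A) := by
  have hc' : (1 : ℝ) < c := by exact_mod_cast hc
  have h1 := exists_nhds_bilipschitz hΦ hL hc'
  have h2 : ∀ᶠ y in 𝓝 x, j y < c * j x := hj.eventually_lt continuousAt_const (by nlinarith)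
  have h3 : ∀ᶠ y in 𝓝 x, j x < c * j y :=
    continuousAt_const.eventually_lt (continuousAt_const.mul hj) (by nlinarith)
  obtain ⟨s, hs, hs'⟩ := Filter.eventually_smallSets.mp h1
  obtain ⟨U, hU, hUo, hxU⟩ := mem_nhds_iff.mp (Filter.inter_mem hs (h2.and h3))
  refine ⟨U, hUo, hxU, fun A hA hAm => ?_⟩
  have hb := hs' A (hA.trans (hU.trans Set.inter_subset_left))
  have e1 := euclideanHausdorffMeasure_image_le_of_dist_le (c := c) m fun a ha b hb' => (hb a ha b hb').1
  have e2 := euclideanHausdorffMeasure_image_le_of_dist_le (c := c) m fun a ha b hb' => (hb a ha b hb').2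
  rw [hjL A hAm] at e1 e2
  have hlow : ENNReal.ofReal (j x) * μ A ≤ c * ∫⁻ y in A, ENNReal.ofReal (j y) ∂μ := by
    rw [← lintegral_const_mul' _ _ ENNReal.coe_ne_top, ← setLIntegral_const]
    refine setLIntegral_mono' hAm fun y hy => ?_
    have := (hU (hA hy)).2.2
    rw [← ENNReal.ofReal_coe_nnreal, ← ENNReal.ofReal_mul (by positivity)]
    exact ENNReal.ofReal_le_ofReal this.le
  have hupp : ∫⁻ y in A, ENNReal.ofReal (j y) ∂μ ≤ c * (ENNReal.ofReal (j x) * μ A) := by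
    rw [← mul_assoc, ← setLIntegral_const]
    refine setLIntegral_mono' hAm fun y hy => ?_
    have := (hU (hA hy)).2.1
    rw [← ENNReal.ofReal_coe_nnreal, ← ENNReal.ofReal_mul (by positivity)]
    exact ENNReal.ofReal_le_ofReal this.le
  constructor
  · calc _ ≤ _ := e1
      _ ≤ (c : ENNReal) ^ m * (c * ∫⁻ y in A, ENNReal.ofReal (j y) ∂μ) := by gcongr
      _ = _ := by ring
  · calc _ ≤ _ := hupp
      _ ≤ c * ((c : ENNReal) ^ m * μHE[m] (Φ '' A)) := by gcongr
      _ = _ := by ring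

/-- The area formula for an injective immersion whose derivatives scale volume by `j`. -/
theorem euclideanHausdorffMeasure_image_eq_lintegral {Φ : V → E} {Φ' : V → V →L[ℝ] E} {m : ℕ}
    {μ : Measure V} (hΦ : ∀ x, HasStrictFDerivAt Φ (Φ' x) x)
    (hΦ' : ∀ x, Function.Injective (Φ' x)) {j : V → ℝ} (hj : Continuous j) (hjpos : ∀ x, 0 < j x)
    (hjL : ∀ x A, MeasurableSet A → μHE[m] (Φ' x '' A) = ENNReal.ofReal (j x) * μ A)
    {t : Set V} (ht : MeasurableSet t) (hinj : Set.InjOn Φ t) :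
    μHE[m] (Φ '' t) = ∫⁻ x in t, ENNReal.ofReal (j x) ∂μ := by
  have hΦc : Continuous Φ := continuous_iff_continuousAt.mpr fun x => (hΦ x).continuousAt
  have key : ∀ c : NNReal, 1 < c →
      μHE[m] (Φ '' t) ≤ (c : ENNReal) ^ (m + 1) * ∫⁻ y in t, ENNReal.ofReal (j y) ∂μ ∧
      ∫⁻ y in t, ENNReal.ofReal (j y) ∂μ ≤ (c : ENNReal) ^ (m + 1) * μHE[m] (Φ '' t) := by
    intro c hc
    choose U hUo hxU hU using fun x =>
      exists_nhds_area_bound (hΦ x) (hΦ' x) hj.continuousAt (hjpos x) (hjL x) hc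
    obtain ⟨s, hs, hsU⟩ := TopologicalSpace.countable_cover_nhds fun x => (hUo x).mem_nhds (hxU x)
    have hne : s.Nonempty := by
      by_contra h
      rw [Set.not_nonempty_iff_eq_empty] at h
      subst h
      have h0 : (0 : V) ∈ (Set.univ : Set V) := trivial
      rw [← hsU] at h0
      simp at h0
    obtain ⟨f, hf⟩ := hs.exists_eq_range hne
    have hcov : ⋃ n, U (f n) = Set.univ := by
      rw [← hsU, hf, Set.biUnion_range]
    set D := disjointed fun n => U (f n) with hD
    have hDm : ∀ n, MeasurableSet (D n) := fun n =>
      MeasurableSet.disjointed (fun n => (hUo (f n)).measurableSet) n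
    have htD : t = ⋃ n, t ∩ D n := by
      rw [← Set.inter_iUnion, hD, iUnion_disjointed, hcov, Set.inter_univ]
    have hdisj : Pairwise (Function.onFun Disjoint fun n => t ∩ D n) := fun a b hab =>
      (disjoint_disjointed _ hab).mono Set.inter_subset_right Set.inter_subset_right
    have him : Φ '' t = ⋃ n, Φ '' (t ∩ D n) := by
      conv_lhs => rw [htD]
      exact Set.image_iUnion
    have hm1 : μHE[m] (Φ '' t) = ∑' n, μHE[m] (Φ '' (t ∩ D n)) := by
      rw [him]
      refine measure_iUnion (fun a b hab => ?_) fun n => ?_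
      · refine Set.disjoint_image_image fun x hx y hy hxy => ?_
        have := hinj hx.1 hy.1 hxy
        subst this
        exact (Set.disjoint_left.mp (hdisj hab)) hx hy
      · exact (ht.inter (hDm n)).image_of_continuousOn_injOn hΦc.continuousOn
          (hinj.mono Set.inter_subset_left)
    have hm2 : ∫⁻ y in t, ENNReal.ofReal (j y) ∂μ
        = ∑' n, ∫⁻ y in t ∩ D n, ENNReal.ofReal (j y) ∂μ := by
      conv_lhs => rw [htD]
      exact lintegral_iUnion (fun n => ht.inter (hDm n)) hdisj _
    have hb := fun n => hU (f n) (t ∩ D n)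
      (Set.inter_subset_right.trans (disjointed_subset _ n)) (ht.inter (hDm n))
    rw [hm1, hm2, ← ENNReal.tsum_mul_left, ← ENNReal.tsum_mul_left]
    exact ⟨ENNReal.tsum_le_tsum fun n => (hb n).1, ENNReal.tsum_le_tsum fun n => (hb n).2⟩
  have lim : ∀ a b : ENNReal, (∀ c : NNReal, 1 < c → a ≤ (c : ENNReal) ^ (m + 1) * b) → a ≤ b := by
    intro a b h
    have ht1 : Tendsto (fun c : NNReal => (c : ENNReal) ^ (m + 1) * b) (𝓝[>] 1)
        (𝓝 (((1 : NNReal) : ENNReal) ^ (m + 1) * b)) := by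
      refine ENNReal.Tendsto.mul_const ?_ (Or.inl (by simp))
      exact ((ENNReal.continuous_pow (m + 1)).comp ENNReal.continuous_coe).continuousAt.tendsto.mono_left
        nhdsWithin_le_nhds
    have := ge_of_tendsto ht1 (eventually_nhdsWithin_of_forall fun c hc => h c hc)
    simpa using this
  exact le_antisymm (lim _ _ fun c hc => (key c hc).1) (lim _ _ fun c hc => (key c hc).2)

theorem restrict_image_eq_map_withDensity {Φ : V → E} {Φ' : V → V →L[ℝ] E} {m : ℕ}
    {μ : Measure V} (hΦ : ∀ x, HasStrictFDerivAt Φ (Φ' x) x)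
    (hΦ' : ∀ x, Function.Injective (Φ' x)) {j : V → ℝ} (hj : Continuous j) (hjpos : ∀ x, 0 < j x)
    (hjL : ∀ x A, MeasurableSet A → μHE[m] (Φ' x '' A) = ENNReal.ofReal (j x) * μ A)
    {t : Set V} (ht : MeasurableSet t) (hinj : Set.InjOn Φ t) :
    (μHE[m] : Measure E).restrict (Φ '' t)
      = ((μ.restrict t).withDensity fun x => ENNReal.ofReal (j x)).map Φ := by
  have hΦc : Continuous Φ := continuous_iff_continuousAt.mpr fun x => (hΦ x).continuousAt
  ext B hB
  rw [Measure.map_apply hΦc.measurable hB, withDensity_apply _ (hΦc.measurable hB),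
    Measure.restrict_apply hB, Measure.restrict_restrict (hΦc.measurable hB),
    ← euclideanHausdorffMeasure_image_eq_lintegral hΦ hΦ' hj hjpos hjL
      ((hΦc.measurable hB).inter ht) (hinj.mono Set.inter_subset_right), Set.inter_comm _ t,
      Set.image_inter_preimage, Set.inter_comm]

end BMResidue

end

section

open scoped Pointwise

namespace BMResidue

/-! ### Hausdorff measure of the image of a hyperplane -/

/-- If `N : ℝ × V → E` scales volume by `c`, then the graph map `y ↦ N (lam y, y)` onto the
hyperplane `ker ℓ` scales the hypersurface measure by `c ‖ℓ‖`. -/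
theorem euclideanHausdorffMeasure_image_hyperplane {V E : Type*} [NormedAddCommGroup V]
    [NormedSpace ℝ V] [FiniteDimensional ℝ V] [MeasurableSpace V] [BorelSpace V]
    [NormedAddCommGroup E] [InnerProductSpace ℝ E]
    [FiniteDimensional ℝ E] [MeasurableSpace E] [BorelSpace E] {μ : Measure V} [SigmaFinite μ]
    (N : ℝ × V →L[ℝ] E) (hN : Function.Injective N) {c : ENNReal}
    (hc : ∀ B, MeasurableSet B → μHE[Module.finrank ℝ E] (N '' B) = c * (volume.prod μ) B)
    (l : E →L[ℝ] ℝ) (hl : l (N (1, 0)) = 1) (lam : V →L[ℝ] ℝ) (hker : ∀ y, l (N (lam y, y)) = 0)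
    {A : Set V} (hA : MeasurableSet A) :
    μHE[Module.finrank ℝ E - 1] ((fun y => N (lam y, y)) '' A) = ENNReal.ofReal ‖l‖ * c * μ A := by
  set γ : V → E := fun y => N (lam y, y)
  set ξ := N (1, 0)
  have hl0 : l ≠ 0 := by rintro rfl; simp at hl
  have hln : 0 < ‖l‖ := norm_pos_iff.mpr hl0
  set e := (InnerProductSpace.toDual ℝ E).symm l with he
  have hen : ‖e‖ = ‖l‖ := LinearIsometryEquiv.norm_map _ _
  have hin : ∀ z, inner ℝ e z = l z := fun z => InnerProductSpace.toDual_symm_apply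
  set v : E := (‖l‖ ^ 2)⁻¹ • e with hv
  have hvn : ‖v‖ = ‖l‖⁻¹ := by
    rw [hv, norm_smul, hen, norm_inv, norm_pow, norm_norm]; field_simp
  have hv0 : v ≠ 0 := by rw [← norm_pos_iff, hvn]; positivity
  have hlv : l v = 1 := by
    rw [hv, map_smul, ← hin, real_inner_self_eq_norm_sq, hen, smul_eq_mul]; field_simp
  set B : Set (ℝ × V) := {y | y.2 ∈ A ∧ y.1 - lam y.2 ∈ Set.Icc (0 : ℝ) 1} with hB
  have hBm : MeasurableSet B :=
    (measurable_snd hA).inter (((by fun_prop : Continuous fun y : ℝ × V =>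
      y.1 - lam y.2).measurable) measurableSet_Icc)
  have hBvol : (volume.prod μ) B = μ A := by
    rw [Measure.prod_apply_symm hBm, ← lintegral_indicator_one hA]
    congr 1
    ext y
    by_cases hy : y ∈ A
    · have : (fun x => (x, y)) ⁻¹' B = Set.Icc (lam y) (lam y + 1) := by
        ext s; simp [hB, hy, add_comm]
      rw [this, Real.volume_Icc]; simp [hy]
    · have : (fun x => (x, y)) ⁻¹' B = ∅ := by
        ext s; simp [hB, hy]
      rw [this]; simp [hy]
  have hNsplit : ∀ s y, N (s, y) = (s - lam y) • ξ + γ y := by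
    intro s y
    simp only [γ, ξ, ← map_smul, ← map_add]
    simp
  have hlN : ∀ s y, l (N (s, y)) = s - lam y := by
    intro s y; rw [hNsplit, map_add, map_smul, hl, hker]; simp
  have hslice : ∀ x : ℝ, N '' B ∩ (AffineSubspace.mk' (x • v +ᵥ (0 : E)) (ℝ ∙ v)ᗮ : Set E)
      = if x ∈ Set.Icc (0 : ℝ) 1 then (x • ξ) +ᵥ (γ '' A) else ∅ := by
    intro x
    have hmem : ∀ z : E, z ∈ (AffineSubspace.mk' (x • v +ᵥ (0 : E)) (ℝ ∙ v)ᗮ : Set E) ↔ l z = x := by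
      intro z
      rw [SetLike.mem_coe, AffineSubspace.mem_mk', Submodule.mem_orthogonal_singleton_iff_inner_right,
        hv, real_inner_smul_left, hin]
      simp only [vadd_eq_add, add_zero, vsub_eq_sub, map_sub, map_smul, smul_eq_mul]
      have h1 : (‖l‖ ^ 2)⁻¹ * l e = 1 := by rw [← hlv, hv, map_smul, smul_eq_mul]
      have h2 : (‖l‖ ^ 2)⁻¹ ≠ 0 := by positivity
      rw [h1, mul_one, mul_eq_zero, or_iff_right h2, sub_eq_zero]
    ext z
    rw [Set.mem_inter_iff, hmem]
    split_ifs with hx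
    · constructor
      · rintro ⟨⟨⟨s, y⟩, hy, rfl⟩, hz⟩
        rw [hlN] at hz
        refine ⟨γ y, ⟨y, hy.1, rfl⟩, ?_⟩
        rw [hNsplit, hz]
        rfl
      · rintro ⟨_, ⟨y, hy, rfl⟩, rfl⟩
        have h1 : N (x + lam y, y) = x • ξ +ᵥ γ y := by rw [hNsplit]; simp
        refine ⟨⟨(x + lam y, y), ⟨hy, by simpa using hx⟩, h1⟩, ?_⟩
        change l (x • ξ +ᵥ γ y) = x
        rw [← h1, hlN]; ring
    · simp only [Set.mem_empty_iff_false, iff_false, not_and]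
      rintro ⟨⟨s, y⟩, hy, rfl⟩ hz
      rw [hlN] at hz
      exact hx (hz ▸ hy.2)
  have htm : MeasurableSet (N '' B) :=
    hBm.image_of_continuousOn_injOn N.continuous.continuousOn hN.injOn
  have key := EuclideanGeometry.euclideanHausdorffMeasure_eq_lintegral (0 : E) hv0 htm
  rw [hc B hBm, hBvol] at key
  simp_rw [hslice] at key
  have hint : ∫⁻ x : ℝ, μHE[Module.finrank ℝ E - 1]
      (if x ∈ Set.Icc (0 : ℝ) 1 then (x • ξ) +ᵥ (γ '' A) else ∅)
      = μHE[Module.finrank ℝ E - 1] (γ '' A) := by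
    have : ∀ x : ℝ, μHE[Module.finrank ℝ E - 1]
        (if x ∈ Set.Icc (0 : ℝ) 1 then (x • ξ) +ᵥ (γ '' A) else ∅)
        = (Set.Icc (0 : ℝ) 1).indicator (fun _ => μHE[Module.finrank ℝ E - 1] (γ '' A)) x := by
      intro x
      by_cases hx : x ∈ Set.Icc (0 : ℝ) 1
      · rw [if_pos hx, Set.indicator_of_mem hx, measure_vadd]
      · rw [if_neg hx, Set.indicator_of_notMem hx, measure_empty]
    simp_rw [this]
    rw [lintegral_indicator_const measurableSet_Icc, Real.volume_Icc]
    simp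
  rw [hint] at key
  have hvE : ‖v‖ₑ = (ENNReal.ofReal ‖l‖)⁻¹ := by
    rw [← ofReal_norm, hvn, ENNReal.ofReal_inv_of_pos hln]
  rw [mul_assoc, key, hvE, ← mul_assoc, ENNReal.mul_inv_cancel (ENNReal.ofReal_pos.mpr hln).ne' (by simp), one_mul]

/-! ### Linear coordinates along a line -/

/-- Extension of a vector by zero in the coordinate `j₀`. -/
noncomputable def zeroExt {ι : Type*} [DecidableEq ι] (j₀ : ι) (a : {i // ¬ i = j₀} → ℝ) (i : ι) : ℝ :=
  if h : i = j₀ then 0 else a ⟨i, h⟩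

theorem measurable_flow {ι : Type*} [Finite ι] [DecidableEq ι] (j₀ : ι) (w : ι → ℝ) :
    Measurable fun y : ℝ × ({i // ¬ i = j₀} → ℝ) => zeroExt j₀ y.2 + y.1 • w := by
  refine measurable_pi_lambda _ fun i => ?_
  simp only [zeroExt, Pi.add_apply, Pi.smul_apply]
  split_ifs <;> fun_prop

theorem lintegral_flow {ι : Type*} [Fintype ι] [DecidableEq ι] (j₀ : ι) (w : ι → ℝ)
    (hw : 0 < w j₀) {F : (ι → ℝ) → ENNReal} (hF : Measurable F) :
    ∫⁻ y : ℝ × ({i // ¬ i = j₀} → ℝ), F (zeroExt j₀ y.2 + y.1 • w)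
      = ENNReal.ofReal (w j₀)⁻¹ * ∫⁻ u, F u := by
  set e := MeasurableEquiv.piEquivPiSubtypeProd (fun _ : ι => ℝ) (fun i => i = j₀)
  have he : MeasurePreserving e.symm :=
    by convert (volume_preserving_piEquivPiSubtypeProd (fun _ : ι => ℝ) (fun i => i = j₀)).symm
  set e1 := MeasurableEquiv.funUnique {i // i = j₀} ℝ
  have he1 : MeasurePreserving e1.symm := (volume_preserving_funUnique {i // i = j₀} ℝ).symm
  set w' : {i // ¬ i = j₀} → ℝ := fun i => w i
  have hm : Measurable fun y : ℝ × ({i // ¬ i = j₀} → ℝ) => e.symm (e1.symm y.1, y.2) :=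
    e.symm.measurable.comp ((e1.symm.measurable.comp measurable_fst).prodMk measurable_snd)
  have hid : ∀ (s : ℝ) (a : {i // ¬ i = j₀} → ℝ),
      e.symm (e1.symm (w j₀ * s), a + s • w') = zeroExt j₀ a + s • w := by
    intro s a
    ext i
    simp only [e, MeasurableEquiv.piEquivPiSubtypeProd_symm_apply, zeroExt, Pi.add_apply,
      Pi.smul_apply, smul_eq_mul, w']
    split_ifs with h
    · subst h; simp [e1, mul_comm]
    · rfl
  have h1 : ∫⁻ u, F u = ∫⁻ s : ℝ, ∫⁻ a : {i // ¬ i = j₀} → ℝ, F (e.symm (e1.symm s, a)) := by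
    rw [← he.lintegral_comp hF, Measure.volume_eq_prod, lintegral_prod (fun z => F (e.symm z)) (hF.comp e.symm.measurable).aemeasurable]
    have hc : Measurable fun x : {i // i = j₀} → ℝ =>
        ∫⁻ a : {i // ¬ i = j₀} → ℝ, F (e.symm (x, a)) :=
      (hF.comp e.symm.measurable).lintegral_prod_right'
    rw [← he1.lintegral_comp hc]
  have h2 : ∀ s : ℝ, ∫⁻ a : {i // ¬ i = j₀} → ℝ, F (e.symm (e1.symm (w j₀ * s), a))
      = ∫⁻ a : {i // ¬ i = j₀} → ℝ, F (zeroExt j₀ a + s • w) := by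
    intro s
    rw [← lintegral_add_right_eq_self _ (s • w')]
    simp_rw [hid]
  have hmeas : Measurable fun s => ∫⁻ a : {i // ¬ i = j₀} → ℝ, F (e.symm (e1.symm s, a)) :=
    (hF.comp hm).lintegral_prod_right'
  rw [Measure.volume_eq_prod, lintegral_prod (fun y : ℝ × ({i // ¬ i = j₀} → ℝ) =>
    F (zeroExt j₀ y.2 + y.1 • w)) (hF.comp (measurable_flow j₀ w)).aemeasurable, h1]
  simp_rw [← h2]
  have h3 := lintegral_map (μ := volume) hmeas (measurable_const_mul (w j₀))
  rw [Real.map_volume_mul_left hw.ne', lintegral_smul_measure, abs_of_pos (inv_pos.mpr hw)] at h3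
  exact h3.symm

theorem map_flow {ι : Type*} [Fintype ι] [DecidableEq ι] (j₀ : ι) (w : ι → ℝ)
    (hw : 0 < w j₀) :
    (volume : Measure (ℝ × ({i // ¬ i = j₀} → ℝ))).map (fun y => zeroExt j₀ y.2 + y.1 • w)
      = ENNReal.ofReal (w j₀)⁻¹ • (volume : Measure (ι → ℝ)) := by
  ext B hB
  have := lintegral_flow j₀ w hw (F := B.indicator 1) (measurable_one.indicator hB)
  rw [Measure.map_apply (measurable_flow j₀ w) hB, Measure.smul_apply, smul_eq_mul,
    ← lintegral_indicator_one hB, ← this,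
    ← lintegral_indicator_one (measurable_flow j₀ w hB)]
  rfl

/-! ### Volume on `ℂⁿ` -/

theorem finrank_Cn (n : ℕ) : Module.finrank ℝ (Cn n) = 2 * n := by
  have h := Module.finrank_mul_finrank ℝ ℂ (Cn n)
  rw [Complex.finrank_real_complex, finrank_euclideanSpace_fin] at h
  exact h.symm

/-- The real and imaginary parts of the coordinates, as an isometry. -/
noncomputable def reImIsometry (n : ℕ) :
    WithLp 2 (EuclideanSpace ℝ (Fin n) × EuclideanSpace ℝ (Fin n)) ≃ₗᵢ[ℝ] Cn n where
  toFun y := WithLp.toLp 2 fun j => (y.fst j : ℂ) + (y.snd j : ℂ) * Complex.I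
  invFun z := WithLp.toLp 2 (WithLp.toLp 2 fun j => (z j).re, WithLp.toLp 2 fun j => (z j).im)
  map_add' x y := by ext j; simp; ring
  map_smul' c y := by ext j; simp; ring
  left_inv y := by
    rcases y with ⟨⟨a⟩, ⟨b⟩⟩
    simp [Complex.add_re, Complex.add_im]
  right_inv z := by ext j; simp
  norm_map' y := by
    have h1 : ‖y‖ ^ 2 = _ := WithLp.prod_norm_sq_eq_of_L2 y
    rw [← sq_eq_sq₀ (norm_nonneg _) (norm_nonneg _), h1, EuclideanSpace.norm_sq_eq,
      EuclideanSpace.norm_sq_eq, EuclideanSpace.norm_sq_eq, ← Finset.sum_add_distrib]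
    refine Finset.sum_congr rfl fun j _ => ?_
    change ‖(y.fst j : ℂ) + (y.snd j : ℂ) * Complex.I‖ ^ 2 = _
    rw [← Complex.normSq_eq_norm_sq, Complex.normSq_add_mul_I, Real.norm_eq_abs, Real.norm_eq_abs,
      sq_abs, sq_abs]

theorem measurePreserving_reIm (n : ℕ) :
    MeasurePreserving (fun y : (Fin n → ℝ) × (Fin n → ℝ) =>
      (WithLp.toLp 2 fun j => (y.1 j : ℂ) + (y.2 j : ℂ) * Complex.I : Cn n)) volume
      μHE[2 * n] := by
  have h1 := (reImIsometry n).measurePreserving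
  have h2 := WithLp.volume_preserving_toLp (EuclideanSpace ℝ (Fin n)) (EuclideanSpace ℝ (Fin n))
  have h3 := (PiLp.volume_preserving_toLp (Fin n)).prod (PiLp.volume_preserving_toLp (Fin n))
  have h4 := (h1.comp h2).comp h3
  rw [← InnerProductSpace.euclideanHausdorffMeasure_eq_volume (V := Cn n), finrank_Cn] at h4
  exact h4

/-- Coordinatewise multiplication by `z`. -/
noncomputable def diagMul {n : ℕ} (z : Fin n → ℂ) : Cn n →ₗ[ℂ] Cn n :=
  (WithLp.linearEquiv 2 ℂ (Fin n → ℂ)).symm.toLinearMap ∘ₗ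
    (LinearMap.pi fun j => z j • LinearMap.proj j) ∘ₗ
    (WithLp.linearEquiv 2 ℂ (Fin n → ℂ)).toLinearMap

theorem diagMul_apply {n : ℕ} (z : Fin n → ℂ) (y : Cn n) (j : Fin n) : diagMul z y j = z j * y j := by
  simp [diagMul]

theorem det_diagMul {n : ℕ} (z : Fin n → ℂ) : LinearMap.det (diagMul z) = ∏ j, z j := by
  have h : diagMul z = (WithLp.linearEquiv 2 ℂ (Fin n → ℂ)).symm.toLinearMap ∘ₗ
    (LinearMap.pi fun j => z j • LinearMap.proj j) ∘ₗ
    (WithLp.linearEquiv 2 ℂ (Fin n → ℂ)).symm.symm.toLinearMap := rfl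
  rw [h, LinearMap.det_conj]
  have := LinearMap.det_pi (R := ℂ) (M := ℂ) (fun j : Fin n => z j • LinearMap.id)
  simp only [LinearMap.det_smul, Module.finrank_self, pow_one, LinearMap.det_id, mul_one] at this
  rw [← this]
  congr 1

theorem euclideanHausdorffMeasure_image_expDeriv {n : ℕ} (z : Fin n → ℂ)
    (B : Set ((Fin n → ℝ) × (Fin n → ℝ))) (hB : MeasurableSet B) :
    μHE[2 * n] ((fun y : (Fin n → ℝ) × (Fin n → ℝ) =>
      (WithLp.toLp 2 fun j => z j * ((y.1 j : ℂ) + (y.2 j : ℂ) * Complex.I) : Cn n)) '' B)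
      = ENNReal.ofReal (∏ j, ‖z j‖ ^ 2) * volume B := by
  set R := fun y : (Fin n → ℝ) × (Fin n → ℝ) =>
      (WithLp.toLp 2 fun j => (y.1 j : ℂ) + (y.2 j : ℂ) * Complex.I : Cn n) with hR
  have hRinj : Function.Injective R := by
    intro x y h
    have h' : ∀ j, ((x.1 j : ℂ) + (x.2 j : ℂ) * Complex.I) = (y.1 j : ℂ) + (y.2 j : ℂ) * Complex.I :=
      fun j => congrArg (fun f : Cn n => f j) h
    ext j
    · simpa using congrArg Complex.re (h' j)
    · simpa using congrArg Complex.im (h' j)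
  have hRc : Continuous R := by
    refine (PiLp.continuous_toLp 2 _).comp ?_
    fun_prop
  have hRB : μHE[2 * n] (R '' B) = volume B := by
    rw [← (measurePreserving_reIm n).measure_preimage
      (hB.image_of_continuousOn_injOn hRc.continuousOn hRinj.injOn).nullMeasurableSet]
    exact congrArg volume (Set.preimage_image_eq _ hRinj)
  have himg : ((fun y : (Fin n → ℝ) × (Fin n → ℝ) =>
      (WithLp.toLp 2 fun j => z j * ((y.1 j : ℂ) + (y.2 j : ℂ) * Complex.I) : Cn n)) '' B)
      = ((diagMul z).restrictScalars ℝ) '' (R '' B) := by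
    rw [Set.image_image]
    refine Set.image_congr fun y _ => ?_
    ext j
    rw [LinearMap.restrictScalars_apply, diagMul_apply]
  have hinst : (μHE[2 * n] : Measure (Cn n)).IsAddHaarMeasure := by
    rw [← finrank_Cn]; infer_instance
  rw [himg, Measure.addHaar_image_linearMap, hRB, LinearMap.det_restrictScalars, det_diagMul,
    Algebra.norm_complex_apply, Complex.normSq_eq_norm_sq, norm_prod, ← Finset.prod_pow,
    abs_of_nonneg (by positivity)]

end BMResidue

end

section

namespace BMResidue

/-! ### Logarithmic coordinates on the level hypersurfaces of `‖ζ^A‖²` -/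

/-- The point with coordinates `e^{u_j + i θ_j}`. -/
noncomputable def expPoint {n : ℕ} (u θ : Fin n → ℝ) : Cn n :=
  WithLp.toLp 2 fun j => Complex.exp ((u j : ℂ) + (θ j : ℂ) * Complex.I)

theorem expPoint_apply {n : ℕ} (u θ : Fin n → ℝ) (j : Fin n) :
    expPoint u θ j = Complex.exp ((u j : ℂ) + (θ j : ℂ) * Complex.I) := rfl

theorem norm_expPoint {n : ℕ} (u θ : Fin n → ℝ) (j : Fin n) :
    ‖expPoint u θ j‖ = Real.exp (u j) := by
  rw [expPoint_apply, Complex.norm_exp]; simp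

theorem expPoint_ne_zero {n : ℕ} (u θ : Fin n → ℝ) (j : Fin n) : expPoint u θ j ≠ 0 :=
  Complex.exp_ne_zero _

/-- `⟨α_k, u⟩`, where `α_k` is the `k`-th row of `A`. -/
noncomputable def rowPair {n p : ℕ} (A : Matrix (Fin p) (Fin n) ℕ) (u : Fin n → ℝ) (k : Fin p) : ℝ :=
  ∑ j, (A k j : ℝ) * u j

/-- `‖ζ^A‖²` in the logarithmic coordinates. -/
noncomputable def expSum {n p : ℕ} (A : Matrix (Fin p) (Fin n) ℕ) (u : Fin n → ℝ) : ℝ :=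
  ∑ k, Real.exp (2 * rowPair A u k)

variable {n p : ℕ} (A : Matrix (Fin p) (Fin n) ℕ)

theorem norm_monomialMap_expPoint (u θ : Fin n → ℝ) (k : Fin p) :
    ‖monomialMap A k (expPoint u θ)‖ = Real.exp (rowPair A u k) := by
  simp only [monomialMap, norm_prod, norm_pow, norm_expPoint, rowPair, Real.exp_sum]
  exact Finset.prod_congr rfl fun j _ => (Real.exp_nat_mul _ _).symm

theorem normSqMap_expPoint (u θ : Fin n → ℝ) :
    normSqMap (monomialMap A) (expPoint u θ) = expSum A u := by
  simp only [normSqMap, norm_monomialMap_expPoint, expSum]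
  exact Finset.sum_congr rfl fun k _ => by rw [← Real.exp_nat_mul]; norm_num

theorem rowPair_add (u v : Fin n → ℝ) (k : Fin p) :
    rowPair A (u + v) k = rowPair A u k + rowPair A v k := by
  simp [rowPair, mul_add, Finset.sum_add_distrib]

theorem rowPair_smul (c : ℝ) (u : Fin n → ℝ) (k : Fin p) :
    rowPair A (c • u) k = c * rowPair A u k := by
  simp only [rowPair, Finset.mul_sum, Pi.smul_apply, smul_eq_mul]
  exact Finset.sum_congr rfl fun j _ => by ring

theorem expSum_add_smul {w : Fin n → ℝ} (hw : ∀ k, rowPair A w k = 1) (u : Fin n → ℝ) (τ : ℝ) :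
    expSum A (u + τ • w) = Real.exp (2 * τ) * expSum A u := by
  simp only [expSum, rowPair_add, rowPair_smul, hw, Finset.mul_sum, ← Real.exp_add]
  exact Finset.sum_congr rfl fun k _ => by ring_nf

theorem expSum_pos (hp : 1 ≤ p) (u : Fin n → ℝ) : 0 < expSum A u := by
  have : Nonempty (Fin p) := ⟨⟨0, hp⟩⟩
  exact Finset.sum_pos (fun k _ => Real.exp_pos _) Finset.univ_nonempty

theorem contDiff_rowPair (k : Fin p) : ContDiff ℝ ∞ fun u : Fin n → ℝ => rowPair A u k := by
  unfold rowPair; fun_prop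

theorem contDiff_expSum : ContDiff ℝ ∞ (expSum A) := by
  unfold expSum
  exact ContDiff.sum fun k _ => (contDiff_const.mul (contDiff_rowPair A k)).exp

/-- The time at which the flow line of `w` starting at `u` meets the level set `η`. -/
noncomputable def flowTime (η : ℝ) (u : Fin n → ℝ) : ℝ :=
  (Real.log η - Real.log (expSum A u)) / 2

/-- The projection along `w` to the level set `η`. -/
noncomputable def levelLog (w : Fin n → ℝ) (η : ℝ) (u : Fin n → ℝ) : Fin n → ℝ :=
  u + flowTime A η u • w

theorem expSum_levelLog (hp : 1 ≤ p) {w : Fin n → ℝ} (hw : ∀ k, rowPair A w k = 1) {η : ℝ}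
    (hη : 0 < η) (u : Fin n → ℝ) : expSum A (levelLog A w η u) = η := by
  rw [levelLog, expSum_add_smul A hw, flowTime, mul_div_cancel₀ _ two_ne_zero, Real.exp_sub,
    Real.exp_log hη, Real.exp_log (expSum_pos A hp u)]
  field_simp [(expSum_pos A hp u).ne']

theorem contDiff_flowTime (hp : 1 ≤ p) (η : ℝ) : ContDiff ℝ ∞ (flowTime A η) := by
  unfold flowTime
  exact (contDiff_const.sub ((contDiff_expSum A).log fun u => (expSum_pos A hp u).ne')).div_const _

/-- Extension by zero in the coordinate `j₀`, as a continuous linear map. -/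
noncomputable def zeroExtCLM (j₀ : Fin n) : ({i // ¬ i = j₀} → ℝ) →L[ℝ] (Fin n → ℝ) :=
  ContinuousLinearMap.pi fun i =>
    if h : i = j₀ then 0 else ContinuousLinearMap.proj (⟨i, h⟩ : {i // ¬ i = j₀})

theorem zeroExtCLM_apply (j₀ : Fin n) (a : {i // ¬ i = j₀} → ℝ) : zeroExtCLM j₀ a = zeroExt j₀ a := by
  ext i
  simp only [zeroExtCLM, zeroExt, ContinuousLinearMap.coe_pi']
  split_ifs <;> rfl

/-- The parametrization of the level hypersurface off the coordinate hyperplanes. -/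
noncomputable def levelChart (w : Fin n → ℝ) (j₀ : Fin n) (η : ℝ)
    (y : ({i // ¬ i = j₀} → ℝ) × (Fin n → ℝ)) : Cn n :=
  expPoint (levelLog A w η (zeroExt j₀ y.1)) y.2

/-- The angles. -/
def angleBox (n : ℕ) : Set (Fin n → ℝ) := Set.univ.pi fun _ => Set.Ioc 0 (2 * Real.pi)

theorem measurableSet_angleBox : MeasurableSet (angleBox n) :=
  MeasurableSet.univ_pi fun _ => measurableSet_Ioc

theorem exp_eq_exp_iff_of_mem_Ioc {a b s t : ℝ} (hs : s ∈ Set.Ioc 0 (2 * Real.pi))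
    (ht : t ∈ Set.Ioc 0 (2 * Real.pi))
    (h : Complex.exp ((a : ℂ) + (s : ℂ) * Complex.I) = Complex.exp ((b : ℂ) + (t : ℂ) * Complex.I)) :
    a = b ∧ s = t := by
  have h1 : a = b := by
    have := congrArg norm h
    simpa [Complex.norm_exp] using this
  refine ⟨h1, ?_⟩
  obtain ⟨m, hm⟩ := Complex.exp_eq_exp_iff_exists_int.mp h
  have him := congrArg Complex.im hm
  simp at him
  have hpi := Real.pi_pos
  have h3 : (m : ℝ) < 1 := by
    by_contra hc
    push Not at hc
    nlinarith [hs.2, ht.1]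
  have h4 : (-1 : ℝ) < m := by
    by_contra hc
    push Not at hc
    nlinarith [hs.1, ht.2]
  have h5 : m = 0 := by
    have : m < 1 := by exact_mod_cast h3
    have : -1 < m := by exact_mod_cast h4
    omega
  subst h5
  simpa using him

theorem exists_exp_eq {z : ℂ} (hz : z ≠ 0) :
    ∃ θ ∈ Set.Ioc 0 (2 * Real.pi),
      Complex.exp ((Real.log ‖z‖ : ℂ) + (θ : ℂ) * Complex.I) = z := by
  have hpi := Real.pi_pos
  have h0 : Complex.exp ((Real.log ‖z‖ : ℂ) + (z.arg : ℂ) * Complex.I) = z := by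
    have := Complex.exp_log hz
    rwa [Complex.log] at this
  by_cases h : 0 < z.arg
  · exact ⟨z.arg, ⟨h, by linarith [Complex.arg_le_pi z]⟩, h0⟩
  · refine ⟨z.arg + 2 * Real.pi, ⟨by linarith [Complex.neg_pi_lt_arg z], by linarith⟩, ?_⟩
    rw [← h0]
    conv_rhs => rw [← Complex.exp_periodic]
    rw [h0]
    congr 1
    push_cast
    ring

theorem expPoint_injOn : ∀ u u' θ θ' : Fin n → ℝ, θ ∈ angleBox n → θ' ∈ angleBox n →
    expPoint u θ = expPoint u' θ' → u = u' ∧ θ = θ' := by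
  intro u u' θ θ' hθ hθ' h
  have := fun j => exp_eq_exp_iff_of_mem_Ioc (hθ j trivial) (hθ' j trivial)
    (congrArg (fun z : Cn n => z j) h)
  exact ⟨funext fun j => (this j).1, funext fun j => (this j).2⟩

theorem flowTime_add_smul (hp : 1 ≤ p) {w : Fin n → ℝ} (hw : ∀ k, rowPair A w k = 1) (η : ℝ)
    (u : Fin n → ℝ) (τ : ℝ) : flowTime A η (u + τ • w) = flowTime A η u - τ := by
  rw [flowTime, expSum_add_smul A hw, Real.log_mul (Real.exp_ne_zero _) (expSum_pos A hp u).ne',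
    Real.log_exp, flowTime]
  ring

theorem zeroExt_self (j₀ : Fin n) (a : {i // ¬ i = j₀} → ℝ) : zeroExt j₀ a j₀ = 0 := by
  simp [zeroExt]

theorem zeroExt_of_ne (j₀ : Fin n) (a : {i // ¬ i = j₀} → ℝ) (i : {i // ¬ i = j₀}) :
    zeroExt j₀ a i = a i := by
  simp [zeroExt, i.2]

theorem zeroExt_add_smul_injective {j₀ : Fin n} {w : Fin n → ℝ} (hj₀ : w j₀ ≠ 0)
    {a b : {i // ¬ i = j₀} → ℝ} {s t : ℝ} (h : zeroExt j₀ a + s • w = zeroExt j₀ b + t • w) :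
    s = t ∧ a = b := by
  have h1 : s = t := by
    have := congrFun h j₀
    simpa [zeroExt_self, hj₀] using this
  subst h1
  refine ⟨rfl, funext fun i => ?_⟩
  have := congrFun h i
  simpa [zeroExt_of_ne] using this

theorem levelChart_injOn {w : Fin n → ℝ} {j₀ : Fin n} (hj₀ : w j₀ ≠ 0) (η : ℝ) :
    Set.InjOn (levelChart A w j₀ η) (Set.univ ×ˢ angleBox n) := by
  rintro ⟨a, θ⟩ ⟨-, hθ⟩ ⟨b, θ'⟩ ⟨-, hθ'⟩ h
  obtain ⟨h1, h2⟩ := expPoint_injOn _ _ _ _ hθ hθ' h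
  rw [levelLog, levelLog] at h1
  exact Prod.ext (zeroExt_add_smul_injective hj₀ h1).2 h2

theorem levelChart_image (hp : 1 ≤ p) {w : Fin n → ℝ} (hw : ∀ k, rowPair A w k = 1) {j₀ : Fin n}
    (hj₀ : w j₀ ≠ 0) {η : ℝ} (hη : 0 < η) :
    levelChart A w j₀ η '' (Set.univ ×ˢ angleBox n)
      = {z | normSqMap (monomialMap A) z = η} ∩ {z | ∀ j, z j ≠ 0} := by
  ext z
  constructor
  · rintro ⟨⟨a, θ⟩, -, rfl⟩
    refine ⟨?_, fun j => expPoint_ne_zero _ _ j⟩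
    change normSqMap _ (expPoint _ _) = η
    rw [normSqMap_expPoint, expSum_levelLog A hp hw hη]
  · rintro ⟨hz, hz0⟩
    choose θ hθ hθz using fun j => exists_exp_eq (hz0 j)
    set u : Fin n → ℝ := fun j => Real.log ‖z j‖ with hu
    have hzu : expPoint u θ = z := by
      ext j; exact hθz j
    have hgu : expSum A u = η := by
      rw [← normSqMap_expPoint A u θ, hzu]; exact hz
    set a : {i // ¬ i = j₀} → ℝ := fun i => (u - (u j₀ / w j₀) • w) i
    have ha : zeroExt j₀ a = u + (-(u j₀ / w j₀)) • w := by
      ext i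
      by_cases h : i = j₀
      · subst h; rw [zeroExt_self]; simp; field_simp; simp
      · rw [zeroExt_of_ne j₀ a ⟨i, h⟩]; simp [a, sub_eq_add_neg]
    refine ⟨(a, θ), ⟨trivial, fun j _ => hθ j⟩, ?_⟩
    rw [levelChart, ← hzu]
    congr 1
    simp only
    rw [levelLog, ha, flowTime_add_smul A hp hw, flowTime, hgu]
    ext i; simp

end BMResidue

end

section

namespace BMResidue

variable {n p : ℕ} (A : Matrix (Fin p) (Fin n) ℕ)

theorem contDiff_coord (j : Fin n) : ContDiff ℝ ∞ fun z : Cn n => z j :=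
  (dz j).contDiff

theorem contDiff_monomialMap (k : Fin p) : ContDiff ℝ ∞ (monomialMap A k) := by
  unfold monomialMap
  exact contDiff_prod fun j _ => (contDiff_coord j).pow _

theorem contDiff_normSqMap : ContDiff ℝ ∞ (normSqMap (monomialMap A)) := by
  unfold normSqMap
  exact ContDiff.sum fun k _ => (contDiff_monomialMap A k).norm_sq ℝ

/-- `(s, a, b) ↦ z · (a + s w / (2η) + i b)`, the linearization of the logarithmic coordinates. -/
noncomputable def levelFrame (w : Fin n → ℝ) (j₀ : Fin n) (η : ℝ) (z : Fin n → ℂ) :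
    ℝ × (({i // ¬ i = j₀} → ℝ) × (Fin n → ℝ)) →L[ℝ] Cn n :=
  LinearMap.toContinuousLinearMap
  { toFun := fun y => WithLp.toLp 2 fun j =>
      z j * (((zeroExtCLM j₀ y.2.1 + y.1 • ((2 * η)⁻¹ • w)) j : ℝ) + (y.2.2 j : ℂ) * Complex.I)
    map_add' := fun x y => by ext j; simp; ring
    map_smul' := fun c y => by ext j; simp; ring }

theorem levelFrame_apply (w : Fin n → ℝ) (j₀ : Fin n) (η : ℝ) (z : Fin n → ℂ)
    (y : ℝ × (({i // ¬ i = j₀} → ℝ) × (Fin n → ℝ))) :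
    levelFrame w j₀ η z y = WithLp.toLp 2 fun j =>
      z j * (((zeroExt j₀ y.2.1 + y.1 • ((2 * η)⁻¹ • w)) j : ℝ) + (y.2.2 j : ℂ) * Complex.I) := by
  rw [← zeroExtCLM_apply]; rfl

theorem levelFrame_injective {w : Fin n → ℝ} {j₀ : Fin n} (hj₀ : w j₀ ≠ 0) {η : ℝ} (hη : 0 < η)
    {z : Fin n → ℂ} (hz : ∀ j, z j ≠ 0) : Function.Injective (levelFrame w j₀ η z) := by
  rintro ⟨s, a, b⟩ ⟨s', a', b'⟩ h
  rw [levelFrame_apply, levelFrame_apply] at h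
  have h1 := fun j => mul_left_cancel₀ (hz j) (congrArg (fun f : Cn n => f j) h)
  have h2 : zeroExt j₀ a + s • ((2 * η)⁻¹ • w) = zeroExt j₀ a' + s' • ((2 * η)⁻¹ • w) := by
    ext j
    simpa using congrArg Complex.re (h1 j)
  have h3 : b = b' := by
    ext j
    simpa using congrArg Complex.im (h1 j)
  obtain ⟨h4, h5⟩ := zeroExt_add_smul_injective (by simp [hj₀, hη.ne']) h2
  rw [h3, h4, h5]

theorem volume_levelFrame_image {w : Fin n → ℝ} {j₀ : Fin n} (hj₀ : 0 < w j₀) {η : ℝ} (hη : 0 < η)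
    {z : Fin n → ℂ} {B : Set (ℝ × (({i // ¬ i = j₀} → ℝ) × (Fin n → ℝ)))} (hB : MeasurableSet B) :
    μHE[2 * n] (levelFrame w j₀ η z '' B)
      = ENNReal.ofReal (w j₀ / (2 * η) * ∏ j, ‖z j‖ ^ 2) * volume B := by
  set w' : Fin n → ℝ := (2 * η)⁻¹ • w with hw'
  have hw'0 : 0 < w' j₀ := by simp [hw', hj₀, hη]
  set F : ℝ × (({i // ¬ i = j₀} → ℝ) × (Fin n → ℝ)) → (Fin n → ℝ) × (Fin n → ℝ) :=
    fun y => (zeroExt j₀ y.2.1 + y.1 • w', y.2.2) with hF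
  have hcomp : levelFrame w j₀ η z '' B = (fun y : (Fin n → ℝ) × (Fin n → ℝ) =>
      (WithLp.toLp 2 fun j => z j * ((y.1 j : ℂ) + (y.2 j : ℂ) * Complex.I) : Cn n)) '' (F '' B) := by
    rw [Set.image_image]
    exact Set.image_congr fun y _ => levelFrame_apply _ _ _ _ _
  have hFinj : Function.Injective F := by
    rintro ⟨s, a, b⟩ ⟨s', a', b'⟩ h
    obtain ⟨h1, h2⟩ := Prod.mk.inj h
    obtain ⟨h4, h5⟩ := zeroExt_add_smul_injective hw'0.ne' h1
    simp only at h2 h4 h5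
    rw [h2, h4, h5]
  have hFc : Continuous F := by
    have : F = fun y => (zeroExtCLM j₀ y.2.1 + y.1 • w', y.2.2) := by
      funext y; simp only [hF, zeroExtCLM_apply]
    rw [this]; fun_prop
  have hFB : MeasurableSet (F '' B) := hB.image_of_continuousOn_injOn hFc.continuousOn hFinj.injOn
  have hmap : (volume : Measure (ℝ × (({i // ¬ i = j₀} → ℝ) × (Fin n → ℝ)))).map F
      = ENNReal.ofReal (w' j₀)⁻¹ • volume := by
    have h1 := (measurePreserving_prodAssoc (volume : Measure ℝ)
      (volume : Measure ({i // ¬ i = j₀} → ℝ)) (volume : Measure (Fin n → ℝ))).symm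
    have h2 : F = Prod.map (fun y : ℝ × ({i // ¬ i = j₀} → ℝ) => zeroExt j₀ y.2 + y.1 • w') id
        ∘ MeasurableEquiv.prodAssoc.symm := rfl
    have h3 := measurable_flow j₀ w'
    rw [h2, ← Measure.map_map (h3.prodMap measurable_id) (MeasurableEquiv.measurable _)]
    erw [h1.map_eq]
    rw [← Measure.map_prod_map _ _ h3 measurable_id, Measure.map_id]
    have h4 := map_flow j₀ w' hw'0
    erw [h4]
    rw [Measure.prod_smul_left]; rfl
  have hvol : volume B = ENNReal.ofReal (w' j₀)⁻¹ * volume (F '' B) := by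
    have := congrArg (fun μ => μ (F '' B)) hmap
    simp only [Measure.smul_apply, smul_eq_mul] at this
    rw [← this, Measure.map_apply hFc.measurable hFB, Set.preimage_image_eq _ hFinj]
  rw [hcomp, euclideanHausdorffMeasure_image_expDeriv z _ hFB, hvol, ← mul_assoc,
    ← ENNReal.ofReal_mul (by positivity)]
  congr 2
  have : w j₀ / (2 * η) = w' j₀ := by simp [hw']; field_simp
  rw [this]; field_simp

theorem hasStrictFDerivAt_levelChart (hp : 1 ≤ p) (w : Fin n → ℝ) (j₀ : Fin n) {η : ℝ} (hη : 0 < η)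
    (y : ({i // ¬ i = j₀} → ℝ) × (Fin n → ℝ)) :
    ∃ lam : ({i // ¬ i = j₀} → ℝ) × (Fin n → ℝ) →L[ℝ] ℝ,
    HasStrictFDerivAt (levelChart A w j₀ η)
      ((levelFrame w j₀ η (levelChart A w j₀ η y)) ∘L (lam.prod (ContinuousLinearMap.id ℝ _))) y := by
  set E := zeroExtCLM j₀ ∘L ContinuousLinearMap.fst ℝ ({i // ¬ i = j₀} → ℝ) (Fin n → ℝ) with hE
  have hT : HasStrictFDerivAt (fun y : ({i // ¬ i = j₀} → ℝ) × (Fin n → ℝ) =>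
      flowTime A η (zeroExtCLM j₀ y.1)) (fderiv ℝ (flowTime A η) (zeroExtCLM j₀ y.1) ∘L E) y := by
    have h1 : HasStrictFDerivAt (flowTime A η) (fderiv ℝ (flowTime A η) (E y)) (E y) :=
      (contDiff_flowTime A hp η).contDiffAt.hasStrictFDerivAt (by simp)
    exact h1.comp y E.hasStrictFDerivAt
  set T' := fderiv ℝ (flowTime A η) (zeroExtCLM j₀ y.1) ∘L E with hT'
  refine ⟨(2 * η) • T', ?_⟩
  rw [hasStrictFDerivAt_piLp]
  intro j
  have h1 : HasStrictFDerivAt (fun y : ({i // ¬ i = j₀} → ℝ) × (Fin n → ℝ) =>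
      levelLog A w η (zeroExt j₀ y.1) j)
      (ContinuousLinearMap.proj j ∘L E + (w j) • T') y := by
    have := ((ContinuousLinearMap.proj (R := ℝ) (φ := fun _ : Fin n => ℝ) j) ∘L E).hasStrictFDerivAt (x := y) |>.add
      (hT.const_mul (w j))
    refine this.congr_of_eventuallyEq (Eventually.of_forall fun y => ?_)
    simp [levelLog, E, zeroExtCLM_apply, mul_comm]
  have h2 : HasStrictFDerivAt (fun y : ({i // ¬ i = j₀} → ℝ) × (Fin n → ℝ) => y.2 j)
      (ContinuousLinearMap.proj j ∘L ContinuousLinearMap.snd ℝ _ _) y :=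
    (ContinuousLinearMap.proj (R := ℝ) (φ := fun _ : Fin n => ℝ) j ∘L
      ContinuousLinearMap.snd ℝ ({i // ¬ i = j₀} → ℝ) (Fin n → ℝ)).hasStrictFDerivAt
  have h3 := ((Complex.ofRealCLM.hasStrictFDerivAt.comp y h1).add
    ((Complex.ofRealCLM.hasStrictFDerivAt.comp y h2).mul_const Complex.I)).cexp
  refine h3.congr_fderiv ?_
  refine ContinuousLinearMap.ext fun v => ?_
  simp [levelFrame_apply, ← zeroExtCLM_apply, levelChart, expPoint_apply, E]
  have : (η : ℂ) ≠ 0 := by exact_mod_cast hη.ne'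
  field_simp

theorem fderiv_normSqMap_levelFrame {w : Fin n → ℝ} (hw : ∀ k, rowPair A w k = 1) (j₀ : Fin n)
    {η : ℝ} (hη : 0 < η) (u θ : Fin n → ℝ) (hu : expSum A u = η) :
    fderiv ℝ (normSqMap (monomialMap A)) (expPoint u θ)
      (levelFrame w j₀ η (expPoint u θ) (1, 0)) = 1 := by
  have h1 : HasDerivAt (fun τ : ℝ => expPoint (u + τ • w) θ)
      ((2 * η) • levelFrame w j₀ η (expPoint u θ) (1, 0)) 0 := by
    have h2 : HasDerivAt (fun (τ : ℝ) (j : Fin n) => expPoint (u + τ • w) θ j)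
        (fun j => Complex.exp ((u j : ℂ) + (θ j : ℂ) * Complex.I) * w j) 0 := by
      rw [hasDerivAt_pi]
      intro j
      have h3 : HasDerivAt (fun τ : ℝ => u j + τ * w j) (w j) 0 := by
        simpa using ((hasDerivAt_id (0 : ℝ)).mul_const (w j)).const_add (u j)
      simpa [expPoint_apply] using (h3.ofReal_comp.add_const ((θ j : ℂ) * Complex.I)).cexp
    have h4 := (PiLp.continuousLinearEquiv 2 ℝ fun _ : Fin n => ℂ).symm.toContinuousLinearMap.hasFDerivAt.comp_hasDerivAt
      (0 : ℝ) h2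
    refine h4.congr_deriv ?_
    ext j
    have : (η : ℂ) ≠ 0 := by exact_mod_cast hη.ne'
    simp [levelFrame_apply, expPoint_apply, zeroExt]
    field_simp
  have h2 : HasDerivAt (fun τ : ℝ => normSqMap (monomialMap A) (expPoint (u + τ • w) θ)) (2 * η) 0 := by
    have : (fun τ : ℝ => normSqMap (monomialMap A) (expPoint (u + τ • w) θ))
        = fun τ => Real.exp (2 * τ) * η := by
      funext τ
      rw [normSqMap_expPoint, expSum_add_smul A hw, hu]
    rw [this]
    have h3 : HasDerivAt (fun τ : ℝ => 2 * τ) 2 0 := by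
      simpa using (hasDerivAt_id (0 : ℝ)).const_mul 2
    simpa using h3.exp.mul_const η
  have h3 : HasFDerivAt (normSqMap (monomialMap A))
      (fderiv ℝ (normSqMap (monomialMap A)) (expPoint u θ)) (expPoint (u + (0 : ℝ) • w) θ) := by
    rw [zero_smul, add_zero]
    exact ((contDiff_normSqMap A).differentiable (by simp) _).hasFDerivAt
  have h4 := HasDerivAt.unique (h3.comp_hasDerivAt (f := fun τ : ℝ => expPoint (u + τ • w) θ)
    (0 : ℝ) h1) h2
  rw [map_smul, smul_eq_mul] at h4
  exact mul_left_cancel₀ (by positivity) (h4.trans (mul_one _).symm)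

theorem contDiff_levelChart (hp : 1 ≤ p) (w : Fin n → ℝ) (j₀ : Fin n) (η : ℝ) :
    ContDiff ℝ ∞ (levelChart A w j₀ η) := by
  rw [contDiff_piLp]
  intro j
  have h1 : ContDiff ℝ ∞ fun y : ({i // ¬ i = j₀} → ℝ) × (Fin n → ℝ) =>
      levelLog A w η (zeroExtCLM j₀ y.1) j := by
    have h2 : ContDiff ℝ ∞ fun y : ({i // ¬ i = j₀} → ℝ) × (Fin n → ℝ) => zeroExtCLM j₀ y.1 :=
      (zeroExtCLM j₀).contDiff.comp contDiff_fst
    simp only [levelLog, Pi.add_apply, Pi.smul_apply, smul_eq_mul]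
    refine ContDiff.add ?_ (((contDiff_flowTime A hp η).comp h2).mul contDiff_const)
    exact (contDiff_apply ℝ ℝ j).comp h2
  simp only [zeroExtCLM_apply] at h1
  exact ((Complex.ofRealCLM.contDiff.comp h1).add ((Complex.ofRealCLM.contDiff.comp
    ((contDiff_apply ℝ ℝ j).comp contDiff_snd)).mul contDiff_const)).cexp

/-- The density of the surface measure of the level hypersurface in the chart. -/
noncomputable def chartDensity (w : Fin n → ℝ) (j₀ : Fin n) (η : ℝ)
    (y : ({i // ¬ i = j₀} → ℝ) × (Fin n → ℝ)) : ℝ :=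
  w j₀ / (2 * η) * ∏ j, ‖levelChart A w j₀ η y j‖ ^ 2

theorem restrict_level_eq_map (hp : 1 ≤ p) {w : Fin n → ℝ} (hw : ∀ k, rowPair A w k = 1)
    {j₀ : Fin n} (hj₀ : 0 < w j₀) {η : ℝ} (hη : 0 < η) :
    (μHE[2 * n - 1] : Measure (Cn n)).restrict
        ({z | normSqMap (monomialMap A) z = η} ∩ {z | ∀ j, z j ≠ 0})
      = ((volume.restrict (Set.univ ×ˢ angleBox n)).withDensity fun y => ENNReal.ofReal
          (‖fderiv ℝ (normSqMap (monomialMap A)) (levelChart A w j₀ η y)‖ *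
            chartDensity A w j₀ η y)).map (levelChart A w j₀ η) := by
  set g := normSqMap (monomialMap A) with hg
  choose lam hlam using hasStrictFDerivAt_levelChart A hp w j₀ hη
  have hnz : ∀ y j, levelChart A w j₀ η y j ≠ 0 := fun y j => expPoint_ne_zero _ _ j
  have hone : ∀ y, fderiv ℝ g (levelChart A w j₀ η y)
      (levelFrame w j₀ η (levelChart A w j₀ η y) (1, 0)) = 1 := fun y =>
    fderiv_normSqMap_levelFrame A hw j₀ hη _ _ (expSum_levelLog A hp hw hη _)
  have hconst : ∀ y, g (levelChart A w j₀ η y) = η := fun y => by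
    rw [hg, levelChart, normSqMap_expPoint, expSum_levelLog A hp hw hη]
  have hker : ∀ y v, fderiv ℝ g (levelChart A w j₀ η y)
      (levelFrame w j₀ η (levelChart A w j₀ η y) (lam y v, v)) = 0 := by
    intro y v
    have h1 := ((contDiff_normSqMap A).differentiable (by simp) (levelChart A w j₀ η y)).hasFDerivAt
    have h2 := h1.comp y (hlam y).hasFDerivAt
    have h3 : HasFDerivAt (g ∘ levelChart A w j₀ η) (0 : _ →L[ℝ] ℝ) y := by
      have : g ∘ levelChart A w j₀ η = fun _ => η := funext hconst
      rw [this]; exact hasFDerivAt_const _ _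
    have h4 := h2.unique h3
    exact congrArg (fun L : _ →L[ℝ] ℝ => L v) h4
  have hinj : ∀ y, Function.Injective ((levelFrame w j₀ η (levelChart A w j₀ η y)) ∘L
      ((lam y).prod (ContinuousLinearMap.id ℝ _))) := by
    intro y v v' h
    exact (Prod.mk.inj (levelFrame_injective hj₀.ne' hη (hnz y) h)).2
  have hcont := (contDiff_levelChart A hp w j₀ η).continuous
  have hdens : ∀ y, 0 < chartDensity A w j₀ η y := fun y =>
    mul_pos (by positivity) (Finset.prod_pos fun j _ => by have := norm_pos_iff.mpr (hnz y j); positivity)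
  have hnorm : ∀ y, 0 < ‖fderiv ℝ g (levelChart A w j₀ η y)‖ := by
    intro y
    rw [norm_pos_iff]
    intro h
    have := hone y
    rw [h] at this
    simp at this
  rw [← levelChart_image A hp hw hj₀.ne' hη]
  refine restrict_image_eq_map_withDensity hlam hinj ?_ (fun y => mul_pos (hnorm y) (hdens y)) ?_
    (MeasurableSet.univ.prod measurableSet_angleBox) (levelChart_injOn A hj₀.ne' η)
  · refine Continuous.mul ?_ ?_
    · exact (((contDiff_normSqMap A).continuous_fderiv (by simp)).comp hcont).norm
    · unfold chartDensity
      refine continuous_const.mul (continuous_finsetProd _ fun j _ => ?_)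
      exact (((contDiff_coord j).continuous.comp hcont).norm).pow 2
  · intro y B hB
    have := euclideanHausdorffMeasure_image_hyperplane (μ := volume)
      (levelFrame w j₀ η (levelChart A w j₀ η y)) (levelFrame_injective hj₀.ne' hη (hnz y))
      (c := ENNReal.ofReal (chartDensity A w j₀ η y)) (fun B hB => by
        rw [finrank_Cn, volume_levelFrame_image hj₀ hη hB]; rfl)
      (fderiv ℝ g (levelChart A w j₀ η y)) (hone y) (lam y) (hker y) hB
    rw [finrank_Cn, ← ENNReal.ofReal_mul (norm_nonneg _)] at this
    exact this

theorem euclideanHausdorffMeasure_coord_eq_zero (j : Fin n) :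
    μHE[2 * n - 1] {z : Cn n | z j = 0} = 0 := by
  set K : Submodule ℝ (Cn n) := LinearMap.ker (dz j).toLinearMap with hK
  have hset : {z : Cn n | z j = 0} = Subtype.val '' (Set.univ : Set K) := by
    rw [Set.image_univ, Subtype.range_coe]; rfl
  have hsurj : LinearMap.range (dz j).toLinearMap = ⊤ := by
    rw [LinearMap.range_eq_top]
    intro c
    exact ⟨EuclideanSpace.single j c, by simp [dz]⟩
  have hrank := LinearMap.finrank_range_add_finrank_ker (dz j).toLinearMap
  rw [hsurj, finrank_top, Complex.finrank_real_complex, finrank_Cn, ← hK] at hrank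
  have hn : 1 ≤ n := Fin.pos j
  rw [hset, isometry_subtype_coe.euclideanHausdorffMeasure_image,
    Measure.euclideanHausdorffMeasure_def, Measure.smul_apply]
  have : (Module.finrank ℝ K : ℝ) < ((2 * n - 1 : ℕ) : ℝ) := by
    rw [Nat.cast_lt]; omega
  simp [Real.hausdorffMeasure_of_finrank_lt this]

theorem level_ae_eq (η : ℝ) :
    {z | normSqMap (monomialMap A) z = η} =ᵐ[μHE[2 * n - 1]]
      ({z | normSqMap (monomialMap A) z = η} ∩ {z | ∀ j, z j ≠ 0} : Set (Cn n)) := by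
  have : ∀ᵐ z : Cn n ∂μHE[2 * n - 1], ∀ j, z j ≠ 0 := by
    rw [ae_all_iff]
    intro j
    rw [ae_iff]
    simpa using euclideanHausdorffMeasure_coord_eq_zero j
  filter_upwards [this] with z hz
  exact propext ⟨fun h => ⟨h, hz⟩, fun h => h.1⟩

/-- Integrals over the level hypersurfaces in the logarithmic chart. -/
theorem level_integral_eq (hp : 1 ≤ p) {w : Fin n → ℝ} (hw : ∀ k, rowPair A w k = 1)
    {j₀ : Fin n} (hj₀ : 0 < w j₀) {η : ℝ} (hη : 0 < η) {G : Cn n → ℂ} (hG : Measurable G)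
    (hint : IntegrableOn (fun y => (chartDensity A w j₀ η y : ℂ) * G (levelChart A w j₀ η y))
      (Set.univ ×ˢ angleBox n)) :
    IntegrableOn (fun z => G z / (‖fderiv ℝ (normSqMap (monomialMap A)) z‖ : ℂ))
      {z | normSqMap (monomialMap A) z = η} μHE[2 * n - 1] ∧
    ∫ z in {z | normSqMap (monomialMap A) z = η},
      G z / (‖fderiv ℝ (normSqMap (monomialMap A)) z‖ : ℂ) ∂μHE[2 * n - 1]
      = ∫ y in Set.univ ×ˢ angleBox n,
          (chartDensity A w j₀ η y : ℂ) * G (levelChart A w j₀ η y) := by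
  set g := normSqMap (monomialMap A) with hg
  have hone : ∀ y, fderiv ℝ g (levelChart A w j₀ η y)
      (levelFrame w j₀ η (levelChart A w j₀ η y) (1, 0)) = 1 := fun y =>
    fderiv_normSqMap_levelFrame A hw j₀ hη _ _ (expSum_levelLog A hp hw hη _)
  have hnorm : ∀ y, ‖fderiv ℝ g (levelChart A w j₀ η y)‖ ≠ 0 := by
    intro y
    rw [norm_ne_zero_iff]
    intro h
    have := hone y
    rw [h] at this
    simp at this
  have hgc : Continuous fun z => ‖fderiv ℝ g z‖ := ((contDiff_normSqMap A).continuous_fderiv (by simp)).norm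
  have hcont := (contDiff_levelChart A hp w j₀ η).continuous
  have hdc : Continuous (chartDensity A w j₀ η) := by
    unfold chartDensity
    refine continuous_const.mul (continuous_finsetProd _ fun j _ => ?_)
    exact (((contDiff_coord j).continuous.comp hcont).norm).pow 2
  have hdn : ∀ y, 0 ≤ chartDensity A w j₀ η y := fun y => by
    unfold chartDensity; positivity
  have hhm : Measurable fun z => G z / (‖fderiv ℝ g z‖ : ℂ) :=
    hG.div (Complex.measurable_ofReal.comp hgc.measurable)
  have hjm : Measurable fun y => ENNReal.ofReal (‖fderiv ℝ g (levelChart A w j₀ η y)‖ *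
      chartDensity A w j₀ η y) := ((hgc.comp hcont).mul hdc).measurable.ennreal_ofReal
  have hfun : ∀ y, (ENNReal.ofReal (‖fderiv ℝ g (levelChart A w j₀ η y)‖ *
      chartDensity A w j₀ η y)).toReal • (G (levelChart A w j₀ η y) /
        (‖fderiv ℝ g (levelChart A w j₀ η y)‖ : ℂ))
      = (chartDensity A w j₀ η y : ℂ) * G (levelChart A w j₀ η y) := by
    intro y
    have : (‖fderiv ℝ g (levelChart A w j₀ η y)‖ : ℂ) ≠ 0 := by exact_mod_cast hnorm y
    rw [ENNReal.toReal_ofReal (mul_nonneg (norm_nonneg _) (hdn y)), Complex.real_smul]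
    push_cast
    field_simp
  rw [IntegrableOn, Measure.restrict_congr_set (level_ae_eq A η), restrict_level_eq_map A hp hw hj₀ hη]
  constructor
  · rw [integrable_map_measure hhm.aestronglyMeasurable hcont.aemeasurable,
      integrable_withDensity_iff_integrable_smul' hjm (Eventually.of_forall fun y => ENNReal.ofReal_lt_top)]
    simp only [Function.comp_def]
    rw [IntegrableOn] at hint
    exact hint.congr (Eventually.of_forall fun y => (hfun y).symm)
  · rw [integral_map hcont.aemeasurable hhm.aestronglyMeasurable,
      integral_withDensity_eq_integral_toReal_smul hjm (Eventually.of_forall fun y => ENNReal.ofReal_lt_top)]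
    exact integral_congr_ae (Eventually.of_forall hfun)

end BMResidue

end

section

namespace BMResidue

/-! ### Exterior products of lists of covectors -/

variable {n : ℕ}

theorem wedge_cons {m : ℕ} (x : Covector n) (l : List (Covector n)) (v : Fin (m + 1) → Cn n) :
    wedge (x :: l) v = ∑ i : Fin (m + 1), (-1 : ℂ) ^ (i : ℕ) * x (v i) * wedge l (i.removeNth v) := by
  rw [wedge, Matrix.det_succ_row_zero]
  rfl

theorem wedge_cons_add {m : ℕ} (x y : Covector n) (l : List (Covector n)) (v : Fin (m + 1) → Cn n) :
    wedge ((x + y) :: l) v = wedge (x :: l) v + wedge (y :: l) v := by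
  simp only [wedge_cons, ← Finset.sum_add_distrib]
  exact Finset.sum_congr rfl fun i _ => by simp; ring

theorem wedge_cons_smul {m : ℕ} (c : ℂ) (x : Covector n) (l : List (Covector n))
    (v : Fin (m + 1) → Cn n) : wedge ((c • x) :: l) v = c * wedge (x :: l) v := by
  simp only [wedge_cons, Finset.mul_sum]
  exact Finset.sum_congr rfl fun i _ => by simp; ring

theorem wedge_cons_sum {m : ℕ} {ι : Type*} (s : Finset ι) (c : ι → ℂ) (x : ι → Covector n)
    (l : List (Covector n)) (v : Fin (m + 1) → Cn n) :
    wedge ((∑ k ∈ s, c k • x k) :: l) v = ∑ k ∈ s, c k * wedge (x k :: l) v := by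
  classical
  induction s using Finset.induction_on with
  | empty => simp [wedge_cons]
  | insert a s ha ih => rw [Finset.sum_insert ha, Finset.sum_insert ha, wedge_cons_add,
      wedge_cons_smul, ih]

theorem wedge_cons_of_mem {m : ℕ} (x : Covector n) (l : List (Covector n)) (v : Fin (m + 1) → Cn n)
    (hx : x ∈ l) (hl : l.length ≤ m) : wedge (x :: l) v = 0 := by
  obtain ⟨k, hk, rfl⟩ := List.mem_iff_getElem.mp hx
  have h : (0 : Fin (m + 1)) ≠ ⟨k + 1, by omega⟩ := by simp [Fin.ext_iff]
  refine Matrix.det_zero_of_row_eq h ?_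
  ext j
  simp [List.getD_eq_getElem?_getD, hk]

theorem wedge_swap (l₁ : List (Covector n)) {m : ℕ} (a b : Covector n) (l₂ : List (Covector n))
    (v : Fin m → Cn n) (hm : l₁.length + 2 ≤ m) :
    wedge (l₁ ++ a :: b :: l₂) v = -wedge (l₁ ++ b :: a :: l₂) v := by
  induction l₁ generalizing m with
  | nil =>
    obtain ⟨m, rfl⟩ : ∃ k, m = k + 2 := ⟨m - 2, by simp at hm; omega⟩
    have h := Matrix.det_permute (Equiv.swap (0 : Fin (m + 2)) 1)
      (Matrix.of fun i j : Fin (m + 2) => ((b :: a :: l₂).getD i 0) (v j))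
    rw [Equiv.Perm.sign_swap (by simp)] at h
    simp only [Units.val_neg, Units.val_one, Int.cast_neg, Int.cast_one, neg_mul, one_mul] at h
    simp only [List.nil_append, wedge]
    rw [← h]
    congr 1
    ext i j
    simp only [Matrix.of_apply, Matrix.submatrix_apply, id]
    refine Fin.cases ?_ (fun i => Fin.cases ?_ (fun i => ?_) i) i
    · rw [Equiv.swap_apply_left]; rfl
    · have : (Fin.succ 0 : Fin (m + 2)) = 1 := rfl
      rw [this, Equiv.swap_apply_right]; rfl
    · rw [Equiv.swap_apply_of_ne_of_ne (by simp [Fin.ext_iff]) (by simp [Fin.ext_iff])]; rfl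
  | cons x l₁ ih =>
    obtain ⟨m, rfl⟩ : ∃ k, m = k + 1 := ⟨m - 1, by simp at hm; omega⟩
    simp only [List.cons_append, wedge_cons]
    rw [← Finset.sum_neg_distrib]
    refine Finset.sum_congr rfl fun i _ => ?_
    rw [ih _ (by simp at hm; omega)]
    ring

theorem wedge_move (l₁ : List (Covector n)) (pre : List (Covector n)) {m : ℕ} (x : Covector n)
    (l₂ : List (Covector n)) (v : Fin m → Cn n) (hm : pre.length + l₁.length + 1 ≤ m) :
    wedge (pre ++ x :: (l₁ ++ l₂)) v = (-1) ^ l₁.length * wedge (pre ++ (l₁ ++ x :: l₂)) v := by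
  induction l₁ generalizing pre with
  | nil => simp
  | cons y l₁ ih =>
    have h1 : pre ++ x :: (y :: l₁ ++ l₂) = pre ++ x :: y :: (l₁ ++ l₂) := rfl
    have h2 : pre ++ y :: x :: (l₁ ++ l₂) = (pre ++ [y]) ++ x :: (l₁ ++ l₂) := by simp
    rw [h1, wedge_swap _ _ _ _ _ (by simp at hm; omega), h2, ih _ (by simp at hm ⊢; omega)]
    simp [pow_succ]

theorem wedge_block_move (l₁ l₂ : List (Covector n)) {m : ℕ}
    (l₃ : List (Covector n)) (v : Fin m → Cn n) (hm : l₁.length + l₂.length ≤ m) :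
    wedge (l₁ ++ (l₂ ++ l₃)) v = (-1) ^ (l₁.length * l₂.length) * wedge (l₂ ++ (l₁ ++ l₃)) v := by
  induction l₁ generalizing l₃ m with
  | nil => simp
  | cons x l₁ ih =>
    obtain ⟨m, rfl⟩ : ∃ k, m = k + 1 := ⟨m - 1, by simp at hm; omega⟩
    have h1 : wedge (x :: l₁ ++ (l₂ ++ l₃)) v
        = (-1) ^ (l₁.length * l₂.length) * wedge (x :: (l₂ ++ (l₁ ++ l₃))) v := by
      simp only [List.cons_append, wedge_cons, Finset.mul_sum]
      refine Finset.sum_congr rfl fun i _ => ?_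
      rw [ih _ _ (by simp at hm; omega)]
      ring
    have h2 := wedge_move l₂ [] x (l₁ ++ l₃) v (by simp at hm ⊢; omega)
    rw [List.nil_append, List.nil_append] at h2
    rw [h1, h2, List.length_cons, ← mul_assoc, ← pow_add, List.cons_append]
    congr 2
    ring

/-- The number of inversions made by moving the elements of `l` which satisfy `P` to the front. -/
def filterInv {α : Type*} (P : α → Bool) : List α → ℕ
  | [] => 0
  | x :: l => filterInv P l + if P x then 0 else (l.filter P).length

theorem wedge_filter {α : Type*} (P : α → Bool) (θ : α → Covector n) (l : List α)
    (pre : List (Covector n)) {m : ℕ} (post : List (Covector n)) (v : Fin m → Cn n)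
    (hm : pre.length + l.length ≤ m) :
    wedge (pre ++ (l.map θ ++ post)) v = (-1) ^ filterInv P l *
      wedge (pre ++ ((l.filter P).map θ ++ ((l.filter fun x => !P x).map θ ++ post))) v := by
  induction l generalizing pre with
  | nil => simp [filterInv]
  | cons x l ih =>
    have h1 : pre ++ ((x :: l).map θ ++ post) = (pre ++ [θ x]) ++ (l.map θ ++ post) := by simp
    rw [h1, ih _ (by simp at hm ⊢; omega)]
    by_cases hx : P x
    · simp [filterInv, hx]
    · have hf : (l.filter P).length ≤ l.length := List.length_filter_le _ _
      have := wedge_move ((l.filter P).map θ) pre (θ x) ((l.filter fun x => !P x).map θ ++ post) v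
        (by simp at hm ⊢; omega)
      simp only [List.append_assoc, List.singleton_append]
      rw [this]
      simp [filterInv, hx, pow_add, mul_assoc]

theorem wedge_interleave {α : Type*} (a b : α → Covector n) (l : List α)
    (pre : List (Covector n)) {m : ℕ} (v : Fin m → Cn n) (hm : pre.length + 2 * l.length ≤ m) :
    wedge (pre ++ l.flatMap fun j => [a j, b j]) v
      = (-1) ^ (l.length * (l.length - 1) / 2) * wedge (pre ++ (l.map a ++ l.map b)) v := by
  induction l generalizing pre with
  | nil => simp
  | cons x l ih =>
    have h1 : pre ++ (x :: l).flatMap (fun j => [a j, b j])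
        = (pre ++ [a x, b x]) ++ l.flatMap (fun j => [a j, b j]) := by simp
    have h2 : (pre ++ [a x, b x]) ++ (l.map a ++ l.map b)
        = (pre ++ [a x]) ++ b x :: (l.map a ++ l.map b) := by simp
    rw [h1, ih _ (by simp at hm ⊢; omega), h2, wedge_move _ _ _ _ _ (by simp at hm ⊢; omega),
      ← mul_assoc, ← pow_add]
    congr 1
    · congr 1
      rw [List.length_map, List.length_cons, Nat.add_sub_cancel, ← Finset.sum_range_id, mul_comm,
        ← Nat.mul_comm, ← Nat.add_sub_cancel (l.length) 1]
      have := Finset.sum_range_id (l.length + 1)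
      simp only [Nat.add_sub_cancel] at this ⊢
      rw [← this, Finset.sum_range_succ]
    · simp

/-- The change of the first `p` factors by a square matrix, modulo the remaining factors. -/
theorem wedge_ofFn_append {p r m : ℕ} (hm : p + r = m) (θ b : Fin p → Covector n)
    (M : Matrix (Fin p) (Fin p) ℂ) (R : List (Covector n)) (hR : R.length = r)
    (hθ : ∀ l, θ l - ∑ ν, M l ν • b ν ∈ Submodule.span ℂ {x | x ∈ R}) (v : Fin m → Cn n) :
    wedge (List.ofFn θ ++ R) v = M.det * wedge (List.ofFn b ++ R) v := by
  subst hm hR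
  have hset : {x | x ∈ R} = Set.range R.get := by ext x; simp [List.mem_iff_get]
  simp only [hset, Submodule.mem_span_range_iff_exists_fun] at hθ
  choose C hC using hθ
  have hrow : ∀ (θ : Fin p → Covector n), wedge (List.ofFn θ ++ R) v
      = (Matrix.of fun i j : Fin p ⊕ Fin R.length =>
          (Sum.elim θ R.get i) (v (finSumFinEquiv j))).det := by
    intro θ
    rw [wedge, ← Matrix.det_submatrix_equiv_self finSumFinEquiv]
    congr 1
    ext i j
    simp only [Matrix.submatrix_apply, Matrix.of_apply]
    congr 1
    rcases i with i | i
    · simp [List.getD_eq_getElem?_getD, List.getElem?_append_left]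
    · simp [List.getD_eq_getElem?_getD]
  have hmul : (Matrix.of fun i j : Fin p ⊕ Fin R.length =>
        (Sum.elim θ R.get i) (v (finSumFinEquiv j)))
      = Matrix.fromBlocks M (Matrix.of C) 0 1 * (Matrix.of fun i j : Fin p ⊕ Fin R.length =>
        (Sum.elim b R.get i) (v (finSumFinEquiv j))) := by
    ext i j
    rw [Matrix.mul_apply, Fintype.sum_sum_type]
    rcases i with i | i
    · have h1 : θ i = ∑ ν, M i ν • b ν + ∑ k, C i k • R.get k := by rw [hC]; abel
      simp [h1]
    · simp [Matrix.one_apply]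
  rw [hrow, hrow, hmul, Matrix.det_mul, Matrix.det_fromBlocks_zero₂₁, Matrix.det_one, mul_one]

end BMResidue

end

section

namespace BMResidue

/-! ### The pairing of the Bochner–Martinelli form with a test form -/

/-- The sum of the positions in `l` of the elements which satisfy `P`. -/
def positionSum {α : Type*} (P : α → Bool) : List α → ℕ
  | [] => 0
  | _ :: l => positionSum P l + (l.filter P).length

theorem filterInv_add {α : Type*} (P : α → Bool) (l : List α) :
    filterInv P l + ∑ i ∈ Finset.range (l.filter P).length, i = positionSum P l := by
  induction l with
  | nil => simp [filterInv, positionSum]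
  | cons x l ih =>
    rw [positionSum, ← ih, filterInv]
    by_cases hx : P x
    · simp only [List.filter_cons, hx, if_true, List.length_cons, Finset.sum_range_succ]; ring
    · simp only [List.filter_cons, hx, if_false, Bool.false_eq_true]; ring

theorem positionSum_map {α β : Type*} (P : β → Bool) (f : α → β) (l : List α) :
    positionSum P (l.map f) = positionSum (P ∘ f) l := by
  induction l with
  | nil => rfl
  | cons x l ih => simp [positionSum, ih, List.filter_map]

theorem length_filter_finRange {n : ℕ} (P : Fin n → Bool) :
    ((List.finRange n).filter P).length = ∑ i : Fin n, if P i then 1 else 0 := by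
  induction n with
  | zero => rfl
  | succ n ih =>
    rw [List.finRange_succ, Fin.sum_univ_succ, ← ih fun i => P i.succ, List.filter_cons,
      List.filter_map]
    by_cases h : P 0 <;> simp [h, Function.comp_def, add_comm]

theorem positionSum_finRange {n : ℕ} (P : Fin n → Bool) :
    positionSum P (List.finRange n) = ∑ i : Fin n, if P i then (i : ℕ) else 0 := by
  induction n with
  | zero => rfl
  | succ n ih =>
    rw [List.finRange_succ, positionSum, positionSum_map, ih, List.filter_map, List.length_map,
      length_filter_finRange, ← Finset.sum_add_distrib, Fin.sum_univ_succ]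
    simp only [Fin.val_zero, ite_self, zero_add]
    refine Finset.sum_congr rfl fun i _ => ?_
    by_cases h : P i.succ <;> simp [h]

variable {n p : ℕ}

theorem ofFn_idx (I : PSubset n p) :
    List.ofFn I.idx = (List.finRange n).filter fun j => decide (j ∈ I.1) := by
  refine List.SortedLT.eq_of_mem_iff ?_ ?_ ?_
  · rw [List.sortedLT_ofFn_iff]
    exact (I.1.orderEmbOfFin I.2).strictMono
  · exact ((List.sortedLT_finRange n).pairwise.filter _).sortedLT
  · intro j
    simp only [List.mem_ofFn, List.mem_filter, List.mem_finRange, true_and, decide_eq_true_eq]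
    have := Finset.range_orderEmbOfFin I.1 I.2
    rw [← Finset.mem_coe, ← this]
    rfl

theorem filter_eq_finRange (k : Fin p) :
    ((List.finRange p).filter fun l => decide (l = k)) = [k] := by
  refine List.SortedLT.eq_of_mem_iff ((List.sortedLT_finRange p).pairwise.filter _).sortedLT ?_ ?_
  · exact (List.pairwise_singleton _ k).sortedLT
  · intro j; simp

theorem filterInv_eq_finRange (k : Fin p) :
    filterInv (fun l => decide (l = k)) (List.finRange p) = k := by
  have := filterInv_add (fun l => decide (l = k)) (List.finRange p)
  rw [filter_eq_finRange, positionSum_finRange] at this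
  simpa using this

theorem signs_filterInv (I : PSubset n p) :
    (-1 : ℂ) ^ filterInv (fun j => decide (j ∈ I.1)) (List.finRange n)
      = (-1) ^ (∑ i ∈ I.1, ((i : ℕ) + 1) + p * (p + 1) / 2) := by
  have h := filterInv_add (fun j => decide (j ∈ I.1)) (List.finRange n)
  rw [← ofFn_idx, List.length_ofFn, positionSum_finRange] at h
  have h1 : ∑ i : Fin n, (if decide (i ∈ I.1) = true then (i : ℕ) else 0) = ∑ i ∈ I.1, (i : ℕ) := by
    simp [Finset.sum_ite_mem]
  rw [h1] at h
  have h2 : p * (p + 1) / 2 = ∑ i ∈ Finset.range p, i + p := by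
    have := Finset.sum_range_id (p + 1)
    rw [Finset.sum_range_succ] at this
    rw [this, mul_comm]; rfl
  rw [Finset.sum_add_distrib, ← h, h2, Finset.sum_const, I.2, smul_eq_mul, mul_one]
  have : filterInv (fun j => decide (j ∈ I.1)) (List.finRange n) + ∑ i ∈ Finset.range p, i + p
      + (∑ i ∈ Finset.range p, i + p)
      = filterInv (fun j => decide (j ∈ I.1)) (List.finRange n) + 2 * (∑ i ∈ Finset.range p, i + p) := by
    ring
  rw [this, pow_add, pow_mul]
  simp

theorem dz_apply (j : Fin n) (v : Cn n) : dz j v = v j := rfl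

theorem dzBar_apply (j : Fin n) (v : Cn n) : dzBar j v = conj (v j) := rfl

theorem getElem?_flatMap_pair {α β : Type*} (a b : α → β) (l : List α) (i : ℕ) :
    (l.flatMap fun j => [a j, b j])[i]? = (l[i / 2]?).map fun j => if i % 2 = 0 then a j else b j := by
  induction l generalizing i with
  | nil => simp
  | cons x l ih =>
    match i with
    | 0 => simp
    | 1 => simp
    | i + 2 =>
      have h : (i + 2) / 2 = i / 2 + 1 := by omega
      have h' : (i + 2) % 2 = i % 2 := by omega
      simp [h, h', ih]

theorem wedge_interleave_stdFrame :
    wedge ((List.finRange n).flatMap fun j => [dz j, dzBar j])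
      (fun k : Fin (n * 2) => stdFrame n k) = (-2 * Complex.I) ^ n := by
  have h1 : (Matrix.of fun i j : Fin (n * 2) =>
      ((List.finRange n).flatMap fun j => [dz j, dzBar j]).getD i 0 (stdFrame n j)).submatrix
        ((Equiv.prodComm _ _).trans finProdFinEquiv) ((Equiv.prodComm _ _).trans finProdFinEquiv)
      = Matrix.blockDiagonal fun _ : Fin n => !![1, Complex.I; 1, -Complex.I] := by
    ext ⟨b, a⟩ ⟨b', a'⟩
    have e1 : ∀ (b : Fin 2) (a : Fin n), ((b : ℕ) + 2 * a) / 2 = a := fun b a => by omega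
    have e2 : ∀ (b : Fin 2) (a : Fin n), ((b : ℕ) + 2 * a) % 2 = b := fun b a => by omega
    simp only [Matrix.submatrix_apply, Matrix.of_apply, Equiv.trans_apply, Equiv.prodComm_apply,
      Prod.swap_prod_mk, finProdFinEquiv_apply_val, Matrix.blockDiagonal_apply,
      List.getD_eq_getElem?_getD, getElem?_flatMap_pair, e1, e2, stdFrame]
    by_cases h : a = a'
    · subst h
      fin_cases b <;> fin_cases b' <;> simp [dz_apply, dzBar_apply]
    · fin_cases b <;> fin_cases b' <;> simp [dz_apply, dzBar_apply, h]
  rw [wedge, ← Matrix.det_submatrix_equiv_self ((Equiv.prodComm _ _).trans finProdFinEquiv), h1,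
    Matrix.det_blockDiagonal]
  simp [Matrix.det_fin_two]
  ring

theorem wedge_dz_dzBar_stdFrame :
    wedge ((List.finRange n).map dz ++ (List.finRange n).map dzBar)
      (fun k : Fin (2 * n) => stdFrame n k) = (-1) ^ (n * (n - 1) / 2) * (-2 * Complex.I) ^ n := by
  have h := wedge_interleave (n := n) dz dzBar (List.finRange n) []
    (fun k : Fin (n * 2) => stdFrame n k) (by simp; omega)
  simp only [List.nil_append, List.length_finRange] at h
  rw [wedge_interleave_stdFrame] at h
  rw [show 2 * n = n * 2 from mul_comm _ _, h, ← mul_assoc, ← pow_add, ← two_mul, pow_mul]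
  simp

/-- `∂f_l/∂ζ_j` for the monomial map. -/
noncomputable def monomialDeriv (A : Matrix (Fin p) (Fin n) ℕ) (z : Cn n) (l : Fin p) (j : Fin n) : ℂ :=
  (A l j : ℂ) * z j ^ (A l j - 1) * ∏ i ∈ Finset.univ.erase j, z i ^ A l i

theorem fderiv_monomialMap (A : Matrix (Fin p) (Fin n) ℕ) (z : Cn n) (l : Fin p) :
    HasFDerivAt (monomialMap A l) (∑ j, monomialDeriv A z l j • dz j) z := by
  have h := HasFDerivAt.finsetProd (u := Finset.univ) (g := fun (j : Fin n) (z : Cn n) => z j ^ A l j)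
    (x := z) fun j _ => ((dz j).hasFDerivAt (x := z)).pow (A l j)
  refine (h.congr_of_eventuallyEq (Eventually.of_forall fun y => ?_)).congr_fderiv ?_
  · rfl
  · refine Finset.sum_congr rfl fun j _ => ?_
    ext v
    simp [monomialDeriv, dz_apply]
    ring

theorem dBarConj_monomialMap (A : Matrix (Fin p) (Fin n) ℕ) (z : Cn n) (l : Fin p) :
    dBarConj (monomialMap A l) z = ∑ j, conj (monomialDeriv A z l j) • dzBar j := by
  ext v
  simp [dBarConj, (fderiv_monomialMap A z l).fderiv, dz_apply, dzBar_apply]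

theorem ofReal_fderiv_normSqMap (A : Matrix (Fin p) (Fin n) ℕ) (z : Cn n) :
    Complex.ofRealCLM ∘L fderiv ℝ (normSqMap (monomialMap A)) z
      = ∑ k, monomialMap A k z • dBarConj (monomialMap A k) z
        + ∑ k, conj (monomialMap A k z) • ∑ j, monomialDeriv A z k j • dz j := by
  have h : HasFDerivAt (normSqMap (monomialMap A)) _ z :=
    HasFDerivAt.fun_sum (u := Finset.univ) fun k _ => (fderiv_monomialMap A z k).norm_sq
  have key (c : ℂ) (B : Covector n) :
      Complex.ofRealCLM ∘L (2 • (innerSL ℝ c ∘L B)) = c • ((Complex.conjCLE : ℂ →L[ℝ] ℂ) ∘L B) + conj c • B := by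
    ext v
    simp only [ContinuousLinearMap.comp_apply, add_apply, smul_apply, Complex.ofRealCLM_apply,
      innerSL_apply_apply, Complex.inner, nsmul_eq_mul, smul_eq_mul,
      ContinuousLinearEquiv.coe_coe, Complex.conjCLE_apply]
    generalize B v = X
    apply Complex.ext <;> simp <;> ring
  rw [h.fderiv, ← Finset.sum_add_distrib, ContinuousLinearMap.comp_finsetSum]
  refine Finset.sum_congr rfl fun k _ => ?_
  rw [dBarConj, (fderiv_monomialMap A z k).fderiv]
  exact key _ _

end BMResidue

end

section

namespace BMResidue

variable {n p : ℕ}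

theorem image_idx (I : PSubset n p) : Finset.univ.image I.idx = I.1 :=
  Finset.image_orderEmbOfFin_univ I.1 I.2

theorem idx_injective (I : PSubset n p) : Function.Injective I.idx :=
  (I.1.orderEmbOfFin I.2).injective

theorem idx_mem (I : PSubset n p) (ν : Fin p) : I.idx ν ∈ I.1 :=
  I.1.orderEmbOfFin_mem I.2 ν

@[to_additive]
theorem prod_idx {M : Type*} [CommMonoid M] (I : PSubset n p) (f : Fin n → M) :
    ∏ ν, f (I.idx ν) = ∏ j ∈ I.1, f j := by
  rw [← Finset.prod_image (f := f) fun a _ b _ h => idx_injective I h, image_idx]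

/-- The list `dζ₁, …, dζ_n` followed by the `dζ̄_j` with `j ∉ I`. -/
noncomputable def testList (I : PSubset n p) : List (Covector n) :=
  (List.finRange n).map dz ++ ((List.finRange n).filter (fun j => j ∉ I.1)).map dzBar

theorem length_filter_notMem (I : PSubset n p) :
    ((List.finRange n).filter fun j => decide (j ∉ I.1)).length = n - p := by
  have h := List.length_eq_length_filter_add (l := List.finRange n) fun j => decide (j ∈ I.1)
  rw [← ofFn_idx, List.length_ofFn, List.length_finRange] at h
  have h2 : ((List.finRange n).filter fun j => decide (j ∉ I.1))
    = (List.finRange n).filter fun j => !decide (j ∈ I.1) := by simp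
  rw [h2]
  omega

theorem length_testList (I : PSubset n p) : (testList I).length = n + (n - p) := by
  rw [testList, List.length_append, List.length_map, List.length_map, length_filter_notMem,
    List.length_finRange]

theorem wedge_ofFn_idx_stdFrame (hpn : p ≤ n) (I : PSubset n p) {m : ℕ} (hm : m = 2 * n) :
    wedge (List.ofFn (fun ν => dzBar (I.idx ν)) ++ testList I) (fun k : Fin m => stdFrame n k)
      = (-1) ^ (p * n) * (-1) ^ (∑ i ∈ I.1, ((i : ℕ) + 1) + p * (p + 1) / 2) *
        ((-1) ^ (n * (n - 1) / 2) * (-2 * Complex.I) ^ n) := by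
  subst hm
  have h1 : List.ofFn (fun ν => dzBar (I.idx ν))
      = ((List.finRange n).filter fun j => decide (j ∈ I.1)).map dzBar := by
    rw [← ofFn_idx, List.map_ofFn]; rfl
  have hl : (List.ofFn fun ν => dzBar (I.idx ν)).length = p := by simp
  rw [testList, wedge_block_move _ _ _ _ (by rw [hl]; simp; omega), hl, List.length_map,
    List.length_finRange, h1]
  have h2 := wedge_filter (fun j => decide (j ∈ I.1)) dzBar (List.finRange n)
    ((List.finRange n).map dz) [] (fun k : Fin (2 * n) => stdFrame n k) (by simp; omega)
  simp only [List.append_nil] at h2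
  rw [wedge_dz_dzBar_stdFrame, signs_filterInv] at h2
  have h3 : ((List.finRange n).filter fun j => decide (j ∉ I.1))
    = (List.finRange n).filter fun j => !decide (j ∈ I.1) := by simp
  rw [h2, h3, mul_assoc, ← mul_assoc ((-1 : ℂ) ^ (∑ i ∈ I.1, ((i : ℕ) + 1) + p * (p + 1) / 2)),
    ← mul_pow]
  simp

/-- The list of covectors of the `k`-th term of the Bochner–Martinelli form. -/
noncomputable def omegaList (A : Matrix (Fin p) (Fin n) ℕ) (I : PSubset n p) (z : Cn n) (k : Fin p) :
    List (Covector n) :=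
  ((List.finRange p).filter (fun l => l ≠ k)).map (fun l => dBarConj (monomialMap A l) z) ++ testList I

theorem omegaWedge_component (A : Matrix (Fin p) (Fin n) ℕ) (φ : PSubset n p → Cn n → ℂ)
    (I : PSubset n p) (z : Cn n) (v : Fin (2 * n - 1) → Cn n) :
    omegaWedge (monomialMap A) (component φ I) z v
      = ∑ k : Fin p, ((-1 : ℂ) ^ (k : ℕ) * conj (monomialMap A k z) /
          (normSqMap (monomialMap A) z : ℂ) ^ p * φ I z) * wedge (omegaList A I z k) v := by
  refine Finset.sum_congr rfl fun k _ => ?_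
  rw [Finset.sum_eq_single I]
  · simp only [component, Pi.single_eq_same, omegaList, testList, List.append_assoc]
  · intro I' _ h
    simp [component, h]
  · simp

theorem wedge_fderiv_normSqMap_cons (hp : 1 ≤ p) (hpn : p ≤ n) (A : Matrix (Fin p) (Fin n) ℕ)
    (I : PSubset n p) (z : Cn n) (k : Fin p) (v : Fin (2 * n - 1 + 1) → Cn n) :
    wedge ((Complex.ofRealCLM ∘L fderiv ℝ (normSqMap (monomialMap A)) z) :: omegaList A I z k) v
      = monomialMap A k z * ((-1) ^ (k : ℕ) *
        wedge (List.ofFn (fun l => dBarConj (monomialMap A l) z) ++ testList I) v) := by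
  have hf : ((List.finRange p).filter fun l => decide (l ≠ k)).length = p - 1 := by
    have h := List.length_eq_length_filter_add (l := List.finRange p) fun j => decide (j = k)
    rw [filter_eq_finRange, List.length_singleton, List.length_finRange] at h
    have h2 : ((List.finRange p).filter fun j => decide (j ≠ k))
      = (List.finRange p).filter fun j => !decide (j = k) := by simp
    rw [h2]
    omega
  have hlen : (omegaList A I z k).length ≤ 2 * n - 1 := by
    rw [omegaList, List.length_append, length_testList, List.length_map, hf]
    omega
  rw [ofReal_fderiv_normSqMap, wedge_cons_add, wedge_cons_sum, wedge_cons_sum,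
    Finset.sum_eq_single k, add_eq_left.mpr]
  · have h := wedge_filter (fun l => decide (l = k)) (fun l => dBarConj (monomialMap A l) z)
      (List.finRange p) [] (testList I) v (by simp; omega)
    simp only [List.nil_append, filter_eq_finRange, filterInv_eq_finRange] at h
    rw [List.ofFn_eq_map, h, ← mul_assoc ((-1 : ℂ) ^ (k : ℕ)), ← mul_pow]
    simp [omegaList]
  · refine Finset.sum_eq_zero fun l _ => ?_
    rw [wedge_cons_sum, Finset.sum_eq_zero, mul_zero]
    intro j _
    rw [wedge_cons_of_mem _ _ _ _ hlen, mul_zero]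
    simp [omegaList, testList]
  · intro l _ hl
    rw [wedge_cons_of_mem _ _ _ _ hlen, mul_zero]
    simp only [omegaList, List.mem_append, List.mem_map, List.mem_filter, List.mem_finRange]
    exact Or.inl ⟨l, by simpa using hl, rfl⟩
  · simp

/-- The minor `det (∂f_l / ∂ζ_{i_ν})` of the Jacobian matrix of the monomial map. -/
noncomputable def monomialMinor (A : Matrix (Fin p) (Fin n) ℕ) (I : PSubset n p) (z : Cn n) : ℂ :=
  (Matrix.of fun l ν => monomialDeriv A z l (I.idx ν)).det

theorem wedge_dBarConj_stdFrame (hpn : p ≤ n) (A : Matrix (Fin p) (Fin n) ℕ) (I : PSubset n p)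
    (z : Cn n) {m : ℕ} (hm : m = 2 * n) :
    wedge (List.ofFn (fun l => dBarConj (monomialMap A l) z) ++ testList I)
        (fun k : Fin m => stdFrame n k)
      = conj (monomialMinor A I z) * ((-1) ^ (p * n) *
        (-1) ^ (∑ i ∈ I.1, ((i : ℕ) + 1) + p * (p + 1) / 2) *
        ((-1) ^ (n * (n - 1) / 2) * (-2 * Complex.I) ^ n)) := by
  rw [wedge_ofFn_append (b := fun ν => dzBar (I.idx ν)) (r := n + (n - p)) (by omega) _
    (M := (Matrix.of fun l ν => monomialDeriv A z l (I.idx ν)).map conj) _ (length_testList I),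
    wedge_ofFn_idx_stdFrame hpn I hm]
  · rw [monomialMinor, RingHom.map_det]; rfl
  · intro l
    have h1 : ∑ ν, (Matrix.of fun l ν => monomialDeriv A z l (I.idx ν)).map conj l ν • dzBar (I.idx ν)
        = ∑ j ∈ I.1, conj (monomialDeriv A z l j) • dzBar (n := n) j :=
      sum_idx I fun j => conj (monomialDeriv A z l j) • dzBar (n := n) j
    rw [dBarConj_monomialMap, h1, ← Finset.sum_compl_add_sum I.1, add_sub_cancel_right]
    refine Submodule.sum_mem _ fun j hj => Submodule.smul_mem _ _ (Submodule.subset_span ?_)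
    simp only [testList, Set.mem_ofPred_eq, List.mem_append, List.mem_map, List.mem_filter]
    exact Or.inr ⟨j, by simpa using hj, rfl⟩

theorem dWedge_omegaWedge_component (hp : 1 ≤ p) (hpn : p ≤ n) (A : Matrix (Fin p) (Fin n) ℕ)
    (φ : PSubset n p → Cn n → ℂ) (I : PSubset n p) (z : Cn n) :
    dWedge (normSqMap (monomialMap A)) (omegaWedge (monomialMap A) (component φ I)) z
      = ((-1) ^ (p * n) * (-1) ^ (∑ i ∈ I.1, ((i : ℕ) + 1) + p * (p + 1) / 2) *
          ((-1) ^ (n * (n - 1) / 2) * (-2 * Complex.I) ^ n)) *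
        ((normSqMap (monomialMap A) z : ℂ) / (normSqMap (monomialMap A) z : ℂ) ^ p) *
        φ I z * conj (monomialMinor A I z) := by
  have h1 : dWedge (normSqMap (monomialMap A)) (omegaWedge (monomialMap A) (component φ I)) z
      = ∑ k : Fin p, ((-1 : ℂ) ^ (k : ℕ) * conj (monomialMap A k z) /
          (normSqMap (monomialMap A) z : ℂ) ^ p * φ I z) *
          wedge ((Complex.ofRealCLM ∘L fderiv ℝ (normSqMap (monomialMap A)) z) :: omegaList A I z k)
            (fun k : Fin (2 * n - 1 + 1) => stdFrame n k) := by
    simp only [dWedge, omegaWedge_component, wedge_cons, Finset.mul_sum]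
    rw [Finset.sum_comm]
    refine Finset.sum_congr rfl fun k _ => Finset.sum_congr rfl fun i _ => ?_
    simp only [ContinuousLinearMap.comp_apply, Complex.ofRealCLM_apply]
    ring
  rw [h1]
  simp only [wedge_fderiv_normSqMap_cons hp hpn,
    wedge_dBarConj_stdFrame hpn A I z (show 2 * n - 1 + 1 = 2 * n by omega)]
  have hs : ∀ k : Fin p, (-1 : ℂ) ^ (k : ℕ) * (-1) ^ (k : ℕ) = 1 := fun k => by
    rw [← mul_pow]; simp
  have h2 : (normSqMap (monomialMap A) z : ℂ) = ∑ k, conj (monomialMap A k z) * monomialMap A k z := by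
    simp [normSqMap, Complex.conj_mul']
  conv_rhs => rw [div_eq_mul_inv]; enter [1, 1, 2, 1]; rw [h2]
  simp only [Finset.sum_mul, Finset.mul_sum]
  refine Finset.sum_congr rfl fun k _ => ?_
  linear_combination (conj (monomialMap A k z) / (normSqMap (monomialMap A) z : ℂ) ^ p * φ I z *
    monomialMap A k z * conj (monomialMinor A I z) * ((-1) ^ (p * n) *
        (-1) ^ (∑ i ∈ I.1, ((i : ℕ) + 1) + p * (p + 1) / 2) *
        ((-1) ^ (n * (n - 1) / 2) * (-2 * Complex.I) ^ n))) * hs k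

theorem monomialDeriv_eq (A : Matrix (Fin p) (Fin n) ℕ) {z : Cn n} (hz : ∀ j, z j ≠ 0) (l : Fin p)
    (j : Fin n) : monomialDeriv A z l j = monomialMap A l z * ((A l j : ℂ) * (z j)⁻¹) := by
  have h : monomialMap A l z = z j ^ A l j * ∏ i ∈ Finset.univ.erase j, z i ^ A l i :=
    (Finset.mul_prod_erase _ _ (Finset.mem_univ j)).symm
  rw [monomialDeriv, h]
  rcases Nat.eq_zero_or_pos (A l j) with h0 | h0
  · simp [h0]
  · obtain ⟨a, ha⟩ : ∃ a, A l j = a + 1 := ⟨A l j - 1, by omega⟩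
    rw [ha, Nat.add_sub_cancel, pow_succ]
    field_simp [hz j]

theorem monomialMinor_eq (A : Matrix (Fin p) (Fin n) ℕ) (I : PSubset n p) {z : Cn n}
    (hz : ∀ j, z j ≠ 0) : monomialMinor A I z
      = (minor A I : ℂ) * (∏ l, monomialMap A l z) * ∏ j ∈ I.1, (z j)⁻¹ := by
  have h1 : (Matrix.of fun l ν => monomialDeriv A z l (I.idx ν))
      = Matrix.diagonal (fun l => monomialMap A l z) *
        ((subMatrix A I).map Complex.ofRealHom * Matrix.diagonal fun ν => (z (I.idx ν))⁻¹) := by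
    ext l ν
    rw [Matrix.diagonal_mul, Matrix.mul_diagonal]
    simp [monomialDeriv_eq A hz, subMatrix]
  have h2 : ∏ ν, (z (I.idx ν))⁻¹ = ∏ j ∈ I.1, (z j)⁻¹ := prod_idx I fun j => (z j)⁻¹
  rw [monomialMinor, h1, Matrix.det_mul, Matrix.det_mul, Matrix.det_diagonal, Matrix.det_diagonal,
    ← RingHom.mapMatrix_apply, ← RingHom.map_det, h2, minor]
  simp; ring

end BMResidue

end

section

namespace BMResidue

/-! ### Angular Fourier coefficients of smooth functions -/

variable {n : ℕ}

/-- The point of `ℂⁿ` with coordinates `r_j e^{iθ_j}`. -/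
noncomputable def polarPoint (r θ : Fin n → ℝ) : Cn n :=
  WithLp.toLp 2 fun j => (r j : ℂ) * Complex.exp ((θ j : ℂ) * Complex.I)

/-- The character `∏ e^{-i m_j θ_j}`. -/
noncomputable def character (m : Fin n → ℤ) (θ : Fin n → ℝ) : ℂ :=
  ∏ j, Complex.exp (-((m j : ℂ) * ((θ j : ℂ) * Complex.I)))

/-- The closed box `[0, 2π]ⁿ`. -/
def closedBox (n : ℕ) : Set (Fin n → ℝ) := Set.univ.pi fun _ => Set.Icc 0 (2 * Real.pi)

theorem isCompact_closedBox : IsCompact (closedBox n) := isCompact_univ_pi fun _ => isCompact_Icc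

theorem continuous_polarPoint :
    Continuous fun y : (Fin n → ℝ) × (Fin n → ℝ) => polarPoint y.1 y.2 := by
  refine (PiLp.continuous_toLp 2 _).comp (continuous_pi fun j => ?_)
  fun_prop

theorem continuous_character (m : Fin n → ℤ) : Continuous (character m) :=
  continuous_finsetProd _ fun j _ => by fun_prop

theorem integral_exp_eq_zero {k : ℤ} (hk : k ≠ 0) :
    ∫ t in Set.Icc 0 (2 * Real.pi), Complex.exp (-((k : ℂ) * ((t : ℂ) * Complex.I))) = 0 := by
  rw [integral_Icc_eq_integral_Ioc, ← intervalIntegral.integral_of_le Real.two_pi_pos.le]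
  have hc : -((k : ℂ) * Complex.I) ≠ 0 := by simp [hk]
  have h := integral_exp_mul_complex (a := 0) (b := 2 * Real.pi) hc
  have h2 : ∀ t : ℝ, -((k : ℂ) * ((t : ℂ) * Complex.I)) = -((k : ℂ) * Complex.I) * (t : ℂ) :=
    fun t => by ring
  simp only [h2]
  rw [h]
  have h3 : -((k : ℂ) * Complex.I) * ((2 * Real.pi : ℝ) : ℂ) = ((-k : ℤ) : ℂ) * (2 * Real.pi * Complex.I) := by
    push_cast; ring
  rw [h3, Complex.exp_int_mul_two_pi_mul_I]
  simp

theorem integral_mul_character_eq_zero {m : Fin n → ℤ} {j : Fin n} (hj : m j ≠ 0)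
    (h : (Fin n → ℝ) → ℂ) (hh : ∀ θ θ', (∀ i, i ≠ j → θ i = θ' i) → h θ = h θ') :
    ∫ θ in closedBox n, h θ * character m θ = 0 := by
  classical
  obtain ⟨P, hP⟩ : ∃ P : Fin n → Prop, ∀ i, P i ↔ i = j := ⟨fun i => i = j, fun _ => Iff.rfl⟩
  set μ : Fin n → Measure ℝ := fun _ => volume.restrict (Set.Icc 0 (2 * Real.pi))
  have h1 : volume.restrict (closedBox n) = Measure.pi μ := by
    rw [closedBox, volume_pi, Measure.restrict_pi_pi]
  have h2 := (measurePreserving_piEquivPiSubtypeProd μ P).symm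
  rw [h1, ← h2.integral_comp (MeasurableEquiv.measurableEmbedding _)]
  set e := (MeasurableEquiv.piEquivPiSubtypeProd (fun _ : Fin n => ℝ) P).symm
  have he : ∀ y i, e y i = if hi : P i then y.1 ⟨i, hi⟩ else y.2 ⟨i, hi⟩ := fun y i => rfl
  have h3 : ∀ y, h (e y) * character m (e y)
      = (∏ i : {i // P i}, Complex.exp (-((m i : ℂ) * ((y.1 i : ℂ) * Complex.I)))) *
        ((∏ i : {i // ¬P i}, Complex.exp (-((m i : ℂ) * ((y.2 i : ℂ) * Complex.I)))) *
        h (e (0, y.2))) := by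
    rintro ⟨x, y⟩
    have hA : h (e (x, y)) = h (e (0, y)) := by
      refine hh _ _ fun i hi => ?_
      rw [he, he, dif_neg (by rwa [hP]), dif_neg (by rwa [hP])]
    have hB : character m (e (x, y))
        = (∏ i : {i // P i}, Complex.exp (-((m i : ℂ) * ((x i : ℂ) * Complex.I)))) *
          ∏ i : {i // ¬P i}, Complex.exp (-((m i : ℂ) * ((y i : ℂ) * Complex.I))) := by
      rw [character, ← Fintype.prod_subtype_mul_prod_subtype P]
      congr 1
      · exact Finset.prod_congr rfl fun i _ => by rw [he, dif_pos i.2]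
      · exact Finset.prod_congr rfl fun i _ => by rw [he, dif_neg i.2]
    rw [hA, hB]; ring
  simp only [h3]
  rw [integral_prod_mul (fun x : {i // P i} → ℝ =>
    ∏ i : {i // P i}, Complex.exp (-((m i : ℂ) * ((x i : ℂ) * Complex.I)))) (fun y : {i // ¬P i} → ℝ =>
        (∏ i : {i // ¬P i}, Complex.exp (-((m i : ℂ) * ((y i : ℂ) * Complex.I)))) *
        h (e (0, y))),
    integral_fintype_prod_eq_prod (μ := fun i : {i // P i} => μ i)
      (fun (i : {i // P i}) (t : ℝ) => Complex.exp (-((m i : ℂ) * ((t : ℂ) * Complex.I)))),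
    Finset.prod_eq_zero (Finset.mem_univ (⟨j, (hP j).2 rfl⟩ : {i // P i})) (integral_exp_eq_zero hj),
    zero_mul]

/-- The point `z` with its `j`-th coordinate multiplied by `t`. -/
noncomputable def scaleCoord (j : Fin n) (t : ℝ) (z : Cn n) : Cn n :=
  z + EuclideanSpace.single j (((t - 1 : ℝ) : ℂ) * z j)

theorem scaleCoord_apply (j : Fin n) (t : ℝ) (z : Cn n) (i : Fin n) :
    scaleCoord j t z i = if i = j then (t : ℂ) * z j else z i := by
  by_cases h : i = j
  · subst h; simp [scaleCoord]; ring
  · simp [scaleCoord, h]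

theorem scaleCoord_eq (j : Fin n) (t : ℝ) (z : Cn n) :
    scaleCoord j t z = z + ((t - 1) * (z j).re) • EuclideanSpace.single j (1 : ℂ)
      + ((t - 1) * (z j).im) • EuclideanSpace.single j Complex.I := by
  ext i
  rw [scaleCoord_apply]
  by_cases h : i = j
  · subst h
    apply Complex.ext <;> simp <;> ring
  · simp [h]

theorem contDiff_scaleCoord (j : Fin n) :
    ContDiff ℝ ∞ fun y : Cn n × ℝ => scaleCoord j y.2 y.1 := by
  simp only [scaleCoord_eq]
  have hc : ContDiff ℝ ∞ fun z : Cn n => z j := (dz j).contDiff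
  have hre : ContDiff ℝ ∞ fun y : Cn n × ℝ => (y.1 j).re :=
    Complex.reCLM.contDiff.comp (hc.comp contDiff_fst)
  have him : ContDiff ℝ ∞ fun y : Cn n × ℝ => (y.1 j).im :=
    Complex.imCLM.contDiff.comp (hc.comp contDiff_fst)
  fun_prop

section Hadamard

variable {S : Type} [NormedAddCommGroup S] [NormedSpace ℝ S]

/-- The Wirtinger-type difference quotients in Hadamard's formula: `σ = -i` gives the coefficient of
`z_j` and `σ = i` the coefficient of `z̄_j`. -/
noncomputable def hadamardCoeff (j : Fin n) (σ : ℂ) (Φ : Cn n × S → ℂ) (y : Cn n × (S × ℝ)) : ℂ :=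
  (1 / 2) * (fderiv ℝ Φ (scaleCoord j y.2.2 y.1, y.2.1) (EuclideanSpace.single j 1, 0) +
    σ * fderiv ℝ Φ (scaleCoord j y.2.2 y.1, y.2.1) (EuclideanSpace.single j Complex.I, 0))

theorem contDiff_hadamardCoeff (j : Fin n) (σ : ℂ) {Φ : Cn n × S → ℂ} (hΦ : ContDiff ℝ ∞ Φ) :
    ContDiff ℝ ∞ (hadamardCoeff j σ Φ) := by
  have h1 : ContDiff ℝ ∞ (fderiv ℝ Φ) := hΦ.fderiv_right (by simp)
  have h2 : ContDiff ℝ ∞ fun y : Cn n × (S × ℝ) => ((scaleCoord j y.2.2 y.1, y.2.1) : Cn n × S) :=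
    ((contDiff_scaleCoord j).comp (contDiff_fst.prodMk (contDiff_snd.comp contDiff_snd))).prodMk
      (contDiff_fst.comp contDiff_snd)
  have h3 := h1.comp h2
  exact contDiff_const.mul ((h3.clm_apply contDiff_const).add
    (contDiff_const.mul (h3.clm_apply contDiff_const)))

theorem hadamard (j : Fin n) {Φ : Cn n × S → ℂ} (hΦ : ContDiff ℝ ∞ Φ) (z : Cn n) (s : S) :
    Φ (z, s) = Φ (scaleCoord j 0 z, s) + ∫ t in Set.Icc (0 : ℝ) 1,
      (z j * hadamardCoeff j (-Complex.I) Φ (z, (s, t)) +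
        conj (z j) * hadamardCoeff j Complex.I Φ (z, (s, t))) := by
  have hd : ∀ t : ℝ, HasDerivAt (fun t : ℝ => Φ (scaleCoord j t z, s))
      (z j * hadamardCoeff j (-Complex.I) Φ (z, (s, t)) +
        conj (z j) * hadamardCoeff j Complex.I Φ (z, (s, t))) t := by
    intro t
    have h1 : HasDerivAt (fun t : ℝ => scaleCoord j t z)
        ((z j).re • EuclideanSpace.single j (1 : ℂ) + (z j).im • EuclideanSpace.single j Complex.I) t := by
      simp only [scaleCoord_eq]
      have ha : HasDerivAt (fun t : ℝ => (t - 1) * (z j).re) (z j).re t := by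
        simpa using ((hasDerivAt_id t).sub_const 1).mul_const (z j).re
      have hb : HasDerivAt (fun t : ℝ => (t - 1) * (z j).im) (z j).im t := by
        simpa using ((hasDerivAt_id t).sub_const 1).mul_const (z j).im
      exact ((ha.smul_const _).const_add z).add (hb.smul_const _)
    have h2 := ((hΦ.differentiable (by simp)) (scaleCoord j t z, s)).hasFDerivAt.comp_hasDerivAt t
      (h1.prodMk (hasDerivAt_const t s))
    refine h2.congr_deriv ?_
    have h3 : (((z j).re • EuclideanSpace.single j (1 : ℂ) + (z j).im • EuclideanSpace.single j Complex.I, 0) : Cn n × S)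
        = (z j).re • (EuclideanSpace.single j (1 : ℂ), 0) + (z j).im • (EuclideanSpace.single j Complex.I, 0) := by
      simp
    rw [h3, map_add, map_smul, map_smul]
    simp only [hadamardCoeff]
    generalize fderiv ℝ Φ (scaleCoord j t z, s) (EuclideanSpace.single j 1, 0) = D1
    generalize fderiv ℝ Φ (scaleCoord j t z, s) (EuclideanSpace.single j Complex.I, 0) = D2
    generalize z j = x
    apply Complex.ext <;> simp <;> ring
  have hcont : Continuous fun t : ℝ => z j * hadamardCoeff j (-Complex.I) Φ (z, (s, t)) +
        conj (z j) * hadamardCoeff j Complex.I Φ (z, (s, t)) := by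
    have h1 := (contDiff_hadamardCoeff j (-Complex.I) hΦ).continuous
    have h2 := (contDiff_hadamardCoeff j Complex.I hΦ).continuous
    fun_prop
  have h := intervalIntegral.integral_eq_sub_of_hasDerivAt (a := 0) (b := 1) (fun t _ => hd t)
    (hcont.intervalIntegrable 0 1)
  rw [integral_Icc_eq_integral_Ioc, ← intervalIntegral.integral_of_le zero_le_one, h]
  have : scaleCoord j 1 z = z := by simp [scaleCoord]
  rw [this]; ring

end Hadamard

theorem character_update (θ : Fin n → ℝ) (m : Fin n → ℤ) (j : Fin n) (c : ℤ) :
    character (Function.update m j c) θ = Complex.exp (((m j - c : ℂ)) * ((θ j : ℂ) * Complex.I)) *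
      character m θ := by
  rw [character, character, ← Finset.mul_prod_erase _ _ (Finset.mem_univ j),
    ← Finset.mul_prod_erase Finset.univ (fun j => Complex.exp (-((m j : ℂ) * ((θ j : ℂ) * Complex.I))))
      (Finset.mem_univ j), ← mul_assoc (Complex.exp _), ← Complex.exp_add]
  congr 1
  · rw [Function.update_self]; congr 1; ring
  · exact Finset.prod_congr rfl fun i hi => by
      rw [Function.update_of_ne (Finset.ne_of_mem_erase hi)]

theorem polarPoint_mul_character (r θ : Fin n → ℝ) (m : Fin n → ℤ) (j : Fin n) :
    polarPoint r θ j * character m θ = (r j : ℂ) * character (Function.update m j (m j - 1)) θ := by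
  have h : polarPoint r θ j = (r j : ℂ) * Complex.exp ((θ j : ℂ) * Complex.I) := rfl
  rw [character_update, ← mul_assoc, h]
  congr 3
  push_cast; ring

theorem conj_polarPoint_mul_character (r θ : Fin n → ℝ) (m : Fin n → ℤ) (j : Fin n) :
    conj (polarPoint r θ j) * character m θ
      = (r j : ℂ) * character (Function.update m j (m j + 1)) θ := by
  rw [character_update, ← mul_assoc]
  simp only [polarPoint, map_mul, Complex.conj_ofReal, ← Complex.exp_conj, Complex.conj_I]
  congr 3
  push_cast; ring

theorem exists_coefficient_aux (N : ℕ) : ∀ (S : Type) [NormedAddCommGroup S] [NormedSpace ℝ S]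
    [LocallyCompactSpace S] (Φ : Cn n × S → ℂ) (_ : ContDiff ℝ ∞ Φ) (m : Fin n → ℤ) (k : Fin n → ℕ)
    (_ : ∑ j, k j = N) (_ : ∀ j, (k j : ℤ) ≤ m j), ∃ Ψ : (Fin n → ℝ) × S → ℂ, Continuous Ψ ∧
      ∀ r s, ∫ θ in closedBox n, Φ (polarPoint r θ, s) * character m θ = (∏ j, (r j : ℂ) ^ k j) * Ψ (r, s) := by
  induction N with
  | zero =>
    intro S _ _ _ Φ hΦ m k hk _
    refine ⟨fun y => ∫ θ in closedBox n, Φ (polarPoint y.1 θ, y.2) * character m θ,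
      continuous_parametric_integral_of_continuous ?_ isCompact_closedBox, fun r s => ?_⟩
    · refine Continuous.mul (hΦ.continuous.comp ?_) ((continuous_character m).comp continuous_snd)
      exact (continuous_polarPoint.comp ((continuous_fst.comp continuous_fst).prodMk continuous_snd)).prodMk
        (continuous_snd.comp continuous_fst)
    · have : ∀ j, k j = 0 := fun j => Finset.sum_eq_zero_iff.mp hk j (Finset.mem_univ j)
      simp [this]
  | succ N ih =>
    intro S _ _ _ Φ hΦ m k hk hkm
    obtain ⟨j, hj⟩ : ∃ j, k j ≠ 0 := by
      by_contra! h
      simp [h] at hk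
    set k' := Function.update k j (k j - 1)
    have hk' : ∑ i, k' i = N := by
      have h1 := Finset.add_sum_erase Finset.univ k (Finset.mem_univ j)
      have h2 := Finset.add_sum_erase Finset.univ k' (Finset.mem_univ j)
      have h3 : ∑ i ∈ Finset.univ.erase j, k' i = ∑ i ∈ Finset.univ.erase j, k i :=
        Finset.sum_congr rfl fun i hi => by simp [k', Finset.ne_of_mem_erase hi]
      have h4 : k' j = k j - 1 := by simp [k']
      omega
    have hle : ∀ (c : ℤ), m j - 1 ≤ c → ∀ i, (k' i : ℤ) ≤ Function.update m j c i := by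
      intro c hc i
      by_cases h : i = j
      · subst h
        have := hkm i
        simp only [k', Function.update_self]
        omega
      · simpa [k', h] using hkm i
    obtain ⟨Ψ₁, hΨ₁, h₁⟩ := ih (S × ℝ) _ (contDiff_hadamardCoeff j (-Complex.I) hΦ)
      (Function.update m j (m j - 1)) k' hk' (hle _ le_rfl)
    obtain ⟨Ψ₂, hΨ₂, h₂⟩ := ih (S × ℝ) _ (contDiff_hadamardCoeff j Complex.I hΦ)
      (Function.update m j (m j + 1)) k' hk' (hle _ (by omega))
    refine ⟨fun y => ∫ t in Set.Icc (0 : ℝ) 1, (Ψ₁ (y.1, (y.2, t)) + Ψ₂ (y.1, (y.2, t))),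
      continuous_parametric_integral_of_continuous ?_ isCompact_Icc, fun r s => ?_⟩
    · have e : Continuous fun q : ((Fin n → ℝ) × S) × ℝ => (q.1.1, (q.1.2, q.2)) := by fun_prop
      exact (hΨ₁.comp e).add (hΨ₂.comp e)
    · have hprod : ∏ i, (r i : ℂ) ^ k i = (r j : ℂ) * ∏ i, (r i : ℂ) ^ k' i := by
        rw [← Finset.mul_prod_erase _ _ (Finset.mem_univ j),
          ← Finset.mul_prod_erase _ (fun i => (r i : ℂ) ^ k' i) (Finset.mem_univ j), ← mul_assoc]
        congr 1
        · simp only [k', Function.update_self]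
          rw [← pow_succ']; congr 1; omega
        · exact Finset.prod_congr rfl fun i hi => by simp [k', Finset.ne_of_mem_erase hi]
      have hpp : Continuous fun q : (Fin n → ℝ) × ℝ =>
          ((polarPoint r q.1, (s, q.2)) : Cn n × (S × ℝ)) :=
        (continuous_polarPoint.comp (continuous_const.prodMk continuous_fst)).prodMk
          (continuous_const.prodMk continuous_snd)
      have c1 : Continuous fun q : (Fin n → ℝ) × ℝ => (r j : ℂ) *
          (hadamardCoeff j (-Complex.I) Φ (polarPoint r q.1, (s, q.2)) *
            character (Function.update m j (m j - 1)) q.1) :=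
        continuous_const.mul (((contDiff_hadamardCoeff j (-Complex.I) hΦ).continuous.comp hpp).mul
          ((continuous_character _).comp continuous_fst))
      have c2 : Continuous fun q : (Fin n → ℝ) × ℝ => (r j : ℂ) *
          (hadamardCoeff j Complex.I Φ (polarPoint r q.1, (s, q.2)) *
            character (Function.update m j (m j + 1)) q.1) :=
        continuous_const.mul (((contDiff_hadamardCoeff j Complex.I hΦ).continuous.comp hpp).mul
          ((continuous_character _).comp continuous_fst))
      have hexp : ∀ θ, Φ (polarPoint r θ, s) * character m θ
          = Φ (scaleCoord j 0 (polarPoint r θ), s) * character m θ + ∫ t in Set.Icc (0 : ℝ) 1,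
            ((r j : ℂ) * (hadamardCoeff j (-Complex.I) Φ (polarPoint r θ, (s, t)) *
              character (Function.update m j (m j - 1)) θ) +
            (r j : ℂ) * (hadamardCoeff j Complex.I Φ (polarPoint r θ, (s, t)) *
              character (Function.update m j (m j + 1)) θ)) := by
        intro θ
        conv_lhs => rw [hadamard j hΦ]
        rw [add_mul, ← integral_mul_const]
        congr 2
        funext t
        linear_combination (hadamardCoeff j (-Complex.I) Φ (polarPoint r θ, (s, t))) *
            polarPoint_mul_character r θ m j +
          (hadamardCoeff j Complex.I Φ (polarPoint r θ, (s, t))) *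
            conj_polarPoint_mul_character r θ m j
      have c0 : Continuous fun θ => Φ (scaleCoord j 0 (polarPoint r θ), s) * character m θ := by
        refine Continuous.mul (hΦ.continuous.comp (Continuous.prodMk ?_ continuous_const))
          (continuous_character m)
        exact (contDiff_scaleCoord j).continuous.comp
          ((continuous_polarPoint.comp (continuous_const.prodMk continuous_id)).prodMk continuous_const)
      simp only [hexp]
      rw [integral_add (c0.continuousOn.integrableOn_compact isCompact_closedBox)
        ((continuous_parametric_integral_of_continuous (c1.add c2) isCompact_Icc).continuousOn.integrableOn_compact
          isCompact_closedBox),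
        integral_mul_character_eq_zero (j := j) (by have := hkm j; omega), zero_add]
      · rw [integral_integral_swap]
        · rw [hprod, ← integral_const_mul]
          refine integral_congr_ae (Eventually.of_forall fun t => ?_)
          have i1 := c1.comp (Continuous.prodMk continuous_id (continuous_const (y := t)))
          have i2 := c2.comp (Continuous.prodMk continuous_id (continuous_const (y := t)))
          have := integral_add (i1.continuousOn.integrableOn_compact isCompact_closedBox (μ := volume))
            (i2.continuousOn.integrableOn_compact isCompact_closedBox (μ := volume))
          simp only [Function.comp_def, id] at this
          simp only [this, integral_const_mul, h₁, h₂]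
          ring
        · rw [Measure.prod_restrict]
          exact (c1.add c2).continuousOn.integrableOn_compact (isCompact_closedBox.prod isCompact_Icc)
      · intro θ θ' h
        congr 2
        ext i
        rw [scaleCoord_apply, scaleCoord_apply]
        by_cases hi : i = j
        · simp [hi]
        · simp [hi, polarPoint, h i hi]

/-- The Fourier coefficient of index `m ≥ 0` of a smooth function on the torus `|z_j| = r_j` is
`∏ r_j^{m_j}` times a continuous function of `r`. -/
theorem exists_coefficient {φ : Cn n → ℂ} (hφ : ContDiff ℝ ∞ φ) (m : Fin n → ℕ) :
    ∃ Ψ : (Fin n → ℝ) → ℂ, Continuous Ψ ∧ ∀ r, ∫ θ in angleBox n,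
      φ (polarPoint r θ) * character (fun j => (m j : ℤ)) θ = (∏ j, (r j : ℂ) ^ m j) * Ψ r := by
  obtain ⟨Ψ, h1, h2⟩ := exists_coefficient_aux (n := n) _ ℝ (fun y => φ y.1) (hφ.comp contDiff_fst)
    (fun j => (m j : ℤ)) m rfl fun j => le_rfl
  refine ⟨fun r => Ψ (r, 0), h1.comp (by fun_prop), fun r => ?_⟩
  rw [← h2 r 0]
  refine setIntegral_congr_set ?_
  rw [angleBox, closedBox, Set.pi_univ_Icc]
  exact Measure.univ_pi_Ioc_ae_eq_Icc

end BMResidue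

end

section

namespace BMResidue

/-! ### Linear changes of variables and Fourier inversion on `ℝ^ι` -/

section ChangeOfVariables

variable {ι : Type*} [Fintype ι] [DecidableEq ι]

theorem measurableEmbedding_mulVec {M : Matrix ι ι ℝ} (hM : M.det ≠ 0) :
    MeasurableEmbedding fun y : ι → ℝ => M.mulVec y := by
  refine Continuous.measurableEmbedding (by fun_prop) ?_
  exact Matrix.mulVec_injective_iff_isUnit.mpr ((Matrix.isUnit_iff_isUnit_det M).mpr hM.isUnit)

theorem map_mulVec_volume {M : Matrix ι ι ℝ} (hM : M.det ≠ 0) :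
    Measure.map (fun y : ι → ℝ => M.mulVec y) volume = ENNReal.ofReal |M.det|⁻¹ • volume := by
  rw [← abs_inv]
  exact Real.map_matrix_volume_pi_eq_smul_volume_pi hM

theorem integral_comp_mulVec {M : Matrix ι ι ℝ} (hM : M.det ≠ 0) (g : (ι → ℝ) → ℂ) :
    ∫ y, g (M.mulVec y) = ((|M.det| : ℝ) : ℂ)⁻¹ * ∫ v, g v := by
  rw [← (measurableEmbedding_mulVec hM).integral_map (g := g), map_mulVec_volume hM,
    integral_smul_measure, ENNReal.toReal_ofReal (by positivity), Complex.real_smul]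
  simp

theorem lintegral_comp_mulVec {M : Matrix ι ι ℝ} (hM : M.det ≠ 0) (g : (ι → ℝ) → ENNReal) :
    ∫⁻ y, g (M.mulVec y) = ENNReal.ofReal |M.det|⁻¹ * ∫⁻ v, g v := by
  rw [← (measurableEmbedding_mulVec hM).lintegral_map (f := g), map_mulVec_volume hM,
    lintegral_smul_measure, smul_eq_mul]

theorem integrable_comp_mulVec {M : Matrix ι ι ℝ} (hM : M.det ≠ 0) {g : (ι → ℝ) → ℂ}
    (hg : Integrable g) : Integrable fun y => g (M.mulVec y) := by
  have h := (measurableEmbedding_mulVec hM).integrable_map_iff (g := g) (μ := volume)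
  rw [map_mulVec_volume hM] at h
  exact h.mp (hg.smul_measure ENNReal.ofReal_ne_top)

theorem fourier_inversion_pi {ι : Type*} [Fintype ι] {G : (ι → ℝ) → ℂ} (hc : Continuous G) (hi : Integrable G)
    (hf : Integrable fun t : ι → ℝ => ∫ ξ : ι → ℝ, Complex.exp (-((∑ ν, t ν * ξ ν : ℝ) * Complex.I)) * G ξ)
    (ξ : ι → ℝ) :
    ((2 * Real.pi : ℂ) ^ Fintype.card ι)⁻¹ * ∫ t : ι → ℝ, Complex.exp ((∑ ν, t ν * ξ ν : ℝ) * Complex.I) *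
      ∫ ξ : ι → ℝ, Complex.exp (-((∑ ν, t ν * ξ ν : ℝ) * Complex.I)) * G ξ = G ξ := by
  set H := fun t : ι → ℝ => ∫ ξ : ι → ℝ, Complex.exp (-((∑ ν, t ν * ξ ν : ℝ) * Complex.I)) * G ξ
  set f : EuclideanSpace ℝ ι → ℂ := fun x => G (WithLp.ofLp x)
  have hof := PiLp.volume_preserving_ofLp ι
  have hemb : MeasurableEmbedding (WithLp.ofLp : EuclideanSpace ℝ ι → ι → ℝ) :=
    (MeasurableEquiv.toLp 2 (ι → ℝ)).symm.measurableEmbedding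
  have hinner : ∀ x y : EuclideanSpace ℝ ι, inner ℝ x y = ∑ ν, y ν * x ν := fun x y => by
    simp [PiLp.inner_apply]
  have hF : ∀ w : EuclideanSpace ℝ ι, FourierTransform.fourier f w
      = H ((2 * Real.pi) • WithLp.ofLp w) := by
    intro w
    rw [Real.fourier_eq']
    refine Eq.trans ?_ (hof.integral_comp hemb fun ξ => Complex.exp
      (-((∑ ν, ((2 * Real.pi) • WithLp.ofLp w) ν * ξ ν : ℝ) * Complex.I)) * G ξ)
    refine integral_congr_ae (Eventually.of_forall fun v => ?_)
    simp only [smul_eq_mul, f, hinner, Pi.smul_apply]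
    congr 2
    rw [← neg_mul, ← Complex.ofReal_neg, Finset.mul_sum, ← Finset.sum_neg_distrib]
    congr 3
    funext ν; ring
  have hHi : Integrable fun t : ι → ℝ => H ((2 * Real.pi) • t) := hf.comp_smul (by positivity)
  have key := Continuous.fourierInv_fourier_eq (f := f) (hc.comp (PiLp.continuous_ofLp 2 _))
    (hof.integrable_comp_of_integrable hi) (by
      have : FourierTransform.fourier f = (fun t : ι → ℝ => H ((2 * Real.pi) • t)) ∘ WithLp.ofLp :=
        funext hF
      rw [this]
      exact hof.integrable_comp_of_integrable hHi)
  have key2 := congrFun key (WithLp.toLp 2 ξ)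
  rw [Real.fourierInv_eq'] at key2
  have h3 : ∀ v : EuclideanSpace ℝ ι, Complex.exp (((2 * Real.pi * inner ℝ v (WithLp.toLp 2 ξ) : ℝ) : ℂ) * Complex.I) •
      FourierTransform.fourier f v = (fun t : ι → ℝ => (fun t : ι → ℝ =>
        Complex.exp ((∑ ν, t ν * ξ ν : ℝ) * Complex.I) * H t) ((2 * Real.pi) • t)) (WithLp.ofLp v) := by
    intro v
    simp only [smul_eq_mul, hF, hinner, Pi.smul_apply]
    congr 4
    rw [Finset.mul_sum]
    refine Finset.sum_congr rfl fun ν _ => by ring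
  simp only [h3] at key2
  rw [hof.integral_comp hemb (fun t : ι → ℝ => (fun t : ι → ℝ =>
        Complex.exp ((∑ ν, t ν * ξ ν : ℝ) * Complex.I) * H t) ((2 * Real.pi) • t)),
    Measure.integral_comp_smul volume (fun t : ι → ℝ =>
        Complex.exp ((∑ ν, t ν * ξ ν : ℝ) * Complex.I) * H t) (2 * Real.pi)] at key2
  simp only [f] at key2
  rw [← key2, Module.finrank_pi, abs_of_pos (by positivity), Complex.real_smul]
  congr 1
  push_cast
  rfl

end ChangeOfVariables

/-! ### The Gamma function on the line `re s = 1` -/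

/-- The function `s ↦ exp (s - eˢ)`, the Fourier transform of which is `τ ↦ Γ(1 - iτ)`. -/
noncomputable def kern (s : ℝ) : ℝ := Real.exp (s - Real.exp s)

theorem kern_pos (s : ℝ) : 0 < kern s := Real.exp_pos _

theorem continuous_kern : Continuous kern := by unfold kern; fun_prop

theorem kern_le (s : ℝ) : kern s ≤ Real.exp (-|s|) := by
  refine Real.exp_le_exp.mpr ?_
  rcases le_total 0 s with h | h
  · rw [abs_of_nonneg h]
    have := Real.quadratic_le_exp_of_nonneg h
    nlinarith [sq_nonneg (s - 1)]
  · rw [abs_of_nonpos h]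
    have := Real.exp_pos s
    linarith

theorem integrable_exp_neg_abs {c : ℝ} (hc : 0 < c) : Integrable fun s : ℝ => Real.exp (-(c * |s|)) := by
  have h1 : IntegrableOn (fun s : ℝ => Real.exp (-(c * |s|))) (Set.Ioi 0) := by
    refine (integrableOn_exp_mul_Ioi (a := -c) (by linarith) 0).congr_fun (fun s hs => ?_) measurableSet_Ioi
    simp only
    rw [abs_of_pos hs, neg_mul]
  have h2 : IntegrableOn (fun s : ℝ => Real.exp (-(c * |s|))) (Set.Iic 0) := by
    refine (integrableOn_exp_mul_Iic (a := c) hc 0).congr_fun (fun s hs => ?_) measurableSet_Iic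
    simp only
    rw [abs_of_nonpos hs]; ring_nf
  rw [← integrableOn_univ, ← Set.Iic_union_Ioi (a := (0 : ℝ))]
  exact h2.union h1

theorem integrable_kern : Integrable kern := by
  refine (integrable_exp_neg_abs one_pos).mono' continuous_kern.aestronglyMeasurable
    (Eventually.of_forall fun s => ?_)
  rw [Real.norm_of_nonneg (kern_pos s).le, one_mul]
  exact kern_le s

theorem Gamma_one_sub_mul_I (τ : ℝ) : Complex.Gamma (1 - τ * Complex.I)
    = ∫ s : ℝ, (kern s : ℂ) * Complex.exp (-(τ * s * Complex.I)) := by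
  rw [Complex.Gamma_eq_integral (by simp), Complex.GammaIntegral_eq_mellin, mellin_eq_fourier,
    Real.fourier_eq', ← integral_neg_eq_self]
  refine integral_congr_ae (Eventually.of_forall fun s => ?_)
  simp only [smul_eq_mul, kern, Complex.real_smul]
  rw [mul_comm]
  have h1 : (kern s : ℂ) = Complex.exp s * Complex.exp (-(Real.exp s : ℂ)) := by
    rw [kern, sub_eq_add_neg, Real.exp_add]; push_cast; rfl
  rw [← kern, h1]
  congr 1
  · simp
  · congr 1
    simp
    field_simp

theorem norm_Gamma_le {s : ℂ} (hs : 0 < s.re) : ‖Complex.Gamma s‖ ≤ Real.Gamma s.re := by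
  rw [Complex.Gamma_eq_integral hs, Real.Gamma_eq_integral hs, Complex.GammaIntegral]
  refine (norm_integral_le_integral_norm _).trans (le_of_eq ?_)
  refine setIntegral_congr_fun measurableSet_Ioi fun x hx => ?_
  simp only [norm_mul]
  rw [Complex.norm_cpow_eq_rpow_re_of_pos hx, Complex.norm_real, Real.norm_of_nonneg (Real.exp_pos _).le]
  simp

theorem norm_Gamma_one_sub_mul_I_le (N : ℕ) (y : ℝ) :
    ‖Complex.Gamma (1 - y * Complex.I)‖ ≤ N.factorial * (2 / (1 + |y|)) ^ N := by
  have h : ‖Complex.Gamma (1 - y * Complex.I)‖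
      ≤ ‖Complex.Gamma (N + 1 - y * Complex.I)‖ * (2 / (1 + |y|)) ^ N := by
    induction N with
    | zero => simp
    | succ N ih =>
      have hne : ((N : ℂ) + 1 - y * Complex.I) ≠ 0 := by
        intro h
        have := congrArg Complex.re h
        simp at this
        linarith [(Nat.cast_nonneg N : (0 : ℝ) ≤ N)]
      have h1 : ((N + 1 : ℕ) : ℂ) + 1 - y * Complex.I = (N + 1 - y * Complex.I) + 1 := by
        push_cast; ring
      have h2 : 1 ≤ ‖((N : ℂ) + 1 - y * Complex.I)‖ * (2 / (1 + |y|)) := by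
        have a1 := Complex.abs_re_le_norm ((N : ℂ) + 1 - y * Complex.I)
        have a2 := Complex.abs_im_le_norm ((N : ℂ) + 1 - y * Complex.I)
        simp at a1 a2
        rw [abs_of_nonneg (by positivity)] at a1
        rw [← mul_div_assoc, le_div_iff₀ (by positivity)]
        linarith [(Nat.cast_nonneg N : (0 : ℝ) ≤ N)]
      rw [h1, Complex.Gamma_add_one _ hne, norm_mul, pow_succ]
      calc _ ≤ _ := ih
        _ ≤ _ := by
          have : 0 ≤ ‖Complex.Gamma (N + 1 - y * Complex.I)‖ * (2 / (1 + |y|)) ^ N := by positivity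
          nlinarith
  refine h.trans (mul_le_mul_of_nonneg_right ?_ (by positivity))
  refine (norm_Gamma_le (by simp; positivity)).trans (le_of_eq ?_)
  simp [Real.Gamma_nat_eq_factorial]

end BMResidue

end

section

namespace BMResidue

/-! ### The Mellin–Barnes integral as an integral over fibres -/

section MellinBarnes

variable {p : ℕ}

/-- The product `∏_l exp (v_l - e^{v_l})`. -/
noncomputable def prodKern (v : Fin p → ℝ) : ℝ := ∏ l, kern (v l)

theorem prodKern_pos (v : Fin p → ℝ) : 0 < prodKern v := Finset.prod_pos fun _ _ => kern_pos _

theorem continuous_prodKern : Continuous (prodKern (p := p)) :=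
  continuous_finsetProd _ fun _ _ => continuous_kern.comp (continuous_apply _)

theorem integrable_prodKern : Integrable (prodKern (p := p)) :=
  Integrable.fintype_prod fun _ => integrable_kern

/-- The product of Gamma factors in the Mellin–Barnes integral. -/
noncomputable def gammaProd (M : Matrix (Fin p) (Fin p) ℝ) (P : Fin p → Prop) [DecidablePred P]
    (t : {ν // P ν} → ℝ) : ℂ :=
  ∏ l : Fin p, Complex.Gamma (1 - ∑ ν : {ν // P ν}, ((M⁻¹ ν.1 l : ℝ) : ℂ) * ((t ν : ℂ) * Complex.I))

theorem gammaProd_eq (M : Matrix (Fin p) (Fin p) ℝ) (P : Fin p → Prop) [DecidablePred P]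
    (t : {ν // P ν} → ℝ) : gammaProd M P t
      = ∏ l : Fin p, Complex.Gamma (1 - ((∑ ν : {ν // P ν}, M⁻¹ ν.1 l * t ν : ℝ) : ℂ) * Complex.I) := by
  refine Finset.prod_congr rfl fun l _ => ?_
  push_cast
  rw [Finset.sum_mul]
  simp only [mul_assoc]

theorem continuous_Gamma_one_sub_mul_I : Continuous fun y : ℝ => Complex.Gamma (1 - y * Complex.I) := by
  refine continuous_iff_continuousAt.mpr fun y => ?_
  refine ContinuousAt.comp (g := Complex.Gamma) ?_ (by fun_prop)
  refine (Complex.differentiableAt_Gamma _ fun m hm => ?_).continuousAt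
  have := congrArg Complex.re hm
  simp at this
  linarith [(Nat.cast_nonneg m : (0 : ℝ) ≤ m)]

theorem continuous_gammaProd (M : Matrix (Fin p) (Fin p) ℝ) (P : Fin p → Prop) [DecidablePred P] :
    Continuous (gammaProd M P) := by
  rw [show gammaProd M P = _ from funext (gammaProd_eq M P)]
  refine continuous_finsetProd _ fun l _ => ?_
  exact continuous_Gamma_one_sub_mul_I.comp (by fun_prop)

variable {M : Matrix (Fin p) (Fin p) ℝ} (P : Fin p → Prop) [DecidablePred P]


theorem sum_mul_inv (hM : M.det ≠ 0) (t : {ν // P ν} → ℝ) (y : Fin p → ℝ) :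
    ∑ l, (∑ ν : {ν // P ν}, M⁻¹ ν.1 l * t ν) * M.mulVec y l = ∑ ν, t ν * y ν.1 := by
  have h : ∀ ν, ∑ l, M⁻¹ ν l * M.mulVec y l = y ν := fun ν => by
    have := congrFun (Matrix.mulVec_mulVec y M⁻¹ M) ν
    rw [Matrix.nonsing_inv_mul _ hM.isUnit, Matrix.one_mulVec] at this
    exact this
  simp only [Finset.sum_mul]
  rw [Finset.sum_comm]
  refine Finset.sum_congr rfl fun ν _ => ?_
  rw [← h ν.1, Finset.mul_sum]
  exact Finset.sum_congr rfl fun l _ => by ring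

theorem sum_mul_inv_apply (hM : M.det ≠ 0) (t : {ν // P ν} → ℝ) (ν : {ν // P ν}) :
    ∑ l, (∑ ν : {ν // P ν}, M⁻¹ ν.1 l * t ν) * M l ν.1 = t ν := by
  have h := sum_mul_inv P hM t (Pi.single ν.1 1)
  simp only [Matrix.mulVec_single_one] at h
  refine h.trans ?_
  rw [Finset.sum_eq_single ν]
  · simp
  · intro ν' _ hne
    rw [Pi.single_eq_of_ne (fun h => hne (Subtype.ext h)), mul_zero]
  · simp

theorem one_add_sum_le_prod {ι : Type*} (s : Finset ι) {a : ι → ℝ} (ha : ∀ i ∈ s, 0 ≤ a i) :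
    1 + ∑ i ∈ s, a i ≤ ∏ i ∈ s, (1 + a i) := by
  classical
  induction s using Finset.induction_on with
  | empty => simp
  | insert i s hi ih =>
    rw [Finset.sum_insert hi, Finset.prod_insert hi]
    have h1 := ih fun j hj => ha j (Finset.mem_insert_of_mem hj)
    have h2 := ha i (Finset.mem_insert_self i s)
    have h3 : 0 ≤ ∑ j ∈ s, a j := Finset.sum_nonneg fun j hj => ha j (Finset.mem_insert_of_mem hj)
    nlinarith

theorem integrable_gammaProd (hM : M.det ≠ 0) : Integrable (gammaProd M P) := by
  set N := Fintype.card {ν // P ν} + 1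
  set b := ∑ l, ∑ ν, |M l ν|
  have hb : 0 ≤ b := Finset.sum_nonneg fun _ _ => Finset.sum_nonneg fun _ _ => abs_nonneg _
  have hint := (integrable_one_add_norm (E := {ν // P ν} → ℝ) (μ := volume) (r := N) (by
    simp [N])).const_mul ((N.factorial * 2 ^ N : ℝ) ^ p * (1 + b) ^ N)
  refine hint.mono' (continuous_gammaProd M P).aestronglyMeasurable (Eventually.of_forall fun t => ?_)
  set τ : Fin p → ℝ := fun l => ∑ ν : {ν // P ν}, M⁻¹ ν.1 l * t ν
  have h1 : 1 + ‖t‖ ≤ (1 + b) * ∏ l, (1 + |τ l|) := by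
    have h2 : 1 + ∑ l, |τ l| ≤ ∏ l, (1 + |τ l|) :=
      one_add_sum_le_prod _ fun l _ => abs_nonneg _
    have h3 : ‖t‖ ≤ b * ∑ l, |τ l| := by
      refine (pi_norm_le_iff_of_nonneg (mul_nonneg hb (Finset.sum_nonneg fun _ _ => abs_nonneg _))).mpr
        fun ν => ?_
      rw [← sum_mul_inv_apply P hM t ν, Real.norm_eq_abs]
      refine (Finset.abs_sum_le_sum_abs _ _).trans ?_
      rw [Finset.mul_sum]
      refine Finset.sum_le_sum fun l _ => ?_
      rw [abs_mul, mul_comm]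
      refine mul_le_mul_of_nonneg_right ?_ (abs_nonneg _)
      refine (Finset.single_le_sum (f := fun ν => |M l ν|) (fun _ _ => abs_nonneg _)
        (Finset.mem_univ ν.1)).trans ?_
      exact Finset.single_le_sum (f := fun l => ∑ ν, |M l ν|)
        (fun _ _ => Finset.sum_nonneg fun _ _ => abs_nonneg _) (Finset.mem_univ l)
    have h4 : 0 ≤ ∑ l, |τ l| := Finset.sum_nonneg fun _ _ => abs_nonneg _
    nlinarith
  have hpos : 0 < ∏ l, (1 + |τ l|) := Finset.prod_pos fun _ _ => by positivity
  have h5 : ‖gammaProd M P t‖ ≤ (N.factorial * 2 ^ N : ℝ) ^ p * ((∏ l, (1 + |τ l|)) ^ N)⁻¹ := by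
    rw [gammaProd_eq, norm_prod]
    calc _ ≤ ∏ l, (N.factorial * (2 / (1 + |τ l|)) ^ N : ℝ) :=
          Finset.prod_le_prod (fun _ _ => norm_nonneg _) fun l _ => norm_Gamma_one_sub_mul_I_le N _
      _ = _ := by
          rw [← Finset.prod_pow, ← Finset.prod_inv_distrib]
          have : ((N.factorial : ℝ) * 2 ^ N) ^ p = ∏ _l : Fin p, ((N.factorial : ℝ) * 2 ^ N) := by
            simp
          rw [this, ← Finset.prod_mul_distrib]
          exact Finset.prod_congr rfl fun l _ => by rw [div_pow, div_eq_mul_inv, mul_assoc]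
  refine h5.trans ?_
  rw [mul_assoc]
  refine mul_le_mul_of_nonneg_left ?_ (by positivity)
  rw [Real.rpow_neg (by positivity), Real.rpow_natCast, ← div_eq_mul_inv, ← one_div,
    div_le_div_iff₀ (by positivity) (by positivity), one_mul, ← mul_pow]
  exact pow_le_pow_left₀ (by positivity) h1 N

/-- The point of `ℝ^p` with coordinates `x_ν` where `P ν` holds, and `y_ν` elsewhere. -/
noncomputable def joinCoord (x : {ν // P ν} → ℝ) (y : {ν // ¬P ν} → ℝ) : Fin p → ℝ :=
  (MeasurableEquiv.piEquivPiSubtypeProd (fun _ : Fin p => ℝ) P).symm (x, y)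

theorem joinCoord_apply (x : {ν // P ν} → ℝ) (y : {ν // ¬P ν} → ℝ) (ν : Fin p) :
    joinCoord P x y ν = if h : P ν then x ⟨ν, h⟩ else y ⟨ν, h⟩ := rfl

theorem continuous_joinCoord : Continuous fun q : ({ν // P ν} → ℝ) × ({ν // ¬P ν} → ℝ) =>
    joinCoord P q.1 q.2 := by
  refine continuous_pi fun ν => ?_
  simp only [joinCoord_apply]
  split_ifs <;> fun_prop

theorem exists_prodKern_mulVec_le (hM : M.det ≠ 0) :
    ∃ c > 0, ∀ y, prodKern (M.mulVec y) ≤ ∏ ν, Real.exp (-(c * |y ν|)) := by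
  set b := ∑ ν, ∑ l, |M⁻¹ ν l|
  have hb : 0 ≤ b := Finset.sum_nonneg fun _ _ => Finset.sum_nonneg fun _ _ => abs_nonneg _
  refine ⟨(b + 1)⁻¹, by positivity, fun y => ?_⟩
  have h1 : prodKern (M.mulVec y) ≤ Real.exp (-∑ l, |M.mulVec y l|) := by
    rw [← Finset.sum_neg_distrib, Real.exp_sum]
    exact Finset.prod_le_prod (fun _ _ => (kern_pos _).le) fun l _ => kern_le _
  refine h1.trans ?_
  rw [← Real.exp_sum, Real.exp_le_exp, Finset.sum_neg_distrib, ← Finset.mul_sum, neg_le_neg_iff,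
    inv_mul_le_iff₀ (by positivity)]
  have h2 : ∀ ν, |y ν| ≤ (∑ l, |M⁻¹ ν l|) * ∑ l, |M.mulVec y l| := by
    intro ν
    have h := congrFun (Matrix.mulVec_mulVec y M⁻¹ M) ν
    rw [Matrix.nonsing_inv_mul _ hM.isUnit, Matrix.one_mulVec] at h
    rw [← h, Matrix.mulVec, dotProduct, Finset.sum_mul]
    refine (Finset.abs_sum_le_sum_abs _ _).trans (Finset.sum_le_sum fun l _ => ?_)
    rw [abs_mul]
    exact mul_le_mul_of_nonneg_left (Finset.single_le_sum (f := fun l => |M.mulVec y l|)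
      (fun _ _ => abs_nonneg _) (Finset.mem_univ l)) (abs_nonneg _)
  have h3 : 0 ≤ ∑ l, |M.mulVec y l| := Finset.sum_nonneg fun _ _ => abs_nonneg _
  calc _ ≤ ∑ ν, (∑ l, |M⁻¹ ν l|) * ∑ l, |M.mulVec y l| := Finset.sum_le_sum fun ν _ => h2 ν
    _ = b * ∑ l, |M.mulVec y l| := by rw [← Finset.sum_mul]
    _ ≤ _ := by nlinarith

/-- The integral of `prodKern ∘ M` over the coordinates for which `P` does not hold. -/
noncomputable def fibreIntegral (M : Matrix (Fin p) (Fin p) ℝ) (x : {ν // P ν} → ℝ) : ℂ :=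
  ∫ y : {ν // ¬P ν} → ℝ, (prodKern (M.mulVec (joinCoord P x y)) : ℂ)

theorem continuous_prodKern_mulVec_joinCoord : Continuous fun q : ({ν // P ν} → ℝ) × ({ν // ¬P ν} → ℝ) =>
    (prodKern (M.mulVec (joinCoord P q.1 q.2)) : ℂ) :=
  Complex.continuous_ofReal.comp (continuous_prodKern.comp
    ((by fun_prop : Continuous fun y : Fin p → ℝ => M.mulVec y).comp (continuous_joinCoord P)))

theorem continuous_fibreIntegral (hM : M.det ≠ 0) : Continuous (fibreIntegral P M) := by
  obtain ⟨c, hc, hle⟩ := exists_prodKern_mulVec_le hM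
  refine continuous_of_dominated (bound := fun y => ∏ ν, Real.exp (-(c * |y ν|))) ?_ ?_ ?_ ?_
  · exact fun x => ((continuous_prodKern_mulVec_joinCoord P).comp
      (continuous_const.prodMk continuous_id)).aestronglyMeasurable
  · refine fun x => Eventually.of_forall fun y => ?_
    rw [Complex.norm_real, Real.norm_of_nonneg (prodKern_pos _).le]
    refine (hle _).trans ?_
    rw [← Fintype.prod_subtype_mul_prod_subtype P]
    have h1 : ∏ ν : {ν // P ν}, Real.exp (-(c * |joinCoord P x y ν.1|)) ≤ 1 :=
      Finset.prod_le_one (fun _ _ => (Real.exp_pos _).le) fun ν _ =>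
        Real.exp_le_one_iff.mpr (neg_nonpos.mpr (by positivity))
    have h2 : ∏ ν : {ν // ¬P ν}, Real.exp (-(c * |joinCoord P x y ν.1|))
        = ∏ ν, Real.exp (-(c * |y ν|)) :=
      Finset.prod_congr rfl fun ν _ => by rw [joinCoord_apply, dif_neg ν.2]
    rw [h2]
    exact mul_le_of_le_one_left (Finset.prod_nonneg fun _ _ => (Real.exp_pos _).le) h1
  · have h1 : Integrable fun y : {ν // ¬P ν} → ℝ => ∏ ν, Real.exp (-(c * |y ν|)) :=
      Integrable.fintype_prod (f := fun (_ : {ν // ¬P ν}) (s : ℝ) => Real.exp (-(c * |s|)))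
        fun _ => integrable_exp_neg_abs hc
    exact h1
  · refine Eventually.of_forall fun y => ?_
    have h1 : Continuous fun x : {ν // P ν} → ℝ => (x, y) := by fun_prop
    have h2 := (continuous_prodKern_mulVec_joinCoord (M := M) P).comp h1
    simpa only [Function.comp_def] using h2

theorem integrable_prodKern_joinCoord (hM : M.det ≠ 0) :
    Integrable fun q : ({ν // P ν} → ℝ) × ({ν // ¬P ν} → ℝ) =>
      (prodKern (M.mulVec (joinCoord P q.1 q.2)) : ℂ) := by
  have h1 := integrable_comp_mulVec hM ((integrable_prodKern (p := p)).ofReal (𝕜 := ℂ))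
  have h2 := (volume_preserving_piEquivPiSubtypeProd (fun _ : Fin p => ℝ) P).symm
  exact h2.integrable_comp_of_integrable h1

theorem integrable_fibreIntegral (hM : M.det ≠ 0) : Integrable (fibreIntegral P M) :=
  (integrable_prodKern_joinCoord P hM).integral_prod_left

theorem gammaProd_eq_fourier (hM : M.det ≠ 0) (t : {ν // P ν} → ℝ) :
    gammaProd M P t = ((|M.det| : ℝ) : ℂ) * ∫ x : {ν // P ν} → ℝ,
      Complex.exp (-((∑ ν, t ν * x ν : ℝ) * Complex.I)) * fibreIntegral P M x := by
  set τ : Fin p → ℝ := fun l => ∑ ν : {ν // P ν}, M⁻¹ ν.1 l * t ν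
  have h1 : gammaProd M P t = ∫ v : Fin p → ℝ, (prodKern v : ℂ) *
      Complex.exp (-((∑ l, τ l * v l : ℝ) * Complex.I)) := by
    simp only [gammaProd_eq, Gamma_one_sub_mul_I]
    rw [← integral_fintype_prod_volume_eq_prod (fun (l : Fin p) (s : ℝ) =>
      (kern s : ℂ) * Complex.exp (-((τ l : ℂ) * s * Complex.I)))]
    refine integral_congr_ae (Eventually.of_forall fun v => ?_)
    simp only [Finset.prod_mul_distrib, prodKern, ← Complex.exp_sum]
    push_cast
    rw [Finset.sum_mul, Finset.sum_neg_distrib]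
  have h2 := integral_comp_mulVec hM fun v => (prodKern v : ℂ) *
      Complex.exp (-((∑ l, τ l * v l : ℝ) * Complex.I))
  have hdet : ((|M.det| : ℝ) : ℂ) ≠ 0 := by simpa using hM
  rw [eq_inv_mul_iff_mul_eq₀ hdet, ← h1] at h2
  rw [← h2]
  congr 1
  have h3 := (volume_preserving_piEquivPiSubtypeProd (fun _ : Fin p => ℝ) P).symm
  rw [← h3.integral_comp (MeasurableEquiv.measurableEmbedding _)]
  have h4 : ∀ q : ({ν // P ν} → ℝ) × ({ν // ¬P ν} → ℝ),
      ∑ l, τ l * M.mulVec (joinCoord P q.1 q.2) l = ∑ ν, t ν * q.1 ν := by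
    intro q
    rw [sum_mul_inv P hM]
    exact Finset.sum_congr rfl fun ν _ => by rw [joinCoord_apply, dif_pos ν.2]
  have h5 : Integrable (fun q : ({ν // P ν} → ℝ) × ({ν // ¬P ν} → ℝ) =>
      Complex.exp (-((∑ ν, t ν * q.1 ν : ℝ) * Complex.I)) *
        (prodKern (M.mulVec (joinCoord P q.1 q.2)) : ℂ)) := by
    refine (integrable_prodKern_joinCoord P hM).bdd_mul (c := 1) (by fun_prop)
      (Eventually.of_forall fun q => ?_)
    rw [← neg_mul, ← Complex.ofReal_neg, Complex.norm_exp_ofReal_mul_I]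
  calc _ = ∫ q : ({ν // P ν} → ℝ) × ({ν // ¬P ν} → ℝ),
      Complex.exp (-((∑ ν, t ν * q.1 ν : ℝ) * Complex.I)) *
        (prodKern (M.mulVec (joinCoord P q.1 q.2)) : ℂ) := by
        refine integral_congr_ae (Eventually.of_forall fun q => ?_)
        simp only
        rw [← h4 q, mul_comm]
        rfl
    _ = _ := by
        rw [Measure.volume_eq_prod, integral_prod _ h5]
        refine integral_congr_ae (Eventually.of_forall fun x => ?_)
        simp only [integral_const_mul, fibreIntegral]

/-- The Mellin–Barnes integral is an integral of a positive function over fibres. -/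
theorem integral_gammaProd (hM : M.det ≠ 0) (x : {ν // P ν} → ℝ) :
    ((2 * Real.pi : ℂ) ^ Fintype.card {ν // P ν})⁻¹ * ∫ t : {ν // P ν} → ℝ,
      Complex.exp ((∑ ν, t ν * x ν : ℝ) * Complex.I) * gammaProd M P t
      = ((|M.det| : ℝ) : ℂ) * fibreIntegral P M x := by
  have hdet : ((|M.det| : ℝ) : ℂ) ≠ 0 := by simpa using hM
  have h0 : ∀ t, ∫ x : {ν // P ν} → ℝ,
      Complex.exp (-((∑ ν, t ν * x ν : ℝ) * Complex.I)) * fibreIntegral P M x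
        = ((|M.det| : ℝ) : ℂ)⁻¹ * gammaProd M P t := fun t => by
    rw [gammaProd_eq_fourier P hM, inv_mul_cancel_left₀ hdet]
  have h := fourier_inversion_pi (continuous_fibreIntegral P hM) (integrable_fibreIntegral P hM)
    (by simp only [h0]; exact (integrable_gammaProd P hM).const_mul _) x
  simp only [h0] at h
  rw [← h, mul_left_comm, ← integral_const_mul ((|M.det| : ℝ) : ℂ)]
  congr 2
  funext t
  rw [mul_left_comm, mul_inv_cancel_left₀ hdet]

end MellinBarnes

end BMResidue

end

section

namespace BMResidue

/-! ### The hypergeometric function in logarithmic coordinates -/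

variable {n p : ℕ} (A : Matrix (Fin p) (Fin n) ℕ) (I : PSubset n p) (J : Finset (Fin n))

theorem isUnit_det_subMatrix {A : Matrix (Fin p) (Fin n) ℕ} {I : PSubset n p} (hA : minor A I ≠ 0) :
    IsUnit (subMatrix A I).det := IsUnit.mk0 _ hA

theorem subMatrix_inv_mulVec_rowPair (hA : minor A I ≠ 0) (u : Fin n → ℝ) (ν : Fin p) :
    (subMatrix A I)⁻¹.mulVec (rowPair A u) ν
      = u (I.idx ν) + ∑ k ∈ I.1ᶜ, colPair A k ((subMatrix A I)⁻¹ ν) * u k := by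
  have h1 : (subMatrix A I)⁻¹.mulVec (rowPair A u) ν
      = ∑ j, colPair A j ((subMatrix A I)⁻¹ ν) * u j := by
    simp only [Matrix.mulVec, dotProduct, rowPair, colPair, Finset.mul_sum, Finset.sum_mul]
    rw [Finset.sum_comm]
    exact Finset.sum_congr rfl fun j _ => Finset.sum_congr rfl fun l _ => by ring
  have h2 : ∀ ν', colPair A (I.idx ν') ((subMatrix A I)⁻¹ ν) = if ν = ν' then 1 else 0 := by
    intro ν'
    have := congrFun (congrFun (Matrix.nonsing_inv_mul _ (isUnit_det_subMatrix hA)) ν) ν'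
    rw [Matrix.mul_apply, Matrix.one_apply] at this
    rw [← this]
    exact Finset.sum_congr rfl fun l _ => by rw [mul_comm]; rfl
  rw [h1, ← Finset.sum_add_sum_compl I.1, ← sum_idx I fun j => colPair A j ((subMatrix A I)⁻¹ ν) * u j]
  simp [h2]

/-- The logarithm of the argument of the hypergeometric function. -/
noncomputable def logArg (x : Fin n → ℝ) (ν : FreeIdx I J) : ℝ :=
  Real.log (x (I.idx ν.1) * ∏ k ∈ I.1ᶜ, x k ^ colPair A k ((subMatrix A I)⁻¹ ν.1))

theorem mbIntegrand_eq {x : Fin n → ℝ} (hx : ∀ i, 0 < x i) (t : FreeIdx I J → ℝ) :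
    mbIntegrand A I J x t = Complex.exp ((∑ ν, t ν * logArg A I J x ν : ℝ) * Complex.I) *
      gammaProd (subMatrix A I) (fun ν => I.idx ν ∉ J) t := by
  rw [mul_comm, mbIntegrand, gammaProd]
  congr 1
  have hpos : ∀ ν : FreeIdx I J, 0 < x (I.idx ν.1) * ∏ k ∈ I.1ᶜ, x k ^ colPair A k ((subMatrix A I)⁻¹ ν.1) :=
    fun ν => mul_pos (hx _) (Finset.prod_pos fun k _ => Real.rpow_pos_of_pos (hx k) _)
  push_cast
  rw [Finset.sum_mul, Complex.exp_sum]
  refine Finset.prod_congr rfl fun ν _ => ?_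
  have h := hpos ν
  rw [logArg, Complex.cpow_def_of_ne_zero (by exact_mod_cast (hpos ν).ne')]
  congr 1
  rw [← Complex.ofReal_prod, ← Complex.ofReal_mul, ← Complex.ofReal_log (hpos ν).le]
  ring

theorem integrable_mbIntegrand (hA : minor A I ≠ 0) {x : Fin n → ℝ} (hx : ∀ i, 0 < x i) :
    Integrable (mbIntegrand A I J x) := by
  rw [show mbIntegrand A I J x = _ from funext (mbIntegrand_eq A I J hx)]
  refine (integrable_gammaProd _ hA).bdd_mul (c := 1)
    (Continuous.aestronglyMeasurable (by fun_prop)) (Eventually.of_forall fun t => ?_)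
  rw [Complex.norm_exp_ofReal_mul_I]

theorem logArg_exp (hA : minor A I ≠ 0) (u : Fin n → ℝ) (ν : FreeIdx I J) :
    logArg A I J (fun i => Real.exp (2 * u i)) ν
      = 2 * (subMatrix A I)⁻¹.mulVec (rowPair A u) ν.1 := by
  rw [logArg, Real.log_mul (Real.exp_pos _).ne'
    (Finset.prod_pos fun k _ => Real.rpow_pos_of_pos (Real.exp_pos _) _).ne', Real.log_exp,
    Real.log_prod fun k _ => (Real.rpow_pos_of_pos (Real.exp_pos _) _).ne',
    subMatrix_inv_mulVec_rowPair A I hA, mul_add, Finset.mul_sum]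
  congr 1
  refine Finset.sum_congr rfl fun k _ => ?_
  rw [Real.log_rpow (Real.exp_pos _), Real.log_exp]
  ring

/-- The hypergeometric function is an integral of a positive function over fibres. -/
theorem hyperF_exp (hA : minor A I ≠ 0) (u : Fin n → ℝ) :
    hyperF A I J (fun i => Real.exp (2 * u i)) = ((|minor A I| : ℝ) : ℂ) *
      fibreIntegral (fun ν => I.idx ν ∉ J) (subMatrix A I)
        (fun ν => 2 * (subMatrix A I)⁻¹.mulVec (rowPair A u) ν.1) := by
  rw [minor, ← integral_gammaProd _ hA, hyperF]
  simp only [mbIntegrand_eq A I J fun i => Real.exp_pos (2 * u i), logArg_exp A I J hA]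
  rw [integral_const_mul, mul_pow, mul_inv, mul_assoc,
    inv_mul_cancel_left₀ (pow_ne_zero _ Complex.I_ne_zero)]

theorem continuous_rowPair : Continuous (rowPair A) := by
  unfold rowPair
  fun_prop

theorem continuous_hyperF_exp (hA : minor A I ≠ 0) :
    Continuous fun u : Fin n → ℝ => hyperF A I J (fun i => Real.exp (2 * u i)) := by
  simp only [hyperF_exp A I J hA]
  refine continuous_const.mul ((continuous_fibreIntegral _ hA).comp (continuous_pi fun ν => ?_))
  have h1 : Continuous fun u : Fin n → ℝ => (subMatrix A I)⁻¹.mulVec (rowPair A u) :=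
    (by fun_prop : Continuous fun y : Fin p → ℝ => (subMatrix A I)⁻¹.mulVec y).comp
      (continuous_rowPair A)
  exact continuous_const.mul ((continuous_apply ν.1).comp h1)

/-- The point with coordinates `a_j` for `j ∈ J` and `b_k` for `k ∉ J`. -/
noncomputable def glue (a : {j // j ∈ J} → ℝ) (b : {k // k ∉ J} → ℝ) : Fin n → ℝ :=
  (MeasurableEquiv.piEquivPiSubtypeProd (fun _ : Fin n => ℝ) (fun j => j ∈ J)).symm (a, b)

theorem glue_apply (a : {j // j ∈ J} → ℝ) (b : {k // k ∉ J} → ℝ) (i : Fin n) :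
    glue J a b i = if h : i ∈ J then a ⟨i, h⟩ else b ⟨i, h⟩ := rfl

variable {I J}

/-- The positions in `I` of the elements of a subset `J`. -/
noncomputable def boundEquiv (hJ : J ⊆ I.1) : {ν : Fin p // ¬ I.idx ν ∉ J} ≃ {j // j ∈ J} :=
  Equiv.ofBijective (fun ν => ⟨I.idx ν.1, not_not.mp ν.2⟩) (by
    constructor
    · intro ν ν' h
      have h' := congrArg (fun x : {j // j ∈ J} => (x : Fin n)) h
      exact Subtype.ext (idx_injective I h')
    · intro j
      have := hJ j.2
      rw [← image_idx I, Finset.mem_image] at this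
      obtain ⟨ν, -, h⟩ := this
      exact ⟨⟨ν, not_not.mpr (h ▸ j.2)⟩, Subtype.ext h⟩)

theorem boundEquiv_apply (hJ : J ⊆ I.1) (ν : {ν : Fin p // ¬ I.idx ν ∉ J}) :
    boundEquiv hJ ν = ⟨I.idx ν.1, not_not.mp ν.2⟩ := rfl

theorem card_bound (hJ : J ⊆ I.1) : Fintype.card {ν : Fin p // ¬ I.idx ν ∉ J} = J.card := by
  rw [Fintype.card_congr (boundEquiv hJ), Fintype.card_coe]

theorem integral_comp_affine {ι κ : Type*} [Fintype ι] [Fintype κ] (e : κ ≃ ι) (c : κ → ℝ)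
    (f : (κ → ℝ) → ℂ) :
    ∫ a : ι → ℝ, f (fun ν => 2 * a (e ν) + c ν) = ((2 : ℂ) ^ Fintype.card κ)⁻¹ * ∫ y, f y := by
  have h1 := (volume_measurePreserving_piCongrLeft (fun _ : ι => ℝ) e).integral_comp
    (MeasurableEquiv.measurableEmbedding _) fun a : ι → ℝ => f (fun ν => 2 * a (e ν) + c ν)
  rw [← h1]
  have h2 : ∀ y : κ → ℝ, f (fun ν => 2 * (MeasurableEquiv.piCongrLeft (fun _ : ι => ℝ) e) y (e ν) + c ν)
      = (fun y => f (y + c)) ((2 : ℝ) • y) := by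
    intro y
    congr 1
    funext ν
    simp [MeasurableEquiv.piCongrLeft, Equiv.piCongrLeft_apply_apply]
  simp only [h2]
  rw [Measure.integral_comp_smul volume (fun y => f (y + c)) 2, integral_add_right_eq_self,
    Module.finrank_pi, abs_of_pos (by positivity), Complex.real_smul]
  simp

theorem rowPair_glue_inv (hA : minor A I ≠ 0) (hJ : J ⊆ I.1) (a a₀ : {j // j ∈ J} → ℝ)
    (b : {k // k ∉ J} → ℝ) (ν : Fin p) :
    (subMatrix A I)⁻¹.mulVec (rowPair A (glue J a b)) ν
      = (glue J a b (I.idx ν) - glue J a₀ b (I.idx ν))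
        + (subMatrix A I)⁻¹.mulVec (rowPair A (glue J a₀ b)) ν := by
  rw [subMatrix_inv_mulVec_rowPair A I hA, subMatrix_inv_mulVec_rowPair A I hA]
  have : ∑ k ∈ I.1ᶜ, colPair A k ((subMatrix A I)⁻¹ ν) * glue J a b k
      = ∑ k ∈ I.1ᶜ, colPair A k ((subMatrix A I)⁻¹ ν) * glue J a₀ b k := by
    refine Finset.sum_congr rfl fun k hk => ?_
    have hk' : k ∉ J := fun h => Finset.mem_compl.mp hk (hJ h)
    rw [glue_apply, glue_apply, dif_neg hk', dif_neg hk']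
  rw [this]; ring

theorem integral_prodKern_glue (hA : minor A I ≠ 0) (hJ : J ⊆ I.1) (a₀ : {j // j ∈ J} → ℝ)
    (b : {k // k ∉ J} → ℝ) :
    ∫ a : {j // j ∈ J} → ℝ, (prodKern (fun l => 2 * rowPair A (glue J a b) l) : ℂ)
      = (2 ^ J.card * ((|minor A I| : ℝ) : ℂ))⁻¹ *
        hyperF A I J (fun i => Real.exp (2 * glue J a₀ b i)) := by
  set M := subMatrix A I
  have hM := isUnit_det_subMatrix hA
  set x : FreeIdx I J → ℝ := fun ν => 2 * M⁻¹.mulVec (rowPair A (glue J a₀ b)) ν.1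
  set c : {ν : Fin p // ¬ I.idx ν ∉ J} → ℝ := fun ν =>
    2 * M⁻¹.mulVec (rowPair A (glue J a₀ b)) ν.1 - 2 * a₀ (boundEquiv hJ ν)
  have h1 : ∀ a : {j // j ∈ J} → ℝ, (fun l => 2 * rowPair A (glue J a b) l)
      = M.mulVec (joinCoord (fun ν => I.idx ν ∉ J) x fun ν => 2 * a (boundEquiv hJ ν) + c ν) := by
    intro a
    have h2 : joinCoord (fun ν => I.idx ν ∉ J) x (fun ν => 2 * a (boundEquiv hJ ν) + c ν)
        = (2 : ℝ) • M⁻¹.mulVec (rowPair A (glue J a b)) := by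
      funext ν
      rw [joinCoord_apply, Pi.smul_apply, rowPair_glue_inv A hA hJ a a₀ b ν]
      by_cases h : I.idx ν ∉ J
      · rw [dif_pos h, glue_apply, glue_apply, dif_neg h, dif_neg h]
        simp [x, M]
      · rw [dif_neg h, glue_apply, glue_apply, dif_pos (not_not.mp h), dif_pos (not_not.mp h)]
        simp only [c, smul_eq_mul, boundEquiv_apply, M]
        ring
    rw [h2, Matrix.mulVec_smul, Matrix.mulVec_mulVec, Matrix.mul_nonsing_inv _ hM, Matrix.one_mulVec]
    rfl
  simp only [h1]
  rw [integral_comp_affine (boundEquiv hJ) c fun y =>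
    (prodKern (M.mulVec (joinCoord (fun ν => I.idx ν ∉ J) x y)) : ℂ), card_bound hJ,
    hyperF_exp A I J hA, mul_inv, mul_assoc]
  have hdet : ((|minor A I| : ℝ) : ℂ) ≠ 0 := by simpa using hA
  rw [inv_mul_cancel_left₀ hdet]
  rfl

end BMResidue

end

section

namespace BMResidue

/-! ### The cone `K₀^I` in the coordinates `⟨α^j, x⟩` -/

variable {n p : ℕ} {A : Matrix (Fin p) (Fin n) ℕ} {I : PSubset n p}

theorem colPair_inv (hA : minor A I ≠ 0) (ν ν' : Fin p) :
    colPair A (I.idx ν') ((subMatrix A I)⁻¹ ν) = if ν = ν' then 1 else 0 := by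
  have := congrFun (congrFun (Matrix.nonsing_inv_mul _ (isUnit_det_subMatrix hA)) ν) ν'
  rw [Matrix.mul_apply, Matrix.one_apply] at this
  rw [← this]
  exact Finset.sum_congr rfl fun l _ => by rw [mul_comm]; rfl

theorem eq_sum_colPair (hA : minor A I ≠ 0) (x : Fin p → ℝ) :
    x = ∑ ν, colPair A (I.idx ν) x • (subMatrix A I)⁻¹ ν := by
  have h := Matrix.vecMul_vecMul x (subMatrix A I) (subMatrix A I)⁻¹
  rw [Matrix.mul_nonsing_inv _ (isUnit_det_subMatrix hA), Matrix.vecMul_one] at h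
  conv_lhs => rw [← h]
  funext l
  rw [Matrix.vecMul, dotProduct, Finset.sum_apply]
  refine Finset.sum_congr rfl fun ν _ => ?_
  rw [Pi.smul_apply, smul_eq_mul]
  have h1 : Matrix.vecMul x (subMatrix A I) ν = colPair A (I.idx ν) x := by
    simp only [Matrix.vecMul, dotProduct, colPair, subMatrix, Matrix.of_apply, mul_comm]
  rw [h1]

/-- The weights for which the monomial map is homogeneous of degree one, supported in `I`. -/
noncomputable def weight (A : Matrix (Fin p) (Fin n) ℕ) (I : PSubset n p) (j : Fin n) : ℝ :=
  ∑ ν, if I.idx ν = j then ∑ l, (subMatrix A I)⁻¹ ν l else 0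

theorem weight_idx (ν : Fin p) : weight A I (I.idx ν) = ∑ l, (subMatrix A I)⁻¹ ν l := by
  rw [weight, Finset.sum_eq_single ν]
  · simp
  · intro ν' _ h
    rw [if_neg fun h' => h (idx_injective I h')]
  · simp

theorem weight_of_notMem {j : Fin n} (hj : j ∉ I.1) : weight A I j = 0 :=
  Finset.sum_eq_zero fun ν _ => if_neg fun h : I.idx ν = j => hj (h ▸ idx_mem I ν)

theorem exists_idx_eq {j : Fin n} (hj : j ∈ I.1) : ∃ ν, I.idx ν = j := by
  rw [← image_idx I, Finset.mem_image] at hj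
  obtain ⟨ν, -, h⟩ := hj
  exact ⟨ν, h⟩

theorem rowPair_weight (hA : minor A I ≠ 0) (k : Fin p) : rowPair A (weight A I) k = 1 := by
  have h1 : rowPair A (weight A I) k = ∑ ν, subMatrix A I k ν * weight A I (I.idx ν) := by
    have h2 : ∑ ν, subMatrix A I k ν * weight A I (I.idx ν) = ∑ j ∈ I.1, (A k j : ℝ) * weight A I j :=
      sum_idx I fun j => (A k j : ℝ) * weight A I j
    rw [h2, rowPair]
    refine (Finset.sum_subset (Finset.subset_univ _) fun j _ hj => ?_).symm
    rw [weight_of_notMem hj, mul_zero]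
  have h3 := congrFun (Matrix.mulVec_mulVec (fun _ => (1 : ℝ)) (subMatrix A I) (subMatrix A I)⁻¹) k
  rw [Matrix.mul_nonsing_inv _ (isUnit_det_subMatrix hA), Matrix.one_mulVec] at h3
  rw [h1, ← h3]
  refine Finset.sum_congr rfl fun ν _ => ?_
  rw [weight_idx]
  simp [Matrix.mulVec, dotProduct]

theorem exists_weight_pos (hp : 1 ≤ p) (hA : minor A I ≠ 0) : ∃ j, 0 < weight A I j := by
  by_contra! h
  have h1 := rowPair_weight hA ⟨0, hp⟩
  have h2 : rowPair A (weight A I) ⟨0, hp⟩ ≤ 0 :=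
    Finset.sum_nonpos fun j _ => mul_nonpos_of_nonneg_of_nonpos (by positivity) (h j)
  linarith

theorem sum_eq_weight (hA : minor A I ≠ 0) (x : Fin p → ℝ) :
    ∑ l, x l = ∑ ν, colPair A (I.idx ν) x * weight A I (I.idx ν) := by
  conv_lhs => rw [eq_sum_colPair hA x]
  simp only [Finset.sum_apply, Pi.smul_apply, smul_eq_mul, weight_idx]
  rw [Finset.sum_comm]
  simp only [Finset.mul_sum]

theorem mem_cone_iff (hA : minor A I ≠ 0) (x : Fin p → ℝ) : x ∈ cone A I ↔
    (∀ ν, 0 ≤ colPair A (I.idx ν) x) ∧ ∑ ν, colPair A (I.idx ν) x * weight A I (I.idx ν) ≤ 0 := by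
  rw [← sum_eq_weight hA]
  refine and_congr ⟨fun h ν => h _ (idx_mem I ν), fun h k hk => ?_⟩ Iff.rfl
  obtain ⟨ν, rfl⟩ := exists_idx_eq hk
  exact h ν

theorem colPair_add (j : Fin n) (x y : Fin p → ℝ) :
    colPair A j (x + y) = colPair A j x + colPair A j y := by
  simp [colPair, mul_add, Finset.sum_add_distrib]

theorem colPair_smul (j : Fin n) (c : ℝ) (x : Fin p → ℝ) :
    colPair A j (c • x) = c * colPair A j x := by
  simp only [colPair, Finset.mul_sum, Pi.smul_apply, smul_eq_mul]
  exact Finset.sum_congr rfl fun l _ => by ring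

theorem codim_eq_zero (hA : minor A I ≠ 0) {j : Fin n} (hj : weight A I j < 0) : codim A I = 0 := by
  obtain ⟨ν₀, rfl⟩ : ∃ ν, I.idx ν = j := by
    refine exists_idx_eq ?_
    by_contra h
    rw [weight_of_notMem h] at hj
    exact lt_irrefl _ hj
  have h0 : (subMatrix A I)⁻¹ ν₀ ∈ cone A I := by
    rw [mem_cone_iff hA]
    simp only [colPair_inv hA]
    refine ⟨fun ν => by split_ifs <;> norm_num, ?_⟩
    simpa using hj.le
  have htop : Submodule.span ℝ (cone A I) = ⊤ := by
    rw [eq_top_iff]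
    intro x _
    rw [eq_sum_colPair hA x]
    refine Submodule.sum_mem _ fun ν _ => Submodule.smul_mem _ _ ?_
    set s := |weight A I (I.idx ν)| / (-weight A I (I.idx ν₀))
    have hs : 0 ≤ s := div_nonneg (abs_nonneg _) (by linarith)
    have h1 : (subMatrix A I)⁻¹ ν + s • (subMatrix A I)⁻¹ ν₀ ∈ cone A I := by
      rw [mem_cone_iff hA]
      simp only [colPair_add, colPair_smul, colPair_inv hA]
      constructor
      · intro ν'
        split_ifs <;> linarith
      · simp only [add_mul, Finset.sum_add_distrib, mul_assoc, ← Finset.mul_sum, ite_mul, one_mul,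
          zero_mul, Finset.sum_ite_eq, Finset.mem_univ, if_true]
        have : s * weight A I (I.idx ν₀) = -|weight A I (I.idx ν)| := by
          rw [div_mul_eq_mul_div, div_eq_iff (by linarith)]
          ring
        rw [this]
        linarith [le_abs_self (weight A I (I.idx ν))]
    have h2 := Submodule.sub_mem _ (Submodule.subset_span h1)
      (Submodule.smul_mem _ s (Submodule.subset_span h0))
    simpa using h2
  rw [codim, htop, finrank_top, Module.finrank_pi]
  simp

theorem colPair_eq_zero_of_mem_cone (hA : minor A I ≠ 0) (hw : ∀ j, 0 ≤ weight A I j)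
    {x : Fin p → ℝ} (hx : x ∈ cone A I) {ν : Fin p} (hν : weight A I (I.idx ν) ≠ 0) :
    colPair A (I.idx ν) x = 0 := by
  rw [mem_cone_iff hA] at hx
  have h1 : ∀ ν ∈ Finset.univ, 0 ≤ colPair A (I.idx ν) x * weight A I (I.idx ν) :=
    fun ν _ => mul_nonneg (hx.1 ν) (hw _)
  have h2 := (Finset.sum_eq_zero_iff_of_nonneg h1).mp (le_antisymm hx.2 (Finset.sum_nonneg h1)) ν
    (Finset.mem_univ ν)
  exact (mul_eq_zero.mp h2).resolve_right hν

theorem inv_mem_cone (hA : minor A I ≠ 0) {ν : Fin p} (hν : weight A I (I.idx ν) = 0) :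
    (subMatrix A I)⁻¹ ν ∈ cone A I := by
  rw [mem_cone_iff hA]
  simp only [colPair_inv hA]
  exact ⟨fun ν => by split_ifs <;> norm_num, by simp [hν]⟩

theorem faceSet_subset : faceSet A I ⊆ I.1 := by
  classical
  exact Finset.filter_subset _ _

theorem mem_faceSet_iff (hA : minor A I ≠ 0) (hw : ∀ j, 0 ≤ weight A I j) (j : Fin n) :
    j ∈ faceSet A I ↔ 0 < weight A I j := by
  classical
  rw [faceSet, Finset.mem_filter]
  constructor
  · rintro ⟨hj, h⟩
    obtain ⟨ν, rfl⟩ := exists_idx_eq hj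
    refine lt_of_le_of_ne (hw _) fun h0 => ?_
    have := h _ (inv_mem_cone hA h0.symm)
    rw [colPair_inv hA, if_pos rfl] at this
    exact one_ne_zero this
  · intro h
    have hj : j ∈ I.1 := by
      by_contra hj
      rw [weight_of_notMem hj] at h
      exact lt_irrefl _ h
    obtain ⟨ν, rfl⟩ := exists_idx_eq hj
    exact ⟨hj, fun x hx => colPair_eq_zero_of_mem_cone hA hw hx h.ne'⟩

theorem codim_eq_card (hA : minor A I ≠ 0) (hw : ∀ j, 0 ≤ weight A I j) :
    codim A I = (faceSet A I).card := by
  set b : {ν : Fin p // weight A I (I.idx ν) = 0} → Fin p → ℝ := fun ν => (subMatrix A I)⁻¹ ν.1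
  have hspan : Submodule.span ℝ (cone A I) = Submodule.span ℝ (Set.range b) := by
    refine le_antisymm (Submodule.span_le.mpr fun x hx => ?_) (Submodule.span_mono ?_)
    · rw [SetLike.mem_coe, eq_sum_colPair hA x]
      refine Submodule.sum_mem _ fun ν _ => ?_
      by_cases hν : weight A I (I.idx ν) = 0
      · exact Submodule.smul_mem _ _ (Submodule.subset_span ⟨⟨ν, hν⟩, rfl⟩)
      · rw [colPair_eq_zero_of_mem_cone hA hw hx hν, zero_smul]
        exact Submodule.zero_mem _
    · rintro _ ⟨ν, rfl⟩
      exact inv_mem_cone hA ν.2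
  have hli : LinearIndependent ℝ b := by
    have h2 : IsUnit (subMatrix A I)⁻¹ :=
      Matrix.isUnit_nonsing_inv_iff.mpr ((Matrix.isUnit_iff_isUnit_det _).mpr (isUnit_det_subMatrix hA))
    exact (Matrix.linearIndependent_rows_iff_isUnit.mpr h2).comp _ Subtype.val_injective
  have hcard : Fintype.card {ν : Fin p // weight A I (I.idx ν) = 0} + (faceSet A I).card = p := by
    have h1 := Fintype.card_subtype_compl fun ν : Fin p => weight A I (I.idx ν) = 0
    have h2 := Fintype.card_subtype_le fun ν : Fin p => weight A I (I.idx ν) = 0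
    have h3 : (faceSet A I).card = Fintype.card {ν : Fin p // ¬ weight A I (I.idx ν) = 0} := by
      rw [Fintype.card_subtype, ← Finset.card_image_of_injective _ (idx_injective I)]
      congr 1
      ext j
      rw [mem_faceSet_iff hA hw, Finset.mem_image]
      constructor
      · intro hj
        have hjI := faceSet_subset ((mem_faceSet_iff hA hw j).mpr hj)
        obtain ⟨ν, rfl⟩ := exists_idx_eq hjI
        exact ⟨ν, by simpa using hj.ne', rfl⟩
      · rintro ⟨ν, hν, rfl⟩
        exact lt_of_le_of_ne (hw _) (Ne.symm (by simpa using hν))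
    rw [Fintype.card_fin] at h1 h2
    omega
  rw [codim, hspan, finrank_span_eq_card hli]
  omega

theorem cone_eq_face (hA : minor A I ≠ 0) (hw : ∀ j, 0 ≤ weight A I j) :
    cone A I = face A I (faceSet A I) := by
  ext x
  constructor
  · intro hx
    refine ⟨fun j hj => ?_, fun k hk => hx.1 k (Finset.mem_sdiff.mp hk).1⟩
    obtain ⟨ν, rfl⟩ := exists_idx_eq (faceSet_subset hj)
    exact colPair_eq_zero_of_mem_cone hA hw hx ((mem_faceSet_iff hA hw _).mp hj).ne'
  · rintro ⟨h1, h2⟩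
    rw [mem_cone_iff hA]
    constructor
    · intro ν
      by_cases hν : I.idx ν ∈ faceSet A I
      · exact (h1 _ hν).ge
      · exact h2 _ (Finset.mem_sdiff.mpr ⟨idx_mem I ν, hν⟩)
    · refine (Finset.sum_eq_zero fun ν _ => ?_).le
      by_cases hν : I.idx ν ∈ faceSet A I
      · rw [h1 _ hν, zero_mul]
      · rw [mem_faceSet_iff hA hw] at hν
        rw [le_antisymm (not_lt.mp hν) (hw _), mul_zero]

theorem eq_faceSet (hA : minor A I ≠ 0) {J : Finset (Fin n)}
    (hJ : J ⊆ I.1) (h : cone A I = face A I J) : J = faceSet A I := by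
  classical
  ext j
  rw [faceSet, Finset.mem_filter]
  constructor
  · exact fun hj => ⟨hJ hj, fun x hx => by rw [h] at hx; exact hx.1 j hj⟩
  · rintro ⟨hj, hx⟩
    by_contra hjJ
    obtain ⟨ν, rfl⟩ := exists_idx_eq hj
    have h1 : (subMatrix A I)⁻¹ ν ∈ face A I J := by
      constructor
      · intro k hk
        obtain ⟨ν', rfl⟩ := exists_idx_eq (hJ hk)
        rw [colPair_inv hA, if_neg]
        rintro rfl
        exact hjJ hk
      · intro k hk
        obtain ⟨ν', rfl⟩ := exists_idx_eq (Finset.mem_sdiff.mp hk).1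
        rw [colPair_inv hA]
        split_ifs <;> norm_num
    rw [← h] at h1
    have := hx _ h1
    rw [colPair_inv hA, if_pos rfl] at this
    exact one_ne_zero this

end BMResidue

end

section

namespace BMResidue

/-! ### Integration along the flow of the weights -/

variable {n p : ℕ}

/-- The product `∏_l exp (δ v_l - e^{v_l})`. -/
noncomputable def kernPow (δ : ℝ) (v : Fin p → ℝ) : ℝ := ∏ l, Real.exp (δ * v l - Real.exp (v l))

theorem kernPow_one (v : Fin p → ℝ) : kernPow 1 v = prodKern v := by
  simp [kernPow, prodKern, kern]

theorem kernPow_pos (δ : ℝ) (v : Fin p → ℝ) : 0 < kernPow δ v :=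
  Finset.prod_pos fun _ _ => Real.exp_pos _

theorem continuous_kernPow (δ : ℝ) : Continuous (kernPow (p := p) δ) :=
  continuous_finsetProd _ fun _ _ => by fun_prop

theorem integrable_kernPow {δ : ℝ} (h0 : 0 < δ) (h1 : δ ≤ 1) : Integrable (kernPow (p := p) δ) := by
  refine Integrable.fintype_prod (f := fun (_ : Fin p) (s : ℝ) => Real.exp (δ * s - Real.exp s)) fun _ => ?_
  refine (integrable_exp_neg_abs h0).mono' (by fun_prop) (Eventually.of_forall fun s => ?_)
  rw [Real.norm_of_nonneg (Real.exp_pos _).le, Real.exp_le_exp]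
  rcases le_total 0 s with h | h
  · rw [abs_of_nonneg h]
    have := Real.quadratic_le_exp_of_nonneg h
    nlinarith [sq_nonneg (s - 1)]
  · rw [abs_of_nonpos h]
    have := Real.exp_pos s
    linarith

theorem integral_exp_sub_exp {c S : ℝ} (hc : 0 < c) (hS : 0 < S) :
    ∫ τ : ℝ, Real.exp (2 * c * τ - S * Real.exp (2 * τ)) = Real.Gamma c / 2 * S ^ (-c) := by
  have himg : (fun τ : ℝ => Real.exp (2 * τ)) '' Set.univ = Set.Ioi 0 := by
    ext t
    constructor
    · rintro ⟨τ, -, rfl⟩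
      exact Real.exp_pos _
    · intro ht
      exact ⟨Real.log t / 2, trivial, by simp [mul_div_cancel₀, Real.exp_log ht]⟩
  have h1 := Real.integral_rpow_mul_exp_neg_mul_Ioi hc hS
  rw [← himg, integral_image_eq_integral_abs_deriv_smul (f' := fun τ => Real.exp (2 * τ) * 2)
    MeasurableSet.univ (fun τ _ => ?_) (fun a _ b _ h => ?_)] at h1
  · rw [setIntegral_univ] at h1
    have h2 : ∀ τ : ℝ, |Real.exp (2 * τ) * 2| • (Real.exp (2 * τ) ^ (c - 1) * Real.exp (-(S * Real.exp (2 * τ))))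
        = 2 * Real.exp (2 * c * τ - S * Real.exp (2 * τ)) := by
      intro τ
      rw [abs_of_pos (by positivity), ← Real.exp_mul, smul_eq_mul, mul_comm _ (2 : ℝ), mul_assoc,
        ← Real.exp_add, ← Real.exp_add]
      ring_nf
    simp only [h2] at h1
    rw [integral_const_mul, one_div, Real.inv_rpow hS.le, ← Real.rpow_neg hS.le] at h1
    linarith
  · have := ((hasDerivAt_id τ).const_mul (2 : ℝ)).exp
    simpa using this
  · have := Real.exp_injective h
    linarith

variable (A : Matrix (Fin p) (Fin n) ℕ)

/-- The product `∏_l (|f_l|² / ‖f‖²)^δ` in logarithmic coordinates. -/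
noncomputable def ratioProd (δ : ℝ) (u : Fin n → ℝ) : ℝ :=
  Real.exp (δ * ∑ l, (2 * rowPair A u l - Real.log (expSum A u)))

theorem ratioProd_pos (δ : ℝ) (u : Fin n → ℝ) : 0 < ratioProd A δ u := Real.exp_pos _

theorem continuous_ratioProd (hp : 1 ≤ p) (δ : ℝ) : Continuous (ratioProd A δ) := by
  have h1 : Continuous fun u => Real.log (expSum A u) :=
    (contDiff_expSum A).continuous.log fun u => (expSum_pos A hp u).ne'
  have h2 : ∀ l, Continuous fun u : Fin n → ℝ => rowPair A u l := fun l => (contDiff_rowPair A l).continuous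
  unfold ratioProd
  fun_prop

theorem kernPow_flow {w : Fin n → ℝ} (hw : ∀ k, rowPair A w k = 1) (δ : ℝ) (u : Fin n → ℝ) (τ : ℝ) :
    kernPow δ (fun l => 2 * rowPair A (u + τ • w) l)
      = Real.exp (δ * ∑ l, 2 * rowPair A u l) *
        Real.exp (2 * (p * δ) * τ - expSum A u * Real.exp (2 * τ)) := by
  rw [kernPow, ← Real.exp_sum, ← Real.exp_add]
  congr 1
  simp only [rowPair_add, rowPair_smul, hw, mul_add, mul_one, Real.exp_add, Finset.sum_sub_distrib,
    Finset.sum_add_distrib, ← Finset.mul_sum, ← Finset.sum_mul, Finset.sum_const, Finset.card_univ,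
    Fintype.card_fin, nsmul_eq_mul, expSum]
  ring

theorem integral_kernPow_flow (hp : 1 ≤ p) {w : Fin n → ℝ} (hw : ∀ k, rowPair A w k = 1) {δ : ℝ}
    (hδ : 0 < δ) (u : Fin n → ℝ) :
    ∫ τ : ℝ, kernPow δ (fun l => 2 * rowPair A (u + τ • w) l)
      = Real.Gamma (p * δ) / 2 * ratioProd A δ u := by
  have hc : 0 < (p : ℝ) * δ := mul_pos (by exact_mod_cast hp) hδ
  have hS := expSum_pos A hp u
  simp only [kernPow_flow A hw]
  rw [integral_const_mul, integral_exp_sub_exp hc hS, ratioProd, Real.rpow_def_of_pos hS,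
    mul_left_comm, ← Real.exp_add, Finset.sum_sub_distrib]
  congr 2
  simp
  ring

/-- Integrals of functions which are invariant under the flow of the weights. -/
theorem integral_ratioProd_mul (hp : 1 ≤ p) {w : Fin n → ℝ} (hw : ∀ k, rowPair A w k = 1)
    {j₀ : Fin n} (hj₀ : 0 < w j₀) {δ : ℝ} (hδ : 0 < δ) {h : (Fin n → ℝ) → ℂ}
    (hflow : ∀ (u : Fin n → ℝ) (τ : ℝ), h (u + τ • w) = h u)
    (hint : Integrable fun u => (kernPow δ (fun l => 2 * rowPair A u l) : ℂ) * h u) :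
    Integrable (fun a => (ratioProd A δ (zeroExt j₀ a) : ℂ) * h (zeroExt j₀ a)) ∧
    ((Real.Gamma (p * δ) / 2 * w j₀ : ℝ) : ℂ) * ∫ a, (ratioProd A δ (zeroExt j₀ a) : ℂ) * h (zeroExt j₀ a)
      = ∫ u, (kernPow δ (fun l => 2 * rowPair A u l) : ℂ) * h u := by
  set F := fun u => (kernPow δ (fun l => 2 * rowPair A u l) : ℂ) * h u
  set fl := fun y : ℝ × ({i // ¬ i = j₀} → ℝ) => zeroExt j₀ y.2 + y.1 • w
  have hm := measurable_flow j₀ w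
  have hmap := map_flow j₀ w hj₀
  have hc : 0 < Real.Gamma (p * δ) / 2 := by
    have : 0 < (p : ℝ) * δ := mul_pos (by exact_mod_cast hp) hδ
    exact half_pos (Real.Gamma_pos_of_pos this)
  have hFi : Integrable F ((volume : Measure (ℝ × ({i // ¬ i = j₀} → ℝ))).map fl) := by
    rw [hmap]
    exact hint.smul_measure ENNReal.ofReal_ne_top
  have hcomp : Integrable (fun y => F (fl y)) := hFi.comp_measurable hm
  have hinner : ∀ a : {i // ¬ i = j₀} → ℝ, ∫ τ : ℝ, F (fl (τ, a))
      = ((Real.Gamma (p * δ) / 2 : ℝ) : ℂ) * ((ratioProd A δ (zeroExt j₀ a) : ℂ) * h (zeroExt j₀ a)) := by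
    intro a
    simp only [F, fl, hflow]
    rw [integral_mul_const, integral_complex_ofReal, integral_kernPow_flow A hp hw hδ]
    push_cast
    ring
  have hsw : Integrable (fun y => F (fl y)) ((volume : Measure ℝ).prod volume) := hcomp
  constructor
  · have h1 := hsw.integral_prod_right
    simp only [hinner] at h1
    have h2 := h1.const_mul (((Real.Gamma (p * δ) / 2 : ℝ) : ℂ)⁻¹)
    refine h2.congr (Eventually.of_forall fun a => ?_)
    simp only
    rw [inv_mul_cancel_left₀ (by exact_mod_cast hc.ne')]
  · have h1 := integral_prod_symm _ hsw
    simp only [hinner] at h1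
    rw [integral_const_mul] at h1
    have h2 := integral_map (μ := volume) hm.aemeasurable hFi.aestronglyMeasurable
    rw [hmap, integral_smul_measure, ENNReal.toReal_ofReal (by positivity)] at h2
    rw [← Measure.volume_eq_prod] at h1
    have h3 := h2.trans h1
    have hw0 : (w j₀ : ℂ) ≠ 0 := by exact_mod_cast hj₀.ne'
    rw [Complex.real_smul, Complex.ofReal_inv, inv_mul_eq_iff_eq_mul₀ hw0] at h3
    rw [h3]
    push_cast
    ring

/-! ### Integrability on the whole logarithmic space -/

variable {A} {I : PSubset n p}

theorem measurePreserving_glue (J : Finset (Fin n)) :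
    MeasurePreserving fun q : ({j // j ∈ J} → ℝ) × ({k // k ∉ J} → ℝ) => glue J q.1 q.2 := by
  convert (volume_preserving_piEquivPiSubtypeProd (fun _ : Fin n => ℝ) (fun j => j ∈ J)).symm
  rfl

theorem measurableEmbedding_glue (J : Finset (Fin n)) :
    MeasurableEmbedding fun q : ({j // j ∈ J} → ℝ) × ({k // k ∉ J} → ℝ) => glue J q.1 q.2 :=
  (MeasurableEquiv.piEquivPiSubtypeProd (fun _ : Fin n => ℝ) (fun j => j ∈ J)).symm.measurableEmbedding

/-- The restriction to `{b ≤ R}` of the density `e^{2b}`. -/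
noncomputable def cutExp (R b : ℝ) : ℝ := Set.indicator (Set.Iic R) (fun b => Real.exp (2 * b)) b

theorem integrable_cutExp (R : ℝ) : Integrable (cutExp R) :=
  (integrableOn_exp_mul_Iic two_pos R).integrable_indicator measurableSet_Iic

theorem cutExp_nonneg (R b : ℝ) : 0 ≤ cutExp R b :=
  Set.indicator_nonneg (fun _ _ => (Real.exp_pos _).le) _

theorem cutExp_of_le {R b : ℝ} (h : b ≤ R) : cutExp R b = Real.exp (2 * b) :=
  Set.indicator_of_mem (Set.mem_Iic.mpr h) _

/-- The product of the densities `cutExp R (u_k)` for `k ∉ I`. -/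
noncomputable def cutWeight (I : PSubset n p) (R : ℝ) (u : Fin n → ℝ) : ℝ :=
  ∏ k : {k // k ∉ I.1}, cutExp R (u k)

theorem cutWeight_nonneg (R : ℝ) (u : Fin n → ℝ) : 0 ≤ cutWeight I R u :=
  Finset.prod_nonneg fun _ _ => cutExp_nonneg _ _

theorem measurable_cutWeight (R : ℝ) : Measurable (cutWeight I R) := by
  refine Finset.measurable_fun_prod _ fun k _ => ?_
  have : Measurable (cutExp R) := Measurable.indicator (by fun_prop) measurableSet_Iic
  exact this.comp (measurable_pi_apply _)

/-- The positions of the elements of `I`. -/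
noncomputable def idxEquiv (I : PSubset n p) : Fin p ≃ {j // j ∈ I.1} :=
  Equiv.ofBijective (fun ν => ⟨I.idx ν, idx_mem I ν⟩) ⟨fun ν ν' h => by
      have h' := congrArg (fun x : {j // j ∈ I.1} => (x : Fin n)) h
      exact idx_injective I h', fun j => by
      obtain ⟨ν, h⟩ := exists_idx_eq j.2
      exact ⟨ν, Subtype.ext h⟩⟩

theorem rowPair_glue (a : {j // j ∈ I.1} → ℝ) (b : {k // k ∉ I.1} → ℝ) (l : Fin p) :
    rowPair A (glue I.1 a b) l = (subMatrix A I).mulVec (fun ν => a (idxEquiv I ν)) l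
      + rowPair A (glue I.1 0 b) l := by
  have h : ∀ a : {j // j ∈ I.1} → ℝ, rowPair A (glue I.1 a b) l
      = (subMatrix A I).mulVec (fun ν => a (idxEquiv I ν)) l
        + ∑ k ∈ I.1ᶜ, (A l k : ℝ) * if h : k ∈ I.1 then 0 else b ⟨k, h⟩ := by
    intro a
    rw [rowPair, ← Finset.sum_add_sum_compl I.1, ← sum_idx I fun j => (A l j : ℝ) * glue I.1 a b j]
    congr 1
    · refine Finset.sum_congr rfl fun ν _ => ?_
      rw [glue_apply, dif_pos (idx_mem I ν)]
      rfl
    · refine Finset.sum_congr rfl fun k hk => ?_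
      rw [glue_apply, dif_neg (Finset.mem_compl.mp hk), dif_neg (Finset.mem_compl.mp hk)]
  rw [h, h 0, ← add_assoc]
  congr 1
  have : (subMatrix A I).mulVec (fun ν => (0 : {j // j ∈ I.1} → ℝ) (idxEquiv I ν)) = 0 :=
    Matrix.mulVec_zero _
  rw [this]
  simp

theorem lintegral_rowPair_glue (hA : minor A I ≠ 0) (F : (Fin p → ℝ) → ENNReal)
    (b : {k // k ∉ I.1} → ℝ) :
    ∫⁻ a : {j // j ∈ I.1} → ℝ, F (fun l => 2 * rowPair A (glue I.1 a b) l)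
      = ENNReal.ofReal |((2 : ℝ) • subMatrix A I).det|⁻¹ * ∫⁻ v, F v := by
  have hdet : ((2 : ℝ) • subMatrix A I).det ≠ 0 := by
    rw [Matrix.det_smul]
    exact mul_ne_zero (by positivity) hA
  rw [← lintegral_add_right_eq_self F (fun l => 2 * rowPair A (glue I.1 0 b) l),
    ← lintegral_comp_mulVec hdet,
    ← (volume_measurePreserving_piCongrLeft (fun _ : {j // j ∈ I.1} => ℝ) (idxEquiv I)).lintegral_comp_emb
    (MeasurableEquiv.measurableEmbedding _)]
  refine lintegral_congr fun y => ?_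
  congr 1
  funext l
  rw [rowPair_glue, mul_add, Pi.add_apply, Matrix.smul_mulVec, Pi.smul_apply, smul_eq_mul]
  congr 4
  funext ν
  simp [MeasurableEquiv.piCongrLeft, Equiv.piCongrLeft_apply_apply]

theorem integrable_kernPow_mul_cutWeight (hA : minor A I ≠ 0) {δ : ℝ} (h0 : 0 < δ) (h1 : δ ≤ 1) (R : ℝ) :
    Integrable fun u => kernPow δ (fun l => 2 * rowPair A u l) * cutWeight I R u := by
  have hmeas : Measurable fun u => kernPow δ (fun l => 2 * rowPair A u l) * cutWeight I R u := by
    refine Measurable.mul ?_ (measurable_cutWeight R)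
    refine ((continuous_kernPow δ).comp (continuous_pi fun l => ?_)).measurable
    exact continuous_const.mul (contDiff_rowPair A l).continuous
  refine ⟨hmeas.aestronglyMeasurable, ?_⟩
  rw [hasFiniteIntegral_iff_ofReal (Eventually.of_forall fun u =>
    mul_nonneg (kernPow_pos _ _).le (cutWeight_nonneg R u))]
  have hmeas' : Measurable fun q : ({j // j ∈ I.1} → ℝ) × ({k // k ∉ I.1} → ℝ) => ENNReal.ofReal
      (kernPow δ (fun l => 2 * rowPair A (glue I.1 q.1 q.2) l) * cutWeight I R (glue I.1 q.1 q.2)) :=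
    (hmeas.comp (measurableEmbedding_glue I.1).measurable).ennreal_ofReal
  rw [← (measurePreserving_glue I.1).lintegral_comp_emb (measurableEmbedding_glue I.1),
    Measure.volume_eq_prod, lintegral_prod_symm _ hmeas'.aemeasurable]
  have hcut : ∀ (a : {j // j ∈ I.1} → ℝ) (b : {k // k ∉ I.1} → ℝ),
      cutWeight I R (glue I.1 a b) = ∏ k, cutExp R (b k) := fun a b =>
    Finset.prod_congr rfl fun k _ => by rw [glue_apply, dif_neg k.2]
  have hin : ∀ b : {k // k ∉ I.1} → ℝ, ∫⁻ a : {j // j ∈ I.1} → ℝ, ENNReal.ofReal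
      (kernPow δ (fun l => 2 * rowPair A (glue I.1 a b) l) * cutWeight I R (glue I.1 a b))
      = ENNReal.ofReal |((2 : ℝ) • subMatrix A I).det|⁻¹ * (∫⁻ v, ENNReal.ofReal (kernPow δ (p := p) v)) *
        ENNReal.ofReal (∏ k, cutExp R (b k)) := by
    intro b
    simp only [hcut, ENNReal.ofReal_mul (kernPow_pos _ _).le]
    rw [lintegral_mul_const']
    · rw [lintegral_rowPair_glue hA fun v => ENNReal.ofReal (kernPow δ v)]
    · exact ENNReal.ofReal_ne_top
  have hfin1 := (hasFiniteIntegral_iff_ofReal (Eventually.of_forall fun v =>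
    (kernPow_pos δ v).le)).mp (integrable_kernPow (p := p) h0 h1).2
  have hfin2 := (hasFiniteIntegral_iff_ofReal (Eventually.of_forall fun b : {k // k ∉ I.1} → ℝ =>
    Finset.prod_nonneg fun k _ => cutExp_nonneg R (b k))).mp
      (Integrable.fintype_prod (f := fun (_ : {k // k ∉ I.1}) => cutExp R) fun _ => integrable_cutExp R).2
  calc _ = ∫⁻ b : {k // k ∉ I.1} → ℝ, ENNReal.ofReal |((2 : ℝ) • subMatrix A I).det|⁻¹ *
        (∫⁻ v, ENNReal.ofReal (kernPow δ (p := p) v)) * ENNReal.ofReal (∏ k, cutExp R (b k)) :=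
        lintegral_congr fun b => hin b
    _ < ⊤ := by
        rw [lintegral_const_mul' _ _ (ENNReal.mul_ne_top ENNReal.ofReal_ne_top hfin1.ne)]
        exact ENNReal.mul_lt_top (ENNReal.mul_lt_top ENNReal.ofReal_lt_top hfin1) hfin2

theorem cutWeight_flow (R : ℝ) (u : Fin n → ℝ) (τ : ℝ) :
    cutWeight I R (u + τ • weight A I) = cutWeight I R u :=
  Finset.prod_congr rfl fun k _ => by simp [weight_of_notMem k.2]

theorem integrable_ratioProd_mul_cutWeight (hp : 1 ≤ p) (hA : minor A I ≠ 0) {δ : ℝ} (h0 : 0 < δ)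
    (h1 : δ ≤ 1) (R : ℝ) {j₀ : Fin n} (hj₀ : 0 < weight A I j₀) :
    Integrable fun a => ratioProd A δ (zeroExt j₀ a) * cutWeight I R (zeroExt j₀ a) := by
  have h2 := (integral_ratioProd_mul A hp (rowPair_weight hA) hj₀ h0 (h := fun u => (cutWeight I R u : ℂ))
    (fun u τ => by rw [cutWeight_flow]) ?_).1
  · have := h2.re
    simpa [← Complex.ofReal_mul] using this
  · have := (integrable_kernPow_mul_cutWeight hA h0 h1 R).ofReal (𝕜 := ℂ)
    simpa using this

end BMResidue

end

section

namespace BMResidue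

/-! ### The integrals over the level hypersurfaces in logarithmic coordinates -/

variable {n p : ℕ} {A : Matrix (Fin p) (Fin n) ℕ} {I : PSubset n p}

/-- The order of vanishing `|α^j| - 1` for `j ∈ I` and `|α^j|` for `j ∉ I`. -/
def order (A : Matrix (Fin p) (Fin n) ℕ) (I : PSubset n p) (j : Fin n) : ℕ :=
  colSum A j - if j ∈ I.1 then 1 else 0

theorem colSum_pos (hA : minor A I ≠ 0) {j : Fin n} (hj : j ∈ I.1) : 0 < colSum A j := by
  by_contra h
  have h0 : ∀ k, A k j = 0 := fun k =>
    Finset.sum_eq_zero_iff.mp (Nat.eq_zero_of_not_pos h) k (Finset.mem_univ k)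
  obtain ⟨ν, rfl⟩ := exists_idx_eq hj
  exact hA (Matrix.det_eq_zero_of_column_eq_zero ν fun k => by simp [subMatrix, h0])

theorem order_add (hA : minor A I ≠ 0) (j : Fin n) :
    order A I j + (if j ∈ I.1 then 1 else 0) = colSum A j := by
  rw [order]
  split_ifs with h
  · have := colSum_pos hA h
    omega
  · omega

theorem prod_monomialMap (z : Cn n) : ∏ l, monomialMap A l z = ∏ j, z j ^ colSum A j := by
  simp only [monomialMap, colSum, ← Finset.prod_pow_eq_pow_sum]
  exact Finset.prod_comm

theorem monomialMinor_eq_prod (hA : minor A I ≠ 0) {z : Cn n} (hz : ∀ j, z j ≠ 0) :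
    monomialMinor A I z = (minor A I : ℂ) * ∏ j, z j ^ order A I j := by
  have h1 : ∏ j ∈ I.1, (z j)⁻¹ = ∏ j, if j ∈ I.1 then (z j)⁻¹ else 1 := by
    rw [Finset.prod_ite_mem, Finset.univ_inter]
  rw [monomialMinor_eq A I hz, prod_monomialMap, h1, mul_assoc, ← Finset.prod_mul_distrib]
  congr 1
  refine Finset.prod_congr rfl fun j _ => ?_
  rw [← order_add hA j]
  split_ifs with h
  · rw [pow_succ, mul_assoc, mul_inv_cancel₀ (hz j), mul_one]
  · simp

theorem expPoint_eq_polarPoint (u θ : Fin n → ℝ) :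
    expPoint u θ = polarPoint (fun j => Real.exp (u j)) θ := by
  ext j
  simp [expPoint, polarPoint, Complex.exp_add]

theorem conj_monomialMinor_expPoint (hA : minor A I ≠ 0) (u θ : Fin n → ℝ) :
    conj (monomialMinor A I (expPoint u θ)) = (minor A I : ℂ) *
      ((∏ j, Real.exp (order A I j * u j) : ℝ) : ℂ) * character (fun j => (order A I j : ℤ)) θ := by
  rw [monomialMinor_eq_prod hA (expPoint_ne_zero u θ), map_mul, Complex.conj_ofReal, map_prod, mul_assoc,
    Complex.ofReal_prod, character, ← Finset.prod_mul_distrib]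
  congr 1
  refine Finset.prod_congr rfl fun j _ => ?_
  rw [map_pow, expPoint_apply, ← Complex.exp_conj, ← Complex.exp_nat_mul, Complex.ofReal_exp,
    ← Complex.exp_add]
  congr 1
  simp
  ring

/-- The density `∏_{k ∉ I} e^{2 u_k}`. -/
noncomputable def expWeight (I : PSubset n p) (u : Fin n → ℝ) : ℝ :=
  ∏ k : {k // k ∉ I.1}, Real.exp (2 * u k)

theorem expWeight_eq (u : Fin n → ℝ) :
    expWeight I u = Real.exp (∑ j, if j ∈ I.1 then 0 else 2 * u j) := by
  rw [expWeight, ← Real.exp_sum]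
  congr 1
  rw [← Finset.sum_subtype I.1ᶜ (fun k => Finset.mem_compl) fun k => 2 * u k,
    ← Finset.sum_add_sum_compl I.1 fun j => if j ∈ I.1 then (0 : ℝ) else 2 * u j,
    Finset.sum_eq_zero (s := I.1) (fun j hj => by simp [hj]), zero_add]
  exact Finset.sum_congr rfl fun k hk => by simp [Finset.mem_compl.mp hk]

theorem sum_rowPair (u : Fin n → ℝ) : ∑ l, rowPair A u l = ∑ j, (colSum A j : ℝ) * u j := by
  simp only [rowPair, colSum, Nat.cast_sum, Finset.sum_mul]
  exact Finset.sum_comm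

theorem expWeight_flow (u : Fin n → ℝ) (τ : ℝ) :
    expWeight I (u + τ • weight A I) = expWeight I u :=
  Finset.prod_congr rfl fun k _ => by simp [weight_of_notMem k.2]

theorem sum_rowPair_levelLog (hA : minor A I ≠ 0) (η : ℝ) (u : Fin n → ℝ) :
    ∑ l, rowPair A (levelLog A (weight A I) η u) l
      = (∑ l, (2 * rowPair A u l - Real.log (expSum A u)) + p * Real.log η) / 2 := by
  simp only [levelLog, rowPair_add, rowPair_smul, rowPair_weight hA, flowTime, Finset.sum_add_distrib,
    Finset.sum_sub_distrib, ← Finset.mul_sum, Finset.sum_const, Finset.card_univ, Fintype.card_fin,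
    nsmul_eq_mul]
  ring

/-- The radial factor of the density of the Bochner–Martinelli form, integrated over the angles. -/
theorem prod_exp_levelLog (hA : minor A I ≠ 0) {η : ℝ} (hη : 0 < η) (u : Fin n → ℝ) :
    (∏ j, Real.exp ((2 + order A I j) * levelLog A (weight A I) η u j)) *
      (∏ j, Real.exp (order A I j * levelLog A (weight A I) η u j))
      = η ^ p * (ratioProd A 1 u * expWeight I u) := by
  have h2 : expWeight I u = expWeight I (levelLog A (weight A I) η u) := (expWeight_flow u _).symm
  have h3 : η ^ p = Real.exp (p * Real.log η) := by rw [Real.exp_nat_mul, Real.exp_log hη]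
  rw [h2, h3, expWeight_eq, ratioProd, ← Real.exp_sum, ← Real.exp_sum, ← Real.exp_add, ← Real.exp_add,
    ← Real.exp_add]
  congr 1
  have h4 := sum_rowPair_levelLog hA η u
  have h5 : p * Real.log η + (1 * ∑ l, (2 * rowPair A u l - Real.log (expSum A u)))
      = ∑ j, 2 * (colSum A j : ℝ) * levelLog A (weight A I) η u j := by
    simp only [mul_assoc]
    rw [← Finset.mul_sum, ← sum_rowPair, h4]
    ring
  rw [← add_assoc, h5, ← Finset.sum_add_distrib, ← Finset.sum_add_distrib]
  refine Finset.sum_congr rfl fun j _ => ?_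
  rw [← order_add hA j]
  split_ifs <;> push_cast <;> ring

theorem prod_exp_levelLog_le (hA : minor A I ≠ 0) {η R : ℝ} (u : Fin n → ℝ)
    (hR : ∀ j, levelLog A (weight A I) η u j ≤ R) :
    ∏ j, Real.exp ((2 + order A I j) * levelLog A (weight A I) η u j)
      ≤ Real.exp (p * R) * Real.exp (p * Real.log η / 2) *
        (ratioProd A (1 / 2) u * cutWeight I R u) := by
  have h1 : cutWeight I R u = expWeight I (levelLog A (weight A I) η u) := by
    have h := cutWeight_flow (A := A) (I := I) R u (flowTime A η u)
    rw [← h]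
    exact Finset.prod_congr rfl fun k _ => cutExp_of_le (hR k)
  rw [h1, expWeight_eq, ratioProd, ← Real.exp_sum, ← Real.exp_add, ← Real.exp_add, ← Real.exp_add,
    Real.exp_le_exp]
  have h4 := sum_rowPair_levelLog hA η u
  rw [sum_rowPair] at h4
  have h5 : ∑ j, (if j ∈ I.1 then levelLog A (weight A I) η u j else 0) ≤ p * R := by
    rw [Finset.sum_ite_mem, Finset.univ_inter]
    refine (Finset.sum_le_card_nsmul _ _ R fun j _ => hR j).trans (le_of_eq ?_)
    rw [I.2, nsmul_eq_mul]
  have h6 : ∑ j, (2 + (order A I j : ℝ)) * levelLog A (weight A I) η u j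
      = ∑ j, (colSum A j : ℝ) * levelLog A (weight A I) η u j
        + (∑ j, (if j ∈ I.1 then levelLog A (weight A I) η u j else 0)
        + ∑ j, if j ∈ I.1 then 0 else 2 * levelLog A (weight A I) η u j) := by
    rw [← Finset.sum_add_distrib, ← Finset.sum_add_distrib]
    refine Finset.sum_congr rfl fun j _ => ?_
    rw [← order_add hA j]
    split_ifs <;> push_cast <;> ring
  rw [h6, h4]
  linarith

/-- The constant relating the Bochner–Martinelli form to the coefficient of the test form. -/
noncomputable def formConst (I : PSubset n p) : ℂ :=
  (-1) ^ (p * n) * (-1) ^ (∑ i ∈ I.1, ((i : ℕ) + 1) + p * (p + 1) / 2) *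
    ((-1) ^ (n * (n - 1) / 2) * (-2 * Complex.I) ^ n)

theorem continuous_monomialDeriv (l : Fin p) (j : Fin n) :
    Continuous fun z : Cn n => monomialDeriv A z l j := by
  unfold monomialDeriv
  fun_prop

theorem continuous_monomialMinor : Continuous fun z : Cn n => monomialMinor A I z := by
  unfold monomialMinor
  exact Continuous.matrix_det (continuous_matrix fun l ν => continuous_monomialDeriv l _)

theorem measurable_dWedge_component (hp : 1 ≤ p) (hpn : p ≤ n) {φ : PSubset n p → Cn n → ℂ}
    (hφ : Continuous (φ I)) :
    Measurable fun z => dWedge (normSqMap (monomialMap A)) (omegaWedge (monomialMap A) (component φ I)) z := by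
  simp only [dWedge_omegaWedge_component hp hpn]
  have h1 : Measurable fun z : Cn n => (normSqMap (monomialMap A) z : ℂ) :=
    (Complex.continuous_ofReal.comp (contDiff_normSqMap A).continuous).measurable
  have h2 : Measurable fun z : Cn n => conj (monomialMinor A I z) :=
    (Complex.continuous_conj.comp continuous_monomialMinor).measurable
  exact (((h1.div (h1.pow_const p)).const_mul _).mul hφ.measurable).mul h2

theorem chartDensity_mul_dWedge (hp : 1 ≤ p) (hpn : p ≤ n) (hA : minor A I ≠ 0)
    (φ : PSubset n p → Cn n → ℂ) (j₀ : Fin n) {η : ℝ} (hη : 0 < η)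
    (y : ({i // ¬ i = j₀} → ℝ) × (Fin n → ℝ)) :
    (chartDensity A (weight A I) j₀ η y : ℂ) * dWedge (normSqMap (monomialMap A))
        (omegaWedge (monomialMap A) (component φ I)) (levelChart A (weight A I) j₀ η y)
      = formConst I * minor A I * weight A I j₀ / 2 * ((η ^ p)⁻¹ : ℝ) *
        ((∏ j, Real.exp ((2 + order A I j) * levelLog A (weight A I) η (zeroExt j₀ y.1) j) : ℝ) : ℂ) *
        (φ I (expPoint (levelLog A (weight A I) η (zeroExt j₀ y.1)) y.2) *
          character (fun j => (order A I j : ℤ)) y.2) := by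
  rw [dWedge_omegaWedge_component hp hpn, chartDensity, levelChart, conj_monomialMinor_expPoint hA,
    normSqMap_expPoint, expSum_levelLog A hp (rowPair_weight hA) hη]
  simp only [norm_expPoint]
  set u := levelLog A (weight A I) η (zeroExt j₀ y.1)
  have h1 : ∏ j, Real.exp ((2 + order A I j) * u j)
      = (∏ j, Real.exp (u j) ^ 2) * ∏ j, Real.exp (order A I j * u j) := by
    rw [← Finset.prod_mul_distrib]
    refine Finset.prod_congr rfl fun j _ => ?_
    rw [add_mul, Real.exp_add, ← Real.exp_nat_mul]
    norm_num
  rw [h1, formConst]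
  have hη' : (η : ℂ) ≠ 0 := by exact_mod_cast hη.ne'
  push_cast
  field_simp

end BMResidue

end

section

namespace BMResidue

/-! ### The limit of the integrals over the level hypersurfaces -/

variable {n p : ℕ} {A : Matrix (Fin p) (Fin n) ℕ} {I : PSubset n p}

theorem exists_support_bound {f : Cn n → ℂ} (hf : HasCompactSupport f) :
    ∃ R : ℝ, ∀ z, f z ≠ 0 → ∀ j, ‖z j‖ ≤ Real.exp R := by
  obtain ⟨C, hC⟩ := hf.isCompact.isBounded.exists_norm_le
  refine ⟨Real.log (max C 1), fun z hz j => ?_⟩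
  rw [Real.exp_log (by positivity)]
  exact (PiLp.norm_apply_le z j).trans ((hC z (subset_tsupport f hz)).trans (le_max_left _ _))

theorem le_of_expPoint_ne_zero {f : Cn n → ℂ} {R : ℝ}
    (hR : ∀ z, f z ≠ 0 → ∀ j, ‖z j‖ ≤ Real.exp R) {u θ : Fin n → ℝ} (h : f (expPoint u θ) ≠ 0)
    (j : Fin n) : u j ≤ R := by
  have := hR _ h j
  rwa [norm_expPoint, Real.exp_le_exp] at this

theorem norm_character (m : Fin n → ℤ) (θ : Fin n → ℝ) : ‖character m θ‖ = 1 := by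
  rw [character, norm_prod]
  refine Finset.prod_eq_one fun j _ => ?_
  rw [Complex.norm_exp]
  simp

theorem isFiniteMeasure_angleBox : IsFiniteMeasure ((volume : Measure (Fin n → ℝ)).restrict (angleBox n)) := by
  refine ⟨?_⟩
  rw [Measure.restrict_apply_univ, angleBox, volume_pi_pi]
  exact ENNReal.prod_lt_top fun _ _ => by
    rw [Real.volume_Ioc]
    exact ENNReal.ofReal_lt_top

/-- The coefficient function of a test function: a continuous function `Ψ` on `ℝⁿ` such that the
Fourier coefficient of index `m` of `φ` on the torus of radius `r` is `r^m Ψ(r)`. -/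
structure IsCoefficient (φ : Cn n → ℂ) (m : Fin n → ℕ) (Ψ : (Fin n → ℝ) → ℂ) : Prop where
  continuous : Continuous Ψ
  integral_eq : ∀ r, ∫ θ in angleBox n, φ (polarPoint r θ) * character (fun j => (m j : ℤ)) θ
    = (∏ j, (r j : ℂ) ^ m j) * Ψ r

theorem IsCoefficient.integral_expPoint {φ : Cn n → ℂ} {m : Fin n → ℕ} {Ψ : (Fin n → ℝ) → ℂ}
    (h : IsCoefficient φ m Ψ) (u : Fin n → ℝ) :
    ∫ θ in angleBox n, φ (expPoint u θ) * character (fun j => (m j : ℤ)) θ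
      = ((∏ j, Real.exp (m j * u j) : ℝ) : ℂ) * Ψ (fun j => Real.exp (u j)) := by
  simp only [expPoint_eq_polarPoint]
  rw [h.integral_eq]
  congr 1
  push_cast
  refine Finset.prod_congr rfl fun j _ => ?_
  rw [← Complex.exp_nat_mul]

theorem IsCoefficient.eq_zero {φ : Cn n → ℂ} {m : Fin n → ℕ} {Ψ : (Fin n → ℝ) → ℂ}
    (h : IsCoefficient φ m Ψ) {R : ℝ} (hR : ∀ z, φ z ≠ 0 → ∀ j, ‖z j‖ ≤ Real.exp R)
    {u : Fin n → ℝ} {j : Fin n} (hj : R < u j) : Ψ (fun j => Real.exp (u j)) = 0 := by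
  have h1 := h.integral_expPoint u
  have h2 : ∀ θ, φ (expPoint u θ) = 0 := fun θ => by
    by_contra h0
    exact absurd (le_of_expPoint_ne_zero hR h0 j) (not_le.mpr hj)
  simp only [h2, zero_mul, integral_zero] at h1
  refine (mul_eq_zero.mp h1.symm).resolve_left ?_
  exact_mod_cast (Finset.prod_pos fun j _ => Real.exp_pos _).ne'

theorem IsCoefficient.exists_bound {φ : Cn n → ℂ} {m : Fin n → ℕ} {Ψ : (Fin n → ℝ) → ℂ}
    (h : IsCoefficient φ m Ψ) {R : ℝ} (hR : ∀ z, φ z ≠ 0 → ∀ j, ‖z j‖ ≤ Real.exp R) (I : PSubset n p) :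
    ∃ B, ∀ u : Fin n → ℝ, ‖(expWeight I u : ℂ) * Ψ (fun j => Real.exp (u j))‖ ≤ B * cutWeight I R u := by
  obtain ⟨B, hB⟩ := (isCompact_univ_pi fun _ : Fin n => isCompact_Icc (a := 0) (b := Real.exp R)).exists_bound_of_continuousOn
    h.continuous.continuousOn
  refine ⟨B, fun u => ?_⟩
  by_cases hu : ∀ j, u j ≤ R
  · have h1 : cutWeight I R u = expWeight I u := Finset.prod_congr rfl fun k _ => cutExp_of_le (hu k)
    have h2 : 0 ≤ expWeight I u := Finset.prod_nonneg fun _ _ => (Real.exp_pos _).le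
    rw [h1, norm_mul, Complex.norm_real, Real.norm_of_nonneg h2, mul_comm]
    exact mul_le_mul_of_nonneg_right (hB _ fun j _ => ⟨(Real.exp_pos _).le, Real.exp_le_exp.mpr (hu j)⟩) h2
  · push Not at hu
    obtain ⟨j, hj⟩ := hu
    have hB0 : 0 ≤ B := (norm_nonneg _).trans (hB 0 fun j _ => ⟨le_rfl, (Real.exp_pos _).le⟩)
    rw [h.eq_zero hR hj, mul_zero, norm_zero]
    exact mul_nonneg hB0 (cutWeight_nonneg R u)

theorem continuous_expPoint : Continuous fun y : (Fin n → ℝ) × (Fin n → ℝ) => expPoint y.1 y.2 := by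
  refine (PiLp.continuous_toLp 2 _).comp (continuous_pi fun j => ?_)
  fun_prop

theorem continuous_zeroExt (j₀ : Fin n) : Continuous (zeroExt j₀) := by
  have : zeroExt j₀ = zeroExtCLM j₀ := funext fun a => (zeroExtCLM_apply j₀ a).symm
  rw [this]
  exact (zeroExtCLM j₀).continuous

theorem continuous_levelLog (hp : 1 ≤ p) (w : Fin n → ℝ) (η : ℝ) : Continuous (levelLog A w η) := by
  unfold levelLog
  exact continuous_id.add ((contDiff_flowTime A hp η).continuous.smul continuous_const)

theorem integrableOn_chart (hp : 1 ≤ p) (hA : minor A I ≠ 0) {φ : Cn n → ℂ} (hφ : Continuous φ)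
    (hc : HasCompactSupport φ) {j₀ : Fin n} (hj₀ : 0 < weight A I j₀) (η : ℝ) :
    IntegrableOn (fun y : ({i // ¬ i = j₀} → ℝ) × (Fin n → ℝ) =>
      ((∏ j, Real.exp ((2 + order A I j) * levelLog A (weight A I) η (zeroExt j₀ y.1) j) : ℝ) : ℂ) *
        (φ (expPoint (levelLog A (weight A I) η (zeroExt j₀ y.1)) y.2) *
          character (fun j => (order A I j : ℤ)) y.2)) (Set.univ ×ˢ angleBox n) := by
  obtain ⟨R, hR⟩ := exists_support_bound hc
  obtain ⟨B, hB⟩ := hφ.bounded_above_of_compact_support hc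
  have := isFiniteMeasure_angleBox (n := n)
  have hcl : Continuous fun y : ({i // ¬ i = j₀} → ℝ) × (Fin n → ℝ) =>
      levelLog A (weight A I) η (zeroExt j₀ y.1) :=
    (continuous_levelLog hp _ η).comp ((continuous_zeroExt j₀).comp continuous_fst)
  have h1 := (((integrable_ratioProd_mul_cutWeight hp hA (δ := 1 / 2) (by norm_num) (by norm_num) R hj₀).const_mul
    (B * (Real.exp (p * R) * Real.exp (p * Real.log η / 2)))).comp_fst (volume.restrict (angleBox n)))
  rw [IntegrableOn, Measure.volume_eq_prod, ← Measure.prod_restrict, Measure.restrict_univ]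
  refine h1.mono' (Continuous.aestronglyMeasurable ?_) (Eventually.of_forall fun y => ?_)
  · refine Continuous.mul (Complex.continuous_ofReal.comp ?_) (Continuous.mul (hφ.comp ?_)
      ((continuous_character _).comp continuous_snd))
    · exact continuous_finsetProd _ fun j _ => (continuous_const.mul ((continuous_apply j).comp hcl)).rexp
    · exact continuous_expPoint.comp (hcl.prodMk continuous_snd)
  · have hB0 : 0 ≤ B := (norm_nonneg _).trans (hB 0)
    set u := levelLog A (weight A I) η (zeroExt j₀ y.1) with hu
    by_cases h0 : φ (expPoint u y.2) = 0
    · rw [h0, zero_mul, mul_zero, norm_zero]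
      exact mul_nonneg (by positivity) (mul_nonneg (ratioProd_pos _ _ _).le (cutWeight_nonneg _ _))
    · have h2 := prod_exp_levelLog_le hA (η := η) (zeroExt j₀ y.1) (le_of_expPoint_ne_zero hR h0)
      rw [norm_mul, norm_mul, norm_character, mul_one, Complex.norm_real,
        Real.norm_of_nonneg (Finset.prod_nonneg fun _ _ => (Real.exp_pos _).le), mul_comm, mul_assoc B]
      exact mul_le_mul (hB _) h2 (Finset.prod_nonneg fun _ _ => (Real.exp_pos _).le) hB0

/-- The integral of the Bochner–Martinelli form over a level hypersurface. -/
theorem levelIntegral_eq (hp : 1 ≤ p) (hpn : p ≤ n) (hA : minor A I ≠ 0)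
    {φ : PSubset n p → Cn n → ℂ} (hφ : Continuous (φ I)) (hc : HasCompactSupport (φ I))
    {Ψ : (Fin n → ℝ) → ℂ} (hΨ : IsCoefficient (φ I) (order A I) Ψ)
    {j₀ : Fin n} (hj₀ : 0 < weight A I j₀) {η : ℝ} (hη : 0 < η) :
    IntegrableOn (levelDensity (normSqMap (monomialMap A)) (omegaWedge (monomialMap A) (component φ I)))
      {z : Cn n | normSqMap (monomialMap A) z = η} (μHE[2 * n - 1]) ∧
    levelIntegral (normSqMap (monomialMap A)) η (omegaWedge (monomialMap A) (component φ I))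
      = formConst I * minor A I * weight A I j₀ / 2 * ∫ a : {i // ¬ i = j₀} → ℝ,
        (ratioProd A 1 (zeroExt j₀ a) : ℂ) * ((expWeight I (zeroExt j₀ a) : ℂ) *
          Ψ (fun j => Real.exp (levelLog A (weight A I) η (zeroExt j₀ a) j))) := by
  have h0 := integrableOn_chart hp hA hφ hc hj₀ η
  have h2 := fun y => (chartDensity_mul_dWedge hp hpn hA φ j₀ hη y).trans (mul_assoc _ _ _)
  have h1 := level_integral_eq A hp (rowPair_weight hA) hj₀ hη (measurable_dWedge_component (A := A) (φ := φ) (I := I) hp hpn hφ) (by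
    rw [show (fun y => _) = _ from funext h2]
    exact h0.const_mul _)
  refine ⟨h1.1, ?_⟩
  rw [levelIntegral]
  simp only [levelDensity]
  rw [h1.2]
  simp only [h2]
  rw [integral_const_mul, mul_assoc]
  congr 1
  rw [Measure.volume_eq_prod, setIntegral_prod _ h0, setIntegral_univ, ← integral_const_mul]
  refine integral_congr_ae (Eventually.of_forall fun a => ?_)
  simp only [integral_const_mul, hΨ.integral_expPoint]
  rw [← mul_assoc, ← mul_assoc, mul_assoc (((η ^ p)⁻¹ : ℝ) : ℂ), ← Complex.ofReal_mul,
    prod_exp_levelLog hA hη, ← Complex.ofReal_mul, inv_mul_cancel_left₀ (by positivity)]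
  push_cast
  ring

/-- The limit of `e^{u + τ w}` as `τ → -∞`, for non-negative weights `w`. -/
noncomputable def limitPoint (w u : Fin n → ℝ) (j : Fin n) : ℝ := if 0 < w j then 0 else Real.exp (u j)

theorem tendsto_flowTime (u : Fin n → ℝ) : Tendsto (fun η => flowTime A η u) (𝓝[>] 0) atBot := by
  unfold flowTime
  exact (tendsto_atBot_add_const_right _ _ Real.tendsto_log_nhdsGT_zero).atBot_div_const two_pos

theorem tendsto_exp_flow {w : Fin n → ℝ} (hw : ∀ j, 0 ≤ w j) (u : Fin n → ℝ) :
    Tendsto (fun τ : ℝ => fun j => Real.exp ((u + τ • w) j)) atBot (𝓝 (limitPoint w u)) := by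
  refine tendsto_pi_nhds.mpr fun j => ?_
  simp only [limitPoint, Pi.add_apply, Pi.smul_apply, smul_eq_mul]
  split_ifs with h
  · exact Real.tendsto_exp_atBot.comp (tendsto_atBot_add_const_left _ _ (tendsto_id.atBot_mul_const h))
  · have : w j = 0 := le_antisymm (not_lt.mp h) (hw j)
    simp [this]

theorem norm_expWeight_mul_limitPoint_le {φ : Cn n → ℂ} {m : Fin n → ℕ} {Ψ : (Fin n → ℝ) → ℂ}
    (h : IsCoefficient φ m Ψ) {R B : ℝ} (hw : ∀ j, 0 ≤ weight A I j)
    (hB : ∀ u : Fin n → ℝ, ‖(expWeight I u : ℂ) * Ψ (fun j => Real.exp (u j))‖ ≤ B * cutWeight I R u)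
    (u : Fin n → ℝ) :
    ‖(expWeight I u : ℂ) * Ψ (limitPoint (weight A I) u)‖ ≤ B * cutWeight I R u := by
  have h1 := ((h.continuous.tendsto _).comp (tendsto_exp_flow hw u)).const_mul (expWeight I u : ℂ)
  refine le_of_tendsto h1.norm (Eventually.of_forall fun τ => ?_)
  have h2 := hB (u + τ • weight A I)
  rwa [expWeight_flow, cutWeight_flow] at h2

theorem measurable_limitPoint (w : Fin n → ℝ) : Measurable (limitPoint w) := by
  refine measurable_pi_lambda _ fun j => ?_
  simp only [limitPoint]
  split_ifs <;> fun_prop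

theorem continuous_expWeight : Continuous (expWeight I) :=
  continuous_finsetProd _ fun _ _ => (continuous_const.mul (continuous_apply _)).rexp

theorem integrable_prodKern_mul_limit (hA : minor A I ≠ 0) {φ : Cn n → ℂ} {m : Fin n → ℕ}
    {Ψ : (Fin n → ℝ) → ℂ} (h : IsCoefficient φ m Ψ) (hc : HasCompactSupport φ)
    (hw : ∀ j, 0 ≤ weight A I j) :
    Integrable fun u => (prodKern (fun l => 2 * rowPair A u l) : ℂ) *
      ((expWeight I u : ℂ) * Ψ (limitPoint (weight A I) u)) := by
  obtain ⟨R, hR⟩ := exists_support_bound hc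
  obtain ⟨B, hB⟩ := h.exists_bound hR I
  have h1 := (integrable_kernPow_mul_cutWeight hA one_pos le_rfl R).const_mul B
  simp only [kernPow_one] at h1
  have h2 : Continuous fun u => prodKern (fun l => 2 * rowPair A u l) :=
    continuous_prodKern.comp (continuous_pi fun l => continuous_const.mul (contDiff_rowPair A l).continuous)
  refine h1.mono' ?_ (Eventually.of_forall fun u => ?_)
  · refine Measurable.aestronglyMeasurable ?_
    exact (Complex.continuous_ofReal.comp h2).measurable.mul
      ((Complex.continuous_ofReal.comp continuous_expWeight).measurable.mul
        (h.continuous.measurable.comp (measurable_limitPoint _)))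
  · have h3 := norm_expWeight_mul_limitPoint_le h hw hB u
    rw [norm_mul, Complex.norm_real, Real.norm_of_nonneg (prodKern_pos _).le, mul_left_comm]
    exact mul_le_mul_of_nonneg_left h3 (prodKern_pos _).le

theorem tendsto_integral_ratioProd (hp : 1 ≤ p) (hA : minor A I ≠ 0) {φ : Cn n → ℂ} {m : Fin n → ℕ}
    {Ψ : (Fin n → ℝ) → ℂ} (h : IsCoefficient φ m Ψ) (hc : HasCompactSupport φ)
    {j₀ : Fin n} (hj₀ : 0 < weight A I j₀) {g : (Fin n → ℝ) → ℂ}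
    (hg : ∀ u, Tendsto (fun η => Ψ (fun j => Real.exp (levelLog A (weight A I) η u j))) (𝓝[>] 0) (𝓝 (g u))) :
    Tendsto (fun η => ∫ a : {i // ¬ i = j₀} → ℝ, (ratioProd A 1 (zeroExt j₀ a) : ℂ) *
      ((expWeight I (zeroExt j₀ a) : ℂ) *
        Ψ (fun j => Real.exp (levelLog A (weight A I) η (zeroExt j₀ a) j)))) (𝓝[>] 0)
      (𝓝 (∫ a : {i // ¬ i = j₀} → ℝ, (ratioProd A 1 (zeroExt j₀ a) : ℂ) *
        ((expWeight I (zeroExt j₀ a) : ℂ) * g (zeroExt j₀ a)))) := by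
  obtain ⟨R, hR⟩ := exists_support_bound hc
  obtain ⟨B, hB⟩ := h.exists_bound hR I
  have h1 := (integrable_ratioProd_mul_cutWeight hp hA one_pos le_rfl R hj₀).const_mul B
  refine tendsto_integral_filter_of_dominated_convergence _ ?_ ?_ h1 ?_
  · refine Eventually.of_forall fun η => Continuous.aestronglyMeasurable ?_
    have hz := continuous_zeroExt j₀
    have hl := (continuous_levelLog (A := A) hp (weight A I) η).comp hz
    refine (Complex.continuous_ofReal.comp ((continuous_ratioProd A hp 1).comp hz)).mul
      ((Complex.continuous_ofReal.comp (continuous_expWeight.comp hz)).mul (h.continuous.comp ?_))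
    exact continuous_pi fun j => Real.continuous_exp.comp ((continuous_apply j).comp hl)
  · refine Eventually.of_forall fun η => Eventually.of_forall fun a => ?_
    have h2 := hB (levelLog A (weight A I) η (zeroExt j₀ a))
    rw [levelLog, expWeight_flow, cutWeight_flow] at h2
    rw [norm_mul, Complex.norm_real, Real.norm_of_nonneg (ratioProd_pos _ _ _).le, mul_left_comm]
    exact mul_le_mul_of_nonneg_left h2 (ratioProd_pos _ _ _).le
  · exact Eventually.of_forall fun a => ((hg _).const_mul _).const_mul _

/-- If some weight is negative, then the integrals over the level hypersurfaces tend to zero. -/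
theorem tendsto_levelIntegral_of_neg (hp : 1 ≤ p) (hpn : p ≤ n) (hA : minor A I ≠ 0)
    {φ : PSubset n p → Cn n → ℂ} (hφ : Continuous (φ I)) (hc : HasCompactSupport (φ I))
    {Ψ : (Fin n → ℝ) → ℂ} (hΨ : IsCoefficient (φ I) (order A I) Ψ)
    {j : Fin n} (hj : weight A I j < 0) :
    Tendsto (fun η => levelIntegral (normSqMap (monomialMap A)) η
      (omegaWedge (monomialMap A) (component φ I))) (𝓝[>] 0) (𝓝 0) := by
  obtain ⟨j₀, hj₀⟩ := exists_weight_pos hp hA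
  obtain ⟨R, hR⟩ := exists_support_bound hc
  have h1 := tendsto_integral_ratioProd hp hA hΨ hc hj₀ (g := fun _ => 0) (fun u => by
    refine tendsto_const_nhds.congr' ?_
    have h2 : Tendsto (fun η => levelLog A (weight A I) η u j) (𝓝[>] 0) atTop := by
      simp only [levelLog, Pi.add_apply, Pi.smul_apply, smul_eq_mul]
      exact tendsto_atTop_add_const_left _ _ ((tendsto_flowTime u).atBot_mul_const_of_neg hj)
    filter_upwards [h2.eventually_gt_atTop R] with η hη
    exact (hΨ.eq_zero hR hη).symm)
  simp only [mul_zero, integral_zero] at h1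
  have h3 := h1.const_mul (formConst I * minor A I * weight A I j₀ / 2)
  rw [mul_zero] at h3
  refine h3.congr' ?_
  filter_upwards [self_mem_nhdsWithin] with η hη
  exact (levelIntegral_eq hp hpn hA hφ hc hΨ hj₀ hη).2.symm

/-- If the weights are non-negative, then the integrals over the level hypersurfaces converge to an
integral over the logarithmic space. -/
theorem tendsto_levelIntegral_of_nonneg (hp : 1 ≤ p) (hpn : p ≤ n) (hA : minor A I ≠ 0)
    {φ : PSubset n p → Cn n → ℂ} (hφ : Continuous (φ I)) (hc : HasCompactSupport (φ I))
    {Ψ : (Fin n → ℝ) → ℂ} (hΨ : IsCoefficient (φ I) (order A I) Ψ)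
    (hw : ∀ j, 0 ≤ weight A I j) :
    Tendsto (fun η => levelIntegral (normSqMap (monomialMap A)) η
      (omegaWedge (monomialMap A) (component φ I))) (𝓝[>] 0)
      (𝓝 (formConst I * minor A I / ((p - 1).factorial : ℂ) *
        ∫ u, (prodKern (fun l => 2 * rowPair A u l) : ℂ) *
          ((expWeight I u : ℂ) * Ψ (limitPoint (weight A I) u)))) := by
  obtain ⟨j₀, hj₀⟩ := exists_weight_pos hp hA
  have h1 := tendsto_integral_ratioProd hp hA hΨ hc hj₀
    (g := fun u => Ψ (limitPoint (weight A I) u)) (fun u => (hΨ.continuous.tendsto _).comp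
      ((tendsto_exp_flow hw u).comp (tendsto_flowTime u)))
  have h2 := (integral_ratioProd_mul A hp (rowPair_weight hA) hj₀ one_pos
    (h := fun u => (expWeight I u : ℂ) * Ψ (limitPoint (weight A I) u)) (fun u τ => by
      rw [expWeight_flow]
      congr 2
      funext j
      simp only [limitPoint, Pi.add_apply, Pi.smul_apply, smul_eq_mul]
      split_ifs with h
      · rfl
      · have : weight A I j = 0 := le_antisymm (not_lt.mp h) (hw j)
        simp [this]) (by
      simp only [kernPow_one]
      exact integrable_prodKern_mul_limit hA hΨ hc hw)).2
  simp only [kernPow_one, mul_one] at h2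
  have hG : Real.Gamma p = ((p - 1).factorial : ℝ) := by
    obtain ⟨k, rfl⟩ : ∃ k, p = k + 1 := ⟨p - 1, by omega⟩
    rw [Nat.add_sub_cancel, Nat.cast_succ, Real.Gamma_nat_eq_factorial]
  rw [hG] at h2
  have h3 := h1.const_mul (formConst I * minor A I * weight A I j₀ / 2)
  have hfac : ((p - 1).factorial : ℂ) ≠ 0 := by exact_mod_cast (p - 1).factorial_ne_zero
  rw [← h2]
  have h4 : ∀ Y : ℂ, formConst I * minor A I / ((p - 1).factorial : ℂ) *
      (((((p - 1).factorial : ℝ) / 2 * weight A I j₀ : ℝ) : ℂ) * Y)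
      = formConst I * minor A I * weight A I j₀ / 2 * Y := by
    intro Y
    push_cast
    field_simp
  rw [h4]
  refine h3.congr' ?_
  filter_upwards [self_mem_nhdsWithin] with η hη
  exact (levelIntegral_eq hp hpn hA hφ hc hΨ hj₀ hη).2.symm

end BMResidue

end

section

namespace BMResidue

/-! ### Logarithmic polar coordinates -/

section Polar

variable {ι : Type*} [Fintype ι]

/-- The angles `0 < θ_k ≤ 2π`. -/
def angles (ι : Type*) : Set (ι → ℝ) := Set.univ.pi fun _ => Set.Ioc 0 (2 * Real.pi)

theorem measurableSet_angles : MeasurableSet (angles ι) :=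
  MeasurableSet.univ_pi fun _ => measurableSet_Ioc

/-- The measure with density `∏ e^{2 b_k}`. -/
noncomputable def expMeasure (ι : Type*) [Fintype ι] : Measure (ι → ℝ) :=
  volume.withDensity fun b => ENNReal.ofReal (∏ k, Real.exp (2 * b k))

instance : SFinite (expMeasure ι) := by unfold expMeasure; infer_instance

/-- The complex vector with coordinates `e^{b_k + i θ_k}`. -/
noncomputable def expPi (q : (ι → ℝ) × (ι → ℝ)) (k : ι) : ℂ :=
  Complex.exp ((q.1 k : ℂ) + (q.2 k : ℂ) * Complex.I)

/-- The derivative of the coordinatewise exponential map. -/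
noncomputable def expDeriv (w : ι → ℂ) : (ι → ℂ) →L[ℂ] (ι → ℂ) :=
  ContinuousLinearMap.pi fun k => Complex.exp (w k) • ContinuousLinearMap.proj k

theorem det_expDeriv (w : ι → ℂ) :
    |((expDeriv w).restrictScalars ℝ).det| = ∏ k, Real.exp (2 * (w k).re) := by
  have h : ((expDeriv w).restrictScalars ℝ : (ι → ℂ) →ₗ[ℝ] (ι → ℂ))
      = (LinearMap.pi fun k => Complex.exp (w k) • LinearMap.proj k : (ι → ℂ) →ₗ[ℂ] (ι → ℂ)).restrictScalars ℝ :=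
    rfl
  have h2 := LinearMap.det_pi (R := ℂ) (M := ℂ) (fun k : ι => Complex.exp (w k) • LinearMap.id)
  simp only [LinearMap.det_smul, Module.finrank_self, pow_one, LinearMap.det_id, mul_one] at h2
  rw [ContinuousLinearMap.det, h, LinearMap.det_restrictScalars, Algebra.norm_complex_apply,
    Complex.normSq_eq_norm_sq]
  rw [show (LinearMap.pi fun k => Complex.exp (w k) • LinearMap.proj k : (ι → ℂ) →ₗ[ℂ] (ι → ℂ))
    = LinearMap.pi fun k => (Complex.exp (w k) • LinearMap.id) ∘ₗ LinearMap.proj k from rfl, h2, norm_prod,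
    abs_of_nonneg (by positivity), ← Finset.prod_pow]
  refine Finset.prod_congr rfl fun k _ => ?_
  rw [Complex.norm_exp, ← Real.exp_nat_mul]
  norm_num

theorem measurableSet_strip :
    MeasurableSet {w : ι → ℂ | ∀ k, (w k).im ∈ Set.Ioc 0 (2 * Real.pi)} := by
  have : {w : ι → ℂ | ∀ k, (w k).im ∈ Set.Ioc 0 (2 * Real.pi)}
      = ⋂ k, {w : ι → ℂ | (w k).im ∈ Set.Ioc 0 (2 * Real.pi)} := by ext; simp
  rw [this]
  exact MeasurableSet.iInter fun k => measurableSet_Ioc.preimage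
    (Complex.measurable_im.comp (measurable_pi_apply k))

theorem lintegral_comp_exp (f : (ι → ℂ) → ENNReal) :
    ∫⁻ w in {w : ι → ℂ | ∀ k, (w k).im ∈ Set.Ioc 0 (2 * Real.pi)},
      ENNReal.ofReal (∏ k, Real.exp (2 * (w k).re)) * f (fun k => Complex.exp (w k)) = ∫⁻ w, f w := by
  set S := {w : ι → ℂ | ∀ k, (w k).im ∈ Set.Ioc 0 (2 * Real.pi)}
  have himg : (fun (w : ι → ℂ) k => Complex.exp (w k)) '' S = {w | ∀ k, w k ≠ 0} := by
    ext w
    constructor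
    · rintro ⟨w, -, rfl⟩ k
      exact Complex.exp_ne_zero _
    · intro hw
      choose θ hθ h using fun k => exists_exp_eq (hw k)
      refine ⟨fun k => (Real.log ‖w k‖ : ℂ) + (θ k : ℂ) * Complex.I, fun k => ?_, funext fun k => ?_⟩
      · simpa using hθ k
      · simpa using h k
  have hinj : Set.InjOn (fun (w : ι → ℂ) k => Complex.exp (w k)) S := by
    intro w hw w' hw' h
    funext k
    have h1 := congrFun h k
    have h2 := exp_eq_exp_iff_of_mem_Ioc (a := (w k).re) (b := (w' k).re) (hw k) (hw' k)
    rw [Complex.re_add_im, Complex.re_add_im] at h2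
    have h3 := h2 h1
    exact Complex.ext h3.1 h3.2
  have hd : ∀ w : ι → ℂ, HasFDerivAt (fun (w : ι → ℂ) k => Complex.exp (w k)) ((expDeriv w).restrictScalars ℝ) w := by
    intro w
    refine HasFDerivAt.restrictScalars ℝ (hasFDerivAt_pi.mpr fun k => ?_)
    exact (ContinuousLinearMap.proj (R := ℂ) (φ := fun _ : ι => ℂ) k).hasFDerivAt.cexp
  have h1 := lintegral_image_eq_lintegral_abs_det_fderiv_mul volume measurableSet_strip
    (fun w _ => (hd w).hasFDerivWithinAt) hinj f
  simp only [det_expDeriv] at h1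
  rw [← h1, himg]
  have hae : ({w : ι → ℂ | ∀ k, w k ≠ 0} : Set (ι → ℂ)) =ᵐ[volume] Set.univ := by
    refine eventuallyEq_univ.mpr (eventually_all.mpr fun k => ?_)
    exact Measure.ae_eval_ne (μ := fun _ : ι => (volume : Measure ℂ)) k 0
  rw [setLIntegral_congr hae, setLIntegral_univ]

theorem measurable_expPi {ι : Type*} : Measurable (expPi (ι := ι)) := by
  unfold expPi
  fun_prop

theorem measurePreserving_complexPi : MeasurePreserving
    (fun (q : (ι → ℝ) × (ι → ℝ)) k => ((q.1 k : ℂ) + (q.2 k : ℂ) * Complex.I)) volume volume := by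
  have h1 := (volume_measurePreserving_arrowProdEquivProdArrow ℝ ℝ ι).symm
  have h2 := volume_preserving_pi (fun _ : ι => Complex.volume_preserving_equiv_real_prod.symm)
  have h3 := h2.comp h1
  have h4 : (fun (q : (ι → ℝ) × (ι → ℝ)) (k : ι) => ((q.1 k : ℂ) + (q.2 k : ℂ) * Complex.I))
      = (fun a i => Complex.measurableEquivRealProd.symm (a i)) ∘
        (MeasurableEquiv.arrowProdEquivProdArrow ℝ ℝ ι).symm := by
    funext q k
    exact (Complex.mk_eq_add_mul_I _ _).symm
  rw [h4]
  exact h3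

theorem measurePreserving_expPi : MeasurePreserving (expPi (ι := ι))
    ((expMeasure ι).prod (volume.restrict (angles ι))) volume := by
  refine ⟨measurable_expPi, Measure.ext_of_lintegral _ fun f hf => ?_⟩
  have hd : Measurable fun b : ι → ℝ => ENNReal.ofReal (∏ k, Real.exp (2 * b k)) := by fun_prop
  have hd' : Measurable fun q : (ι → ℝ) × (ι → ℝ) => ENNReal.ofReal (∏ k, Real.exp (2 * q.1 k)) := by fun_prop
  rw [lintegral_map hf measurable_expPi, expMeasure, prod_withDensity_left hd,
    lintegral_withDensity_eq_lintegral_mul _ hd' (g := fun q => f (expPi q)) (hf.comp measurable_expPi),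
    ← lintegral_comp_exp f]
  have h1 := (measurePreserving_complexPi (ι := ι)).restrict_preimage measurableSet_strip
  rw [← h1.map_eq, lintegral_map (by fun_prop) h1.measurable]
  have hpre : (fun (q : (ι → ℝ) × (ι → ℝ)) k => ((q.1 k : ℂ) + (q.2 k : ℂ) * Complex.I)) ⁻¹'
      {w : ι → ℂ | ∀ k, (w k).im ∈ Set.Ioc 0 (2 * Real.pi)} = Set.univ ×ˢ angles ι := by
    ext q
    simp [angles]
  rw [hpre, Measure.volume_eq_prod, ← Measure.prod_restrict, Measure.restrict_univ]
  refine lintegral_congr fun q => ?_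
  simp
  rfl

end Polar

variable {n p : ℕ}

theorem measurePreserving_restrict_angleBox (J : Finset (Fin n)) :
    MeasurePreserving (fun θ : Fin n → ℝ => ((fun k : {k // k ∉ J} => θ k), (fun j : {j // j ∈ J} => θ j)))
      (volume.restrict (angleBox n))
      ((volume.restrict (angles {k // k ∉ J})).prod (volume.restrict (angles {j // j ∈ J}))) := by
  have h1 : MeasurePreserving (fun θ : Fin n → ℝ =>
      ((fun j : {j // j ∈ J} => θ j), (fun k : {k // k ∉ J} => θ k))) := by
    convert (volume_preserving_piEquivPiSubtypeProd (fun _ : Fin n => ℝ) (fun j => j ∈ J))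
    · rfl
    · rfl
  have h2 : MeasurePreserving (fun θ : Fin n → ℝ =>
      ((fun k : {k // k ∉ J} => θ k), (fun j : {j // j ∈ J} => θ j))) :=
    Measure.measurePreserving_swap.comp h1
  have h3 : angleBox n = (fun θ : Fin n → ℝ =>
      ((fun k : {k // k ∉ J} => θ k), (fun j : {j // j ∈ J} => θ j))) ⁻¹'
        (angles {k // k ∉ J} ×ˢ angles {j // j ∈ J}) := by
    ext θ
    simp only [angleBox, angles, Set.mem_univ_pi, Set.mem_preimage, Set.mem_prod, Subtype.forall]
    constructor
    · exact fun h => ⟨fun k _ => h k, fun k _ => h k⟩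
    · intro h k
      by_cases hk : k ∈ J
      · exact h.2 k hk
      · exact h.1 k hk
  rw [Measure.prod_restrict, h3]
  exact h2.restrict_preimage (measurableSet_angles.prod measurableSet_angles)

/-- The parametrization of the tube by logarithmic polar coordinates. -/
noncomputable def tubeParam (J : Finset (Fin n)) (y : ({k // k ∉ J} → ℝ) × (Fin n → ℝ)) :
    ({k // k ∉ J} → ℂ) × ({j // j ∈ J} → ℝ) :=
  (expPi (y.1, fun k => y.2 k), fun j => y.2 j)

theorem measurePreserving_tubeParam (J : Finset (Fin n)) : MeasurePreserving (tubeParam J)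
    ((expMeasure {k // k ∉ J}).prod (volume.restrict (angleBox n)))
    ((volume : Measure ({k // k ∉ J} → ℂ)).prod (volume.restrict (angles {j // j ∈ J}))) := by
  have h1 := (MeasurePreserving.id (expMeasure {k // k ∉ J})).prod (measurePreserving_restrict_angleBox J)
  have h2 := (measurePreserving_prodAssoc (expMeasure {k // k ∉ J}) (volume.restrict (angles {k // k ∉ J}))
    (volume.restrict (angles {j // j ∈ J}))).symm
  have h3 := (measurePreserving_expPi (ι := {k // k ∉ J})).prod
    (MeasurePreserving.id ((volume : Measure ({j // j ∈ J} → ℝ)).restrict (angles {j // j ∈ J})))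
  exact h3.comp (h2.comp h1)

theorem integral_expMeasure_prod {α ι : Type*} [Fintype ι] [MeasurableSpace α] (ν : Measure α) [SFinite ν]
    (f : (ι → ℝ) × α → ℂ) :
    (Integrable f ((expMeasure ι).prod ν) ↔
      Integrable (fun q => ((∏ k, Real.exp (2 * q.1 k) : ℝ) : ℂ) * f q) ((volume : Measure (ι → ℝ)).prod ν)) ∧
    ∫ q, f q ∂((expMeasure ι).prod ν)
      = ∫ q, ((∏ k, Real.exp (2 * q.1 k) : ℝ) : ℂ) * f q ∂((volume : Measure (ι → ℝ)).prod ν) := by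
  have hd : Measurable fun b : ι → ℝ => ENNReal.ofReal (∏ k, Real.exp (2 * b k)) := by fun_prop
  have hd' : Measurable fun q : (ι → ℝ) × α => ENNReal.ofReal (∏ k, Real.exp (2 * q.1 k)) := by fun_prop
  have ht : ∀ q : (ι → ℝ) × α, (ENNReal.ofReal (∏ k, Real.exp (2 * q.1 k))).toReal
      = ∏ k, Real.exp (2 * q.1 k) := fun q =>
    ENNReal.toReal_ofReal (Finset.prod_nonneg fun _ _ => (Real.exp_pos _).le)
  rw [expMeasure, prod_withDensity_left hd, integrable_withDensity_iff_integrable_smul' hd'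
    (Eventually.of_forall fun _ => ENNReal.ofReal_lt_top),
    integral_withDensity_eq_integral_toReal_smul hd' (Eventually.of_forall fun _ => ENNReal.ofReal_lt_top)]
  simp only [ht, Complex.real_smul, and_self]

end BMResidue

end

section

namespace BMResidue

/-! ### Integrals over tubes -/

variable {n p : ℕ} {A : Matrix (Fin p) (Fin n) ℕ} {I : PSubset n p} {J : Finset (Fin n)}

theorem hyperF_glue_eq (hA : minor A I ≠ 0) (hJ : J ⊆ I.1) (a a' : {j // j ∈ J} → ℝ)
    (b : {k // k ∉ J} → ℝ) :
    hyperF A I J (fun i => Real.exp (2 * glue J a b i)) = hyperF A I J (fun i => Real.exp (2 * glue J a' b i)) := by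
  have h := (integral_prodKern_glue A hA hJ a b).symm.trans (integral_prodKern_glue A hA hJ a' b)
  refine mul_left_cancel₀ (inv_ne_zero (mul_ne_zero (pow_ne_zero _ two_ne_zero) ?_)) h
  exact_mod_cast (abs_pos.mpr hA).ne'

theorem expWeight_glue (hJ : J ⊆ I.1) (a a' : {j // j ∈ J} → ℝ) (b : {k // k ∉ J} → ℝ) :
    expWeight I (glue J a b) = expWeight I (glue J a' b) :=
  Finset.prod_congr rfl fun k _ => by
    rw [glue_apply, glue_apply, dif_neg fun h => k.2 (hJ h), dif_neg fun h => k.2 (hJ h)]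

theorem cutWeight_glue (hJ : J ⊆ I.1) (R : ℝ) (a a' : {j // j ∈ J} → ℝ) (b : {k // k ∉ J} → ℝ) :
    cutWeight I R (glue J a b) = cutWeight I R (glue J a' b) :=
  Finset.prod_congr rfl fun k _ => by
    rw [glue_apply, glue_apply, dif_neg fun h => k.2 (hJ h), dif_neg fun h => k.2 (hJ h)]

/-- The logarithms of the radii of the point of the tube with parameter `b`. -/
noncomputable def tubeLog (J : Finset (Fin n)) (ε : Fin n → ℝ) (b : {k // k ∉ J} → ℝ) : Fin n → ℝ :=
  glue J (fun j => Real.log (ε j)) b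

theorem continuous_glue_right (a : {j // j ∈ J} → ℝ) : Continuous fun b => glue J a b := by
  refine continuous_pi fun i => ?_
  simp only [glue_apply]
  split_ifs <;> fun_prop

theorem tubePoint_tubeParam {ε : Fin n → ℝ} (hε : ∀ i, 0 < ε i)
    (y : ({k // k ∉ J} → ℝ) × (Fin n → ℝ)) :
    tubePoint J ε (tubeParam J y).1 (tubeParam J y).2 = expPoint (tubeLog J ε y.1) y.2 := by
  ext i
  rw [expPoint_apply, tubeLog, glue_apply]
  simp only [tubePoint, tubeParam, expPi]
  split_ifs with h
  · rw [Complex.exp_add, ← Complex.ofReal_exp, Real.exp_log (hε i)]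
  · rfl

theorem prod_mul_tubeIntegrand (hA : minor A I ≠ 0) (hJ : J ⊆ I.1) (H : (Fin n → ℝ) → ℂ) (φ : Cn n → ℂ)
    {ε : Fin n → ℝ} (hε : ∀ i, 0 < ε i) (y : ({k // k ∉ J} → ℝ) × (Fin n → ℝ)) :
    ((∏ k, Real.exp (2 * y.1 k) : ℝ) : ℂ) * tubeIntegrand A I J H φ ε (tubeParam J y)
      = Complex.I ^ J.card * (2 * Complex.I) ^ (n - J.card) *
        H (fun i => Real.exp (2 * tubeLog J ε y.1 i)) * expWeight I (tubeLog J ε y.1) *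
        ((∏ j, Real.exp (-(order A I j * tubeLog J ε y.1 j)) : ℝ) : ℂ) *
        (φ (expPoint (tubeLog J ε y.1) y.2) * character (fun j => (order A I j : ℤ)) y.2) := by
  set u := tubeLog J ε y.1 with hu
  simp only [tubeIntegrand, tubePoint_tubeParam hε, ← hu]
  set z := expPoint u y.2 with hz
  have hzj : ∀ j, z j = Complex.exp ((u j : ℂ) + (y.2 j : ℂ) * Complex.I) := fun j => expPoint_apply u y.2 j
  have hz0 : ∀ j, z j ≠ 0 := fun j => by rw [hzj]; exact Complex.exp_ne_zero _
  have hE : ∀ j, ((Real.exp (2 * u j) : ℝ) : ℂ) = z j * conj (z j) := fun j => by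
    rw [Complex.mul_conj, Complex.normSq_eq_norm_sq, hz, norm_expPoint, ← Real.exp_nat_mul]
    norm_num
  have hH : (fun i => ‖z i‖ ^ 2) = fun i => Real.exp (2 * u i) := funext fun i => by
    rw [hz, norm_expPoint, ← Real.exp_nat_mul]
    norm_num
  have h1 : ((∏ k, Real.exp (2 * y.1 k) : ℝ) : ℂ) = ∏ j, if j ∈ J then (1 : ℂ) else z j * conj (z j) := by
    rw [Complex.ofReal_prod, ← Finset.prod_filter_mul_prod_filter_not Finset.univ (fun j => j ∈ J)]
    rw [Finset.prod_eq_one (s := Finset.univ.filter fun j => j ∈ J) (fun j hj => if_pos (Finset.mem_filter.mp hj).2),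
      one_mul, Finset.prod_subtype (p := fun j => j ∉ J) _ (by simp)]
    refine Finset.prod_congr rfl fun k _ => ?_
    rw [if_neg k.2, ← hE, hu, tubeLog, glue_apply, dif_neg k.2]
  have h2 : (expWeight I u : ℂ) = ∏ j, if j ∈ I.1 then (1 : ℂ) else z j * conj (z j) := by
    rw [expWeight, Complex.ofReal_prod, ← Finset.prod_filter_mul_prod_filter_not Finset.univ (fun j => j ∈ I.1)]
    rw [Finset.prod_eq_one (s := Finset.univ.filter fun j => j ∈ I.1) (fun j hj => if_pos (Finset.mem_filter.mp hj).2),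
      one_mul, Finset.prod_subtype (p := fun j => j ∉ I.1) _ (by simp)]
    refine Finset.prod_congr rfl fun k _ => ?_
    rw [if_neg k.2, ← hE]
  have h3 : Complex.I ^ J.card * (2 * Complex.I) ^ (n - J.card)
      = ∏ j, if j ∈ J then Complex.I else 2 * Complex.I := by
    rw [Finset.prod_ite, Finset.prod_const, Finset.prod_const]
    congr 2
    · congr 1; ext; simp
    · rw [← Finset.compl_filter, Finset.card_compl, Fintype.card_fin]
      congr 2; ext; simp
  have h4 : ∏ j ∈ J, Complex.I * z j / z j ^ colSum A j
      = ∏ j, if j ∈ J then Complex.I * z j / z j ^ colSum A j else 1 := by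
    rw [Finset.prod_ite_mem, Finset.univ_inter]
  have h5 : ∏ k ∈ I.1 \ J, 2 * Complex.I / (z k ^ colSum A k * conj (z k))
      = ∏ j, if j ∈ I.1 \ J then 2 * Complex.I / (z j ^ colSum A j * conj (z j)) else 1 := by
    rw [Finset.prod_ite_mem, Finset.univ_inter]
  have h6 : ∏ l ∈ I.1ᶜ, 2 * Complex.I / z l ^ colSum A l
      = ∏ j, if j ∈ I.1ᶜ then 2 * Complex.I / z j ^ colSum A j else 1 := by
    rw [Finset.prod_ite_mem, Finset.univ_inter]
  have h7 : ((∏ j, Real.exp (-(order A I j * u j)) : ℝ) : ℂ) * character (fun j => (order A I j : ℤ)) y.2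
      = ∏ j, (z j ^ order A I j)⁻¹ := by
    rw [character, Complex.ofReal_prod, ← Finset.prod_mul_distrib]
    refine Finset.prod_congr rfl fun j _ => ?_
    rw [hzj, ← Complex.exp_nat_mul, ← Complex.exp_neg, Complex.ofReal_exp, ← Complex.exp_add]
    push_cast
    ring_nf
  have h8 : (∏ j, if j ∈ J then (1 : ℂ) else z j * conj (z j)) *
      (∏ j, if j ∈ J then Complex.I * z j / z j ^ colSum A j else 1) *
      (∏ j, if j ∈ I.1 \ J then 2 * Complex.I / (z j ^ colSum A j * conj (z j)) else 1) *
      (∏ j, if j ∈ I.1ᶜ then 2 * Complex.I / z j ^ colSum A j else 1)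
      = (∏ j, if j ∈ J then Complex.I else 2 * Complex.I) *
        (∏ j, if j ∈ I.1 then (1 : ℂ) else z j * conj (z j)) * ∏ j, (z j ^ order A I j)⁻¹ := by
    simp only [← Finset.prod_mul_distrib]
    refine Finset.prod_congr rfl fun j _ => ?_
    have hc : conj (z j) ≠ 0 := (map_ne_zero _).mpr (hz0 j)
    have hzz := hz0 j
    have ho := order_add hA j
    by_cases hjI : j ∈ I.1
    · rw [if_pos hjI] at ho
      by_cases hjJ : j ∈ J
      · simp only [hjI, hjJ, if_true, Finset.mem_sdiff, Finset.mem_compl, not_true, and_false, if_false, ← ho, pow_succ]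
        field_simp
      · simp only [hjI, hjJ, if_true, Finset.mem_sdiff, Finset.mem_compl, not_true, not_false_iff, and_true, if_false, ← ho, pow_succ]
        field_simp
    · have hjJ : j ∉ J := fun h => hjI (hJ h)
      rw [if_neg hjI, add_zero] at ho
      simp only [hjI, hjJ, if_true, Finset.mem_sdiff, Finset.mem_compl, not_false_iff, and_true, if_false, ← ho]
      field_simp
  rw [h1, h2, h3, h4, h5, h6, hH]
  linear_combination (φ z * H fun i => Real.exp (2 * u i)) * h8
    - (∏ j, if j ∈ J then Complex.I else 2 * Complex.I) * (H fun i => Real.exp (2 * u i)) *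
        (∏ j, if j ∈ I.1 then (1 : ℂ) else z j * conj (z j)) * φ z * h7

theorem measurable_tubeIntegrand {H : (Fin n → ℝ) → ℂ}
    (hH : Measurable H) {φ : Cn n → ℂ} (hφ : Continuous φ) (ε : Fin n → ℝ) :
    Measurable (tubeIntegrand A I J H φ ε) := by
  have h1 : ∀ i, Measurable fun y : ({k : Fin n // k ∉ J} → ℂ) × ({j : Fin n // j ∈ J} → ℝ) =>
      tubePoint J ε y.1 y.2 i := by
    intro i
    simp only [tubePoint]
    split_ifs <;> fun_prop
  have h2 : Measurable fun y : ({k : Fin n // k ∉ J} → ℂ) × ({j : Fin n // j ∈ J} → ℝ) =>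
      tubePoint J ε y.1 y.2 :=
    (PiLp.continuous_toLp 2 _).measurable.comp (measurable_pi_lambda _ h1)
  have h3 := hφ.measurable.comp h2
  have h4 : Measurable fun y : ({k : Fin n // k ∉ J} → ℂ) × ({j : Fin n // j ∈ J} → ℝ) =>
      H fun i => ‖tubePoint J ε y.1 y.2 i‖ ^ 2 :=
    hH.comp (measurable_pi_lambda _ fun i => (h1 i).norm.pow_const 2)
  refine (((h3.mul h4).mul (Finset.measurable_fun_prod _ fun j _ => ?_)).mul
    (Finset.measurable_fun_prod _ fun j _ => ?_)).mul (Finset.measurable_fun_prod _ fun j _ => ?_)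
  · exact ((h1 j).const_mul _).div ((h1 j).pow_const _)
  · exact ((((h1 j).pow_const _).mul (Complex.continuous_conj.measurable.comp (h1 j))).const_div _)
  · exact ((h1 j).pow_const _).const_div _

end BMResidue

end

section

namespace BMResidue

/-! ### The limit of the integrals over tubes -/

variable {n p : ℕ} {A : Matrix (Fin p) (Fin n) ℕ} {I : PSubset n p} {J : Finset (Fin n)}

/-- The logarithmic radial parameters of a tube. -/
def tubeBox (J : Finset (Fin n)) (ε : Fin n → ℝ) : Set ({k // k ∉ J} → ℝ) :=
  {b | ∀ k, Real.log (ε k.1) < b k}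

theorem measurableSet_tubeBox (ε : Fin n → ℝ) : MeasurableSet (tubeBox J ε) := by
  have : tubeBox J ε = Set.univ.pi fun k => Set.Ioi (Real.log (ε k.1)) := by ext; simp [tubeBox]
  rw [this]
  exact MeasurableSet.univ_pi fun _ => measurableSet_Ioi

theorem norm_expPi {ι : Type*} (q : (ι → ℝ) × (ι → ℝ)) (k : ι) : ‖expPi q k‖ = Real.exp (q.1 k) := by
  rw [expPi, Complex.norm_exp]
  simp

/-- The integrand of the tube integrals in logarithmic polar coordinates. -/
noncomputable def polarIntegrand (A : Matrix (Fin p) (Fin n) ℕ) (I : PSubset n p) (J : Finset (Fin n))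
    (φ : Cn n → ℂ) (ε : Fin n → ℝ) (y : ({k // k ∉ J} → ℝ) × (Fin n → ℝ)) : ℂ :=
  Complex.I ^ J.card * (2 * Complex.I) ^ (n - J.card) *
    hyperF A I J (fun i => Real.exp (2 * tubeLog J ε y.1 i)) * expWeight I (tubeLog J ε y.1) *
    ((∏ j, Real.exp (-(order A I j * tubeLog J ε y.1 j)) : ℝ) : ℂ) *
    (φ (expPoint (tubeLog J ε y.1) y.2) * character (fun j => (order A I j : ℤ)) y.2)

theorem continuous_polarIntegrand (hA : minor A I ≠ 0) {φ : Cn n → ℂ} (hφ : Continuous φ) (ε : Fin n → ℝ) :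
    Continuous (polarIntegrand A I J φ ε) := by
  have h1 : Continuous fun y : ({k // k ∉ J} → ℝ) × (Fin n → ℝ) => tubeLog J ε y.1 :=
    (continuous_glue_right _).comp continuous_fst
  refine ((continuous_const.mul ((continuous_hyperF_exp A I J hA).comp h1)).mul
    (Complex.continuous_ofReal.comp (continuous_expWeight.comp h1))).mul ?_ |>.mul
    ((hφ.comp (continuous_expPoint.comp (h1.prodMk continuous_snd))).mul
      ((continuous_character _).comp continuous_snd))
  exact Complex.continuous_ofReal.comp (continuous_finsetProd _ fun j _ =>
    ((continuous_const.mul ((continuous_apply j).comp h1)).neg).rexp)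

theorem integrableOn_polarIntegrand (hA : minor A I ≠ 0) {φ : Cn n → ℂ} (hφ : Continuous φ)
    (hc : HasCompactSupport φ) (ε : Fin n → ℝ) :
    IntegrableOn (polarIntegrand A I J φ ε) (tubeBox J ε ×ˢ angleBox n) := by
  obtain ⟨R, hR⟩ := exists_support_bound hc
  have hK : IsCompact ((Set.univ.pi fun k : {k // k ∉ J} => Set.Icc (Real.log (ε k.1)) R) ×ˢ closedBox n) :=
    (isCompact_univ_pi fun _ => isCompact_Icc).prod isCompact_closedBox
  refine ((continuous_polarIntegrand hA hφ ε).continuousOn.integrableOn_compact hK).of_forall_sdiff_eq_zero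
    ((measurableSet_tubeBox ε).prod measurableSet_angleBox) fun y hy => ?_
  rw [polarIntegrand]
  suffices h : φ (expPoint (tubeLog J ε y.1) y.2) = 0 by rw [h, zero_mul, mul_zero]
  by_contra h
  refine hy.2 ⟨fun k _ => ⟨(hy.1.1 k).le, ?_⟩, fun j _ => ⟨(hy.1.2 j trivial).1.le, (hy.1.2 j trivial).2⟩⟩
  have := le_of_expPoint_ne_zero hR h k.1
  rwa [tubeLog, glue_apply, dif_neg k.2] at this

theorem tubeIntegrand_congr {H H' : (Fin n → ℝ) → ℂ} {φ : Cn n → ℂ} {ε : Fin n → ℝ} (hε : ∀ i, 0 < ε i)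
    (hH : ∀ x : Fin n → ℝ, (∀ i, 0 < x i) → H x = H' x)
    {y : ({k : Fin n // k ∉ J} → ℂ) × ({j : Fin n // j ∈ J} → ℝ)} (hy : ∀ k, ε k.1 < ‖y.1 k‖) :
    tubeIntegrand A I J H φ ε y = tubeIntegrand A I J H' φ ε y := by
  simp only [tubeIntegrand]
  rw [hH]
  intro i
  refine pow_pos (norm_pos_iff.mpr ?_) 2
  simp only [tubePoint]
  split_ifs with h
  · exact mul_ne_zero (by exact_mod_cast (hε i).ne') (Complex.exp_ne_zero _)
  · exact norm_pos_iff.mp ((hε i).trans (hy ⟨i, h⟩))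

/-- The integrals over tubes in logarithmic polar coordinates. -/
theorem tubeIntegral_eq_polar (hA : minor A I ≠ 0) (hJ : J ⊆ I.1) {φ : Cn n → ℂ} (hφ : Continuous φ)
    (hc : HasCompactSupport φ) {ε : Fin n → ℝ} (hε : ∀ i, 0 < ε i) :
    IntegrableOn (tubeIntegrand A I J (hyperF A I J) φ ε) (tubeDomain J ε) ∧
    ∫ y in tubeDomain J ε, tubeIntegrand A I J (hyperF A I J) φ ε y
      = ∫ y in tubeBox J ε ×ˢ angleBox n, polarIntegrand A I J φ ε y := by
  set W : Set ({k : Fin n // k ∉ J} → ℂ) := {w | ∀ k, ε k.1 < ‖w k‖}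
  have hW : MeasurableSet W := by
    have : W = ⋂ k, {w | ε k.1 < ‖w k‖} := by ext; simp [W]
    rw [this]
    exact MeasurableSet.iInter fun k => measurableSet_lt measurable_const (measurable_pi_apply k).norm
  have hdom : (volume : Measure (({k : Fin n // k ∉ J} → ℂ) × ({j : Fin n // j ∈ J} → ℝ))).restrict (tubeDomain J ε)
      = ((volume : Measure ({k // k ∉ J} → ℂ)).prod (volume.restrict (angles {j // j ∈ J}))).restrict
        (W ×ˢ Set.univ) := by
    rw [← Measure.prod_restrict, Measure.restrict_univ, Measure.prod_restrict, ← Measure.volume_eq_prod]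
    congr 2
    ext θ
    simp [angles, tubeDomain, W]
  have hWu : MeasurableSet (W ×ˢ (Set.univ : Set ({j : Fin n // j ∈ J} → ℝ))) := hW.prod MeasurableSet.univ
  set H' : (Fin n → ℝ) → ℂ := fun x => hyperF A I J (fun i => Real.exp (2 * (Real.log (x i) / 2)))
  have hH' : Measurable H' :=
    (continuous_hyperF_exp A I J hA).measurable.comp (measurable_pi_lambda _ fun i =>
      (Real.measurable_log.comp (measurable_pi_apply i)).div_const 2)
  have hHH : ∀ x : Fin n → ℝ, (∀ i, 0 < x i) → hyperF A I J x = H' x := fun x hx => by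
    simp only [H', mul_div_cancel₀ _ (two_ne_zero' ℝ), Real.exp_log (hx _)]
  set F := (W ×ˢ (Set.univ : Set ({j : Fin n // j ∈ J} → ℝ))).indicator (tubeIntegrand A I J H' φ ε)
  have hF : Measurable F := (measurable_tubeIntegrand hH' hφ ε).indicator hWu
  have hm := measurePreserving_tubeParam J
  have hpol : ∀ y : ({k // k ∉ J} → ℝ) × (Fin n → ℝ), ((∏ k, Real.exp (2 * y.1 k) : ℝ) : ℂ) * F (tubeParam J y)
      = (tubeBox J ε ×ˢ (Set.univ : Set (Fin n → ℝ))).indicator (polarIntegrand A I J φ ε) y := by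
    intro y
    have hmem : tubeParam J y ∈ W ×ˢ (Set.univ : Set ({j : Fin n // j ∈ J} → ℝ))
        ↔ y ∈ tubeBox J ε ×ˢ (Set.univ : Set (Fin n → ℝ)) := by
      simp only [Set.mem_prod, Set.mem_univ, and_true, tubeParam, W, tubeBox, Set.mem_ofPred_eq, norm_expPi]
      exact forall_congr' fun k => (Real.log_lt_iff_lt_exp (hε k)).symm
    simp only [F]
    by_cases h : y ∈ tubeBox J ε ×ˢ (Set.univ : Set (Fin n → ℝ))
    · rw [Set.indicator_of_mem h, Set.indicator_of_mem (hmem.mpr h),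
        ← tubeIntegrand_congr hε hHH (hmem.mpr h).1, prod_mul_tubeIntegrand hA hJ _ _ hε]
      rfl
    · rw [Set.indicator_of_notMem h, Set.indicator_of_notMem (fun h' => h (hmem.mp h')), mul_zero]
  have hbox : ((volume : Measure ({k // k ∉ J} → ℝ)).prod (volume.restrict (angleBox n))).restrict
      (tubeBox J ε ×ˢ Set.univ) = volume.restrict (tubeBox J ε ×ˢ angleBox n) := by
    rw [← Measure.prod_restrict, Measure.restrict_univ, Measure.prod_restrict, ← Measure.volume_eq_prod]
  have hbu : MeasurableSet (tubeBox J ε ×ˢ (Set.univ : Set (Fin n → ℝ))) :=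
    (measurableSet_tubeBox ε).prod MeasurableSet.univ
  have hE := integral_expMeasure_prod (volume.restrict (angleBox n)) (fun y => F (tubeParam J y))
  simp only [hpol] at hE
  rw [integrable_indicator_iff hbu, integral_indicator hbu, IntegrableOn, hbox] at hE
  have hcongr : ∀ y ∈ W ×ˢ (Set.univ : Set ({j : Fin n // j ∈ J} → ℝ)),
      tubeIntegrand A I J H' φ ε y = tubeIntegrand A I J (hyperF A I J) φ ε y := fun y hy =>
    (tubeIntegrand_congr hε hHH hy.1).symm
  have hFi := hE.1.mpr (integrableOn_polarIntegrand hA hφ hc ε)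
  constructor
  · rw [IntegrableOn, hdom]
    refine IntegrableOn.congr_fun ?_ hcongr hWu
    rw [← integrable_indicator_iff hWu]
    exact (hm.integrable_comp hF.aestronglyMeasurable).mp hFi
  · rw [hdom, ← setIntegral_congr_fun hWu hcongr, ← integral_indicator hWu, ← hm.map_eq,
      integral_map hm.measurable.aemeasurable hF.aestronglyMeasurable]
    exact hE.2

theorem prod_exp_neg_mul_prod_exp (m : Fin n → ℕ) (u : Fin n → ℝ) :
    ((∏ j, Real.exp (-(m j * u j)) : ℝ) : ℂ) * ((∏ j, Real.exp (m j * u j) : ℝ) : ℂ) = 1 := by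
  rw [← Complex.ofReal_mul, ← Finset.prod_mul_distrib, Finset.prod_eq_one fun j _ => ?_, Complex.ofReal_one]
  rw [← Real.exp_add, neg_add_cancel, Real.exp_zero]

theorem tubeIntegral_eq (hA : minor A I ≠ 0) (hJ : J ⊆ I.1) {φ : Cn n → ℂ} (hφ : Continuous φ)
    (hc : HasCompactSupport φ) {Ψ : (Fin n → ℝ) → ℂ} (hΨ : IsCoefficient φ (order A I) Ψ)
    {ε : Fin n → ℝ} (hε : ∀ i, 0 < ε i) :
    ∫ y in tubeDomain J ε, tubeIntegrand A I J (hyperF A I J) φ ε y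
      = Complex.I ^ J.card * (2 * Complex.I) ^ (n - J.card) * ∫ b : {k // k ∉ J} → ℝ,
        (tubeBox J ε).indicator (fun b => hyperF A I J (fun i => Real.exp (2 * glue J 0 b i)) *
          ((expWeight I (tubeLog J ε b) : ℂ) * Ψ (fun j => Real.exp (tubeLog J ε b j)))) b := by
  have h0 := integrableOn_polarIntegrand (J := J) hA hφ hc ε
  rw [(tubeIntegral_eq_polar hA hJ hφ hc hε).2, Measure.volume_eq_prod, setIntegral_prod _ h0,
    integral_indicator (measurableSet_tubeBox ε), ← integral_const_mul]
  refine integral_congr_ae (Eventually.of_forall fun b => ?_)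
  simp only [polarIntegrand, integral_const_mul, hΨ.integral_expPoint]
  rw [tubeLog, hyperF_glue_eq hA hJ _ 0 b]
  linear_combination (Complex.I ^ J.card * (2 * Complex.I) ^ (n - J.card) *
    hyperF A I J (fun i => Real.exp (2 * glue J 0 b i)) *
      (expWeight I (glue J (fun j => Real.log (ε j)) b)) *
      Ψ (fun j => Real.exp (glue J (fun j => Real.log (ε j)) b j))) *
      prod_exp_neg_mul_prod_exp (order A I) (glue J (fun j => Real.log (ε j)) b)

theorem integrable_hyperF_mul_cutWeight (hA : minor A I ≠ 0) (hJ : J ⊆ I.1) (R : ℝ) :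
    Integrable fun b : {k // k ∉ J} → ℝ => hyperF A I J (fun i => Real.exp (2 * glue J 0 b i)) *
      (cutWeight I R (glue J 0 b) : ℂ) := by
  have h1 := (integrable_kernPow_mul_cutWeight hA one_pos le_rfl R).ofReal (𝕜 := ℂ)
  simp only [kernPow_one] at h1
  have h2 := ((measurePreserving_glue J).integrable_comp_emb (measurableEmbedding_glue J)).mpr h1
  rw [Measure.volume_eq_prod] at h2
  have h3 := h2.integral_prod_right
  refine (h3.const_mul (2 ^ J.card * ((|minor A I| : ℝ) : ℂ))).congr (Eventually.of_forall fun b => ?_)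
  have h4 : (2 ^ J.card * ((|minor A I| : ℝ) : ℂ)) ≠ 0 :=
    mul_ne_zero (pow_ne_zero _ two_ne_zero) (by exact_mod_cast (abs_pos.mpr hA).ne')
  simp only [Function.comp_apply, RCLike.ofReal_mul, Complex.coe_algebraMap, fun a => cutWeight_glue hJ R a 0 b]
  rw [integral_mul_const, integral_prodKern_glue A hA hJ 0 b, ← mul_assoc, mul_inv_cancel_left₀ h4]

theorem limitPoint_glue {w : Fin n → ℝ} (hw : ∀ j, j ∈ J ↔ 0 < w j) (a a' : {j // j ∈ J} → ℝ)
    (b : {k // k ∉ J} → ℝ) : limitPoint w (glue J a b) = limitPoint w (glue J a' b) := by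
  funext j
  simp only [limitPoint]
  split_ifs with h
  · rfl
  · rw [glue_apply, glue_apply, dif_neg fun hj => h ((hw j).mp hj), dif_neg fun hj => h ((hw j).mp hj)]

theorem integral_limit_eq (hA : minor A I ≠ 0) (hJ : J ⊆ I.1) {φ : Cn n → ℂ}
    (hc : HasCompactSupport φ) {m : Fin n → ℕ} {Ψ : (Fin n → ℝ) → ℂ} (hΨ : IsCoefficient φ m Ψ)
    (hw : ∀ j, 0 ≤ weight A I j) (hwJ : ∀ j, j ∈ J ↔ 0 < weight A I j) :
    ∫ b : {k // k ∉ J} → ℝ, hyperF A I J (fun i => Real.exp (2 * glue J 0 b i)) *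
        ((expWeight I (glue J 0 b) : ℂ) * Ψ (limitPoint (weight A I) (glue J 0 b)))
      = 2 ^ J.card * ((|minor A I| : ℝ) : ℂ) * ∫ u, (prodKern (fun l => 2 * rowPair A u l) : ℂ) *
        ((expWeight I u : ℂ) * Ψ (limitPoint (weight A I) u)) := by
  have h1 := integrable_prodKern_mul_limit hA hΨ hc hw
  have h2 := ((measurePreserving_glue J).integrable_comp_emb (measurableEmbedding_glue J)).mpr h1
  rw [Measure.volume_eq_prod] at h2
  simp only [Function.comp_def] at h2
  rw [← (measurePreserving_glue J).integral_comp (measurableEmbedding_glue J)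
    (fun u => (prodKern (fun l => 2 * rowPair A u l) : ℂ) *
        ((expWeight I u : ℂ) * Ψ (limitPoint (weight A I) u))), Measure.volume_eq_prod,
    integral_prod_symm _ h2, ← integral_const_mul]
  refine integral_congr_ae (Eventually.of_forall fun b => ?_)
  have h4 : (2 ^ J.card * ((|minor A I| : ℝ) : ℂ)) ≠ 0 :=
    mul_ne_zero (pow_ne_zero _ two_ne_zero) (by exact_mod_cast (abs_pos.mpr hA).ne')
  simp only [fun a => expWeight_glue hJ a 0 b, fun a => limitPoint_glue hwJ a 0 b]
  rw [integral_mul_const, integral_prodKern_glue A hA hJ 0 b, mul_assoc (2 ^ J.card * _)⁻¹, mul_inv_cancel_left₀ h4]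

/-- The product of residue and principal value currents exists, and its value is an integral over
the logarithmic space. -/
theorem hasProductValue (hA : minor A I ≠ 0) (hJ : J ⊆ I.1) {φ : Cn n → ℂ} (hφ : Continuous φ)
    (hc : HasCompactSupport φ) {Ψ : (Fin n → ℝ) → ℂ} (hΨ : IsCoefficient φ (order A I) Ψ)
    (hw : ∀ j, 0 ≤ weight A I j) (hwJ : ∀ j, j ∈ J ↔ 0 < weight A I j) :
    HasProductValue A I J (hyperF A I J) φ ((2 * Complex.I) ^ n * ((|minor A I| : ℝ) : ℂ) *
      ∫ u, (prodKern (fun l => 2 * rowPair A u l) : ℂ) *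
        ((expWeight I u : ℂ) * Ψ (limitPoint (weight A I) u))) := by
  refine ⟨fun ε hε => (tubeIntegral_eq_polar hA hJ hφ hc hε).1, ?_⟩
  obtain ⟨R, hR⟩ := exists_support_bound hc
  obtain ⟨B, hB⟩ := hΨ.exists_bound hR I
  have hlim : Tendsto (fun ε : Fin n → ℝ => ∫ b : {k // k ∉ J} → ℝ,
        (tubeBox J ε).indicator (fun b => hyperF A I J (fun i => Real.exp (2 * glue J 0 b i)) *
          ((expWeight I (tubeLog J ε b) : ℂ) * Ψ (fun j => Real.exp (tubeLog J ε b j)))) b)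
      (𝓝[{ε : Fin n → ℝ | ∀ i, 0 < ε i}] 0)
      (𝓝 (∫ b : {k // k ∉ J} → ℝ, hyperF A I J (fun i => Real.exp (2 * glue J 0 b i)) *
        ((expWeight I (glue J 0 b) : ℂ) * Ψ (limitPoint (weight A I) (glue J 0 b))))) := by
    refine tendsto_integral_filter_of_dominated_convergence
      (fun b => B * ‖hyperF A I J (fun i => Real.exp (2 * glue J 0 b i)) * (cutWeight I R (glue J 0 b) : ℂ)‖)
      ?_ ?_ ((integrable_hyperF_mul_cutWeight hA hJ R).norm.const_mul B) ?_
    · refine Eventually.of_forall fun ε => AEStronglyMeasurable.indicator ?_ (measurableSet_tubeBox ε)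
      have h1 : Continuous fun b => tubeLog J ε b := continuous_glue_right _
      refine (((continuous_hyperF_exp A I J hA).comp (continuous_glue_right 0)).mul
        ((Complex.continuous_ofReal.comp (continuous_expWeight.comp h1)).mul
          (hΨ.continuous.comp (continuous_pi fun j => ?_)))).aestronglyMeasurable
      exact Real.continuous_exp.comp ((continuous_apply j).comp h1)
    · refine Eventually.of_forall fun ε => Eventually.of_forall fun b => ?_
      refine (norm_indicator_le_norm_self _ _).trans ?_
      have h1 := hB (tubeLog J ε b)
      rw [tubeLog, cutWeight_glue hJ R _ 0 b, ← tubeLog] at h1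
      rw [norm_mul, norm_mul (hyperF A I J _) (cutWeight I R (glue J 0 b) : ℂ), Complex.norm_real,
        Real.norm_of_nonneg (cutWeight_nonneg R _), mul_left_comm]
      exact mul_le_mul_of_nonneg_left h1 (norm_nonneg _)
    · refine Eventually.of_forall fun b => ?_
      have hpos : ∀ᶠ ε : Fin n → ℝ in 𝓝[{ε : Fin n → ℝ | ∀ i, 0 < ε i}] 0, ∀ i, 0 < ε i :=
        self_mem_nhdsWithin
      have hcoord : ∀ i, Tendsto (fun ε : Fin n → ℝ => ε i) (𝓝[{ε : Fin n → ℝ | ∀ i, 0 < ε i}] 0) (𝓝 0) :=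
        fun i => ((continuous_apply i).tendsto' 0 0 rfl).mono_left nhdsWithin_le_nhds
      have hbox : ∀ᶠ ε in 𝓝[{ε : Fin n → ℝ | ∀ i, 0 < ε i}] 0, b ∈ tubeBox J ε := by
        have : ∀ᶠ ε in 𝓝[{ε : Fin n → ℝ | ∀ i, 0 < ε i}] 0, ∀ k : {k // k ∉ J}, ε k.1 < Real.exp (b k) :=
          eventually_all.mpr fun k => (hcoord k).eventually_lt_const (Real.exp_pos _)
        filter_upwards [hpos, this] with ε h1 h2 k
        exact (Real.log_lt_iff_lt_exp (h1 k)).mpr (h2 k)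
      have hpt : Tendsto (fun ε : Fin n → ℝ => fun j => Real.exp (tubeLog J ε b j))
          (𝓝[{ε : Fin n → ℝ | ∀ i, 0 < ε i}] 0) (𝓝 (limitPoint (weight A I) (glue J 0 b))) := by
        refine tendsto_pi_nhds.mpr fun j => ?_
        simp only [limitPoint, ← hwJ, tubeLog, glue_apply]
        split_ifs with h
        · refine (hcoord j).congr' ?_
          filter_upwards [hpos] with ε h1
          exact (Real.exp_log (h1 j)).symm
        · exact tendsto_const_nhds
      have h2 := (((hΨ.continuous.tendsto _).comp hpt).const_mul (expWeight I (glue J 0 b) : ℂ)).const_mul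
        (hyperF A I J (fun i => Real.exp (2 * glue J 0 b i)))
      refine h2.congr' ?_
      filter_upwards [hbox] with ε h1
      rw [Set.indicator_of_mem h1, show expWeight I (tubeLog J ε b) = expWeight I (glue J 0 b) from
        expWeight_glue hJ _ 0 b]
      rfl
  have h5 := hlim.const_mul (Complex.I ^ J.card * (2 * Complex.I) ^ (n - J.card))
  rw [integral_limit_eq hA hJ hc hΨ hw hwJ, ← mul_assoc, ← mul_assoc] at h5
  have h6 : Complex.I ^ J.card * (2 * Complex.I) ^ (n - J.card) * 2 ^ J.card = (2 * Complex.I) ^ n := by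
    have hle : J.card ≤ n := (Finset.card_le_univ J).trans_eq (Fintype.card_fin n)
    rw [mul_right_comm, mul_comm (Complex.I ^ _), ← mul_pow, ← pow_add, Nat.add_sub_cancel' hle]
  rw [h6] at h5
  refine h5.congr' ?_
  filter_upwards [self_mem_nhdsWithin] with ε hε
  exact (tubeIntegral_eq hA hJ hφ hc hΨ hε).symm

theorem hyperF_eq_one (x : Fin n → ℝ) : hyperF A I I.1 x = 1 := by
  have : IsEmpty (FreeIdx I I.1) := ⟨fun ν => ν.2 (idx_mem I ν.1)⟩
  simp [hyperF, mbIntegrand, Measure.real, volume_pi]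

end BMResidue

end

section

namespace BMResidue

/-! ### The components of the residue current -/

variable {n p : ℕ} {A : Matrix (Fin p) (Fin n) ℕ} {I : PSubset n p}

theorem levelDensity_ae_eq_zero (hp : 1 ≤ p) (hpn : p ≤ n) (hA : minor A I = 0)
    (φ : PSubset n p → Cn n → ℂ) (η : ℝ) :
    levelDensity (normSqMap (monomialMap A)) (omegaWedge (monomialMap A) (component φ I))
      =ᵐ[(μHE[2 * n - 1]).restrict {z : Cn n | normSqMap (monomialMap A) z = η}] 0 := by
  rw [Measure.restrict_congr_set (level_ae_eq A η)]
  refine ae_restrict_of_forall_mem ?_ fun z hz => ?_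
  · refine ((isClosed_singleton (x := η)).preimage (contDiff_normSqMap A).continuous).measurableSet.inter ?_
    have : {z : Cn n | ∀ j, z j ≠ 0} = ⋂ j, {z : Cn n | z j ≠ 0} := by ext; simp
    rw [this]
    exact MeasurableSet.iInter fun j => ((isClosed_singleton (x := (0 : ℂ))).preimage
      (dz j).continuous).isOpen_compl.measurableSet
  · rw [levelDensity, dWedge_omegaWedge_component hp hpn, monomialMinor_eq A I hz.2, hA]
    simp

theorem hasBMResidue_of_minor_eq_zero (hp : 1 ≤ p) (hpn : p ≤ n) (hA : minor A I = 0)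
    (φ : PSubset n p → Cn n → ℂ) : HasBMResidue (monomialMap A) (component φ I) 0 := by
  constructor
  · exact Eventually.of_forall fun η =>
      (integrable_zero _ _ _).congr (levelDensity_ae_eq_zero hp hpn hA φ η).symm
  · have : ∀ η, levelIntegral (normSqMap (monomialMap A)) η (omegaWedge (monomialMap A) (component φ I)) = 0 :=
      fun η => integral_eq_zero_of_ae (levelDensity_ae_eq_zero hp hpn hA φ η)
    simp only [this, mul_zero]
    exact tendsto_const_nhds

theorem neg_one_pow_mul_formConst (hpn : p ≤ n) (I : PSubset n p) :
    (-1) ^ (p * (p - 1) / 2) * formConst I = signConst I * (2 * Complex.I) ^ n := by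
  obtain ⟨m, rfl⟩ := Nat.exists_eq_add_of_le hpn
  have h1 : ∀ k : ℕ, ∃ c, k * (k - 1) / 2 = c ∧ 2 * c + k = k * k := by
    intro k
    refine ⟨_, rfl, ?_⟩
    have := Nat.div_mul_cancel (Nat.even_mul_pred_self k).two_dvd
    rcases k with _ | k
    · rfl
    · simp only [Nat.add_sub_cancel] at this ⊢
      linarith
  obtain ⟨a, ha, ha'⟩ := h1 p
  obtain ⟨b, hb, hb'⟩ := h1 (p + m)
  obtain ⟨c, hc, hc'⟩ := h1 (m + 1)
  rw [Nat.add_sub_cancel] at hc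
  have h2 : a + p * (p + m) + b + (p + m) = c + 2 * (p * p + p * m) := by linarith
  rw [formConst, signConst, Nat.add_sub_cancel_left, ha, hb, hc,
    show -2 * Complex.I = (-1) * (2 * Complex.I) by ring, mul_pow (-1 : ℂ), pow_add (-1 : ℂ) _ c]
  have h3 : (-1 : ℂ) ^ a * (-1) ^ (p * (p + m)) * (-1) ^ b * (-1) ^ (p + m) = (-1) ^ c := by
    rw [← pow_add, ← pow_add, ← pow_add, h2, pow_add, pow_mul]
    simp
  linear_combination ((-1 : ℂ) ^ (∑ i ∈ I.1, ((i : ℕ) + 1) + p * (p + 1) / 2) * (2 * Complex.I) ^ (p + m)) * h3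

theorem bmConst_mul_formConst (hpn : p ≤ n) (A : Matrix (Fin p) (Fin n) ℕ) (I : PSubset n p) (X : ℂ) :
    bmConst p * (formConst I * minor A I / ((p - 1).factorial : ℂ) * X)
      = fullConst A I * ((2 * Complex.I) ^ n * ((|minor A I| : ℝ) : ℂ) * X) := by
  have h1 : (minor A I : ℂ) = (Real.sign (minor A I) : ℂ) * ((|minor A I| : ℝ) : ℂ) := by
    rw [← Complex.ofReal_mul, show Real.sign (minor A I) * |minor A I| = minor A I from ?_]
    rcases lt_trichotomy (minor A I) 0 with h | h | h
    · rw [Real.sign_of_neg h, abs_of_neg h, neg_one_mul, neg_neg]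
    · simp [h]
    · rw [Real.sign_of_pos h, abs_of_pos h, one_mul]
  have hfac : ((p - 1).factorial : ℂ) ≠ 0 := by exact_mod_cast (p - 1).factorial_ne_zero
  have h2 := neg_one_pow_mul_formConst hpn I
  rw [bmConst, fullConst, h1]
  field_simp
  linear_combination (Real.sign (minor A I) : ℂ) * ((|minor A I| : ℝ) : ℂ) * X * h2

/-- The residue current on the component `φ_I dζ ∧ dζ̄[I]` of a test form. -/
theorem exists_hasBMResidue_component (hp : 1 ≤ p) (hpn : p ≤ n) (A : Matrix (Fin p) (Fin n) ℕ)
    {φ : PSubset n p → Cn n → ℂ} (hφ : IsTestForm φ) (I : PSubset n p) :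
    ∃ T : ℂ, HasBMResidue (monomialMap A) (component φ I) T ∧
      (minor A I = 0 → T = 0) ∧ (codim A I = 0 → T = 0) ∧
      (minor A I ≠ 0 → 1 ≤ codim A I → ∃ S : ℂ,
        HasProductValue A I (faceSet A I) (hyperF A I (faceSet A I)) (φ I) S ∧
        T = fullConst A I * S ∧
        (faceSet A I = I.1 → HasProductValue A I (faceSet A I) (fun _ => 1) (φ I) S)) := by
  by_cases hA : minor A I = 0
  · exact ⟨0, hasBMResidue_of_minor_eq_zero hp hpn hA φ, fun _ => rfl, fun _ => rfl, fun h => absurd hA h⟩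
  have hc := (hφ I).2
  have hcont := (hφ I).1.continuous
  obtain ⟨Ψ, h1, h2⟩ := exists_coefficient (hφ I).1 (order A I)
  have hΨ : IsCoefficient (φ I) (order A I) Ψ := ⟨h1, h2⟩
  obtain ⟨j₀, hj₀⟩ := exists_weight_pos hp hA
  have hint : ∀ᶠ η in 𝓝[>] (0 : ℝ), IntegrableOn
      (levelDensity (normSqMap (monomialMap A)) (omegaWedge (monomialMap A) (component φ I)))
      {z : Cn n | normSqMap (monomialMap A) z = η} (μHE[2 * n - 1]) := by
    filter_upwards [self_mem_nhdsWithin] with η hη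
    exact (levelIntegral_eq hp hpn hA hcont hc hΨ hj₀ hη).1
  by_cases hw : ∀ j, 0 ≤ weight A I j
  · have hcodim := codim_eq_card hA hw
    have hpos : 0 < codim A I := by
      rw [hcodim]
      exact Finset.card_pos.mpr ⟨j₀, (mem_faceSet_iff hA hw j₀).mpr hj₀⟩
    have hS := hasProductValue hA faceSet_subset hcont hc hΨ hw (mem_faceSet_iff hA hw)
    refine ⟨_, ⟨hint, (tendsto_levelIntegral_of_nonneg hp hpn hA hcont hc hΨ hw).const_mul (bmConst p)⟩,
      fun h => absurd h hA, fun h => absurd h hpos.ne', fun _ _ => ⟨_, hS, bmConst_mul_formConst hpn A I _, fun hJ => ?_⟩⟩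
    have hF : hyperF A I (faceSet A I) = fun _ => 1 := funext fun x => by rw [hJ, hyperF_eq_one]
    rwa [hF] at hS
  · push Not at hw
    obtain ⟨j, hj⟩ := hw
    have hcodim := codim_eq_zero hA hj
    refine ⟨0, ⟨hint, ?_⟩, fun _ => rfl, fun _ => rfl, fun _ h => by omega⟩
    have h3 := (tendsto_levelIntegral_of_neg hp hpn hA hcont hc hΨ hj).const_mul (bmConst p)
    rwa [mul_zero] at h3

theorem omegaWedge_eq_sum (f : Fin p → Cn n → ℂ) (φ : PSubset n p → Cn n → ℂ) (z : Cn n)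
    (v : Fin (2 * n - 1) → Cn n) : omegaWedge f φ z v = ∑ I, omegaWedge f (component φ I) z v := by
  simp only [omegaWedge]
  rw [Finset.sum_comm (s := (Finset.univ : Finset (PSubset n p))) (t := (Finset.univ : Finset (Fin p)))]
  refine Finset.sum_congr rfl fun k _ => ?_
  rw [Finset.sum_comm]
  refine Finset.sum_congr rfl fun I _ => ?_
  rw [Finset.sum_eq_single I]
  · simp [component]
  · intro I' _ h
    simp [component, Pi.single_eq_of_ne h.symm]
  · simp

theorem levelDensity_eq_sum (g : Cn n → ℝ) (f : Fin p → Cn n → ℂ) (φ : PSubset n p → Cn n → ℂ) (z : Cn n) :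
    levelDensity g (omegaWedge f φ) z = ∑ I, levelDensity g (omegaWedge f (component φ I)) z := by
  simp only [levelDensity, dWedge, ← Finset.sum_div]
  congr 1
  rw [Finset.sum_comm]
  refine Finset.sum_congr rfl fun i _ => ?_
  rw [omegaWedge_eq_sum, Finset.mul_sum]

/-- The residue current of a test form is the sum of its values on the components. -/
theorem HasBMResidue.sum {f : Fin p → Cn n → ℂ} {φ : PSubset n p → Cn n → ℂ} {T : PSubset n p → ℂ}
    (h : ∀ I, HasBMResidue f (component φ I) (T I)) : HasBMResidue f φ (∑ I, T I) := by
  have hint := eventually_all.mpr fun I => (h I).1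
  have hD := funext (levelDensity_eq_sum (normSqMap f) f φ)
  constructor
  · filter_upwards [hint] with η hη
    rw [hD]
    exact integrable_finsetSum _ fun I _ => hη I
  · refine (tendsto_finsetSum Finset.univ fun I _ => (h I).2).congr' ?_
    filter_upwards [hint] with η hη
    rw [← Finset.mul_sum, levelIntegral, hD, integral_finsetSum _ fun I _ => hη I]
    rfl

end BMResidue

open BMResidue
theorem theorem1 (n p : ℕ) (hp : 1 ≤ p) (hpn : p ≤ n) (A : Matrix (Fin p) (Fin n) ℕ) :
    -- the set `J(I)` has `q(I)` elements and cuts out the cone `K₀^I`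
    (∀ I : PSubset n p, minor A I ≠ 0 → 1 ≤ codim A I →
      faceSet A I ⊆ I.1 ∧ (faceSet A I).card = codim A I ∧
      cone A I = face A I (faceSet A I) ∧
      ∀ J ⊆ I.1, J.card = codim A I → cone A I = face A I J → J = faceSet A I) ∧
    -- the Mellin–Barnes integral converges absolutely
    (∀ I : PSubset n p, minor A I ≠ 0 → 1 ≤ codim A I →
      ∀ x : Fin n → ℝ, (∀ i, 0 < x i) → Integrable (mbIntegrand A I (faceSet A I) x)) ∧
    -- the decomposition of the current
    ∃ T : PSubset n p → (PSubset n p → Cn n → ℂ) → ℂ,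
      ∀ φ : PSubset n p → Cn n → ℂ, IsTestForm φ →
        HasBMResidue (monomialMap A) φ (∑ I, T I φ) ∧
        ∀ I : PSubset n p,
          HasBMResidue (monomialMap A) (component φ I) (T I φ) ∧
          (minor A I = 0 → T I φ = 0) ∧
          (codim A I = 0 → T I φ = 0) ∧
          (minor A I ≠ 0 → 1 ≤ codim A I →
            ∃ S : ℂ,
              HasProductValue A I (faceSet A I) (hyperF A I (faceSet A I)) (φ I) S ∧
              T I φ = fullConst A I * S ∧
              (faceSet A I = I.1 →
                HasProductValue A I (faceSet A I) (fun _ => 1) (φ I) S)) := by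
  refine ⟨fun I hA hc => ?_, fun I hA _ x hx => integrable_mbIntegrand A I _ hA hx, ?_⟩
  · have hw : ∀ j, 0 ≤ weight A I j := fun j => by
      by_contra hj
      have := codim_eq_zero hA (not_le.mp hj)
      omega
    exact ⟨faceSet_subset, (codim_eq_card hA hw).symm, cone_eq_face hA hw,
      fun J hJ _ h => eq_faceSet hA hJ h⟩
  · choose T hT using fun (I : PSubset n p) (φ : {φ : PSubset n p → Cn n → ℂ // IsTestForm φ}) =>
      exists_hasBMResidue_component hp hpn A φ.2 I
    classical
    refine ⟨fun I φ => if h : IsTestForm φ then T I ⟨φ, h⟩ else 0, fun φ hφ => ?_⟩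
    simp only [dif_pos hφ]
    exact ⟨HasBMResidue.sum fun I => (hT I ⟨φ, hφ⟩).1, fun I => hT I ⟨φ, hφ⟩⟩

end
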